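/- Let $N=2^n$, index vectors of $\mathbb{R}^N$ by $\mathbb{F}_2^n$, and let $\hat x(i)=N^{-1/2}\sum_{j\in\mathbb{F}_2^n}(-1)^{\langle i,j\rangle}x(j)$ be the Walsh–Hadamard transform of $x\in\mathbb{R}^N$. $H_k(x)$ denotes the vector that agrees with $x$ on $k$ coordinates of largest magnitude and is zero elsewhere. Write $\lg t:=\max\{1,\log_2 t\}$. Algorithms are programs of a randomized real RAM (exact real arithmetic and square roots, addition, truncated subtraction and comparison of natural numbers, indirect addressing, fair coin tosses) with query access to $\hat x$; each operation costs one unit and a query to one coordinate of $\hat x$ costs $n+1$ units ($n$ for the index, one for the result). An algorithm is non-adaptive if the queried positions depend only on its parameters and its coin tosses, not on $\hat x$. There is an absolute constant $c>0$ such that the following hold. 1. There is a randomized non-adaptive algorithm that, given integers $n\ge 1$ and $1\le k\le N$, real parameters $\eta>0$ and $\nu>0$, and query access to $\hat x$ for any $x\in\mathbb{R}^N$, outputs a $k$-sparse vector $\tilde x\in\mathbb{R}^N$ (as a list of index–value pairs) that, with probability at least $1-\eta$ over the coin tosses of the algorithm, satisfies $$\|\tilde x-x\|_1\le c\,\|x-H_k(x)\|_1+\nu\|x\|_1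 ,$$ and that performs in the worst case $$O\bigl(\lg(\lg(1/\nu)/\eta)\cdot\lg(1/\nu)\cdot(k\log_2 k+n^2)\cdot n^2\bigr)$$ operations, with an absolute constant in the $O(\cdot)$. 2. There is a randomized non-adaptive algorithm that is given integers $n\ge1$, $1\le k\le N$, $a\ge 0$, a real number $\eta>0$, and query access to $\hat x$ for any $x\in\mathbb{R}^N$ such that every coefficient of $\hat x$ is a binary fixed-point number with $an$ bits after the binary point and absolute value at most $2^{an}$. It outputs a $k$-sparse $\tilde x\in\mathbb{R}^N$ that, with probability at least $1-\eta$ over the coin tosses, satisfies $$\|\tilde x-x\|_1\le c\,\|x-H_k(x)\|_1 ,$$ and it performs in the worst case $O_a\bigl(\lg(n/\eta)\cdot(k\log_2 k+n^2)\cdot n^3\bigr)$ operations. In particular, for all fixed $a\ge0$, $d\ge0$ and $\delta>0$, whenever $n,k\ge2$, $k\ge\delta n^2$ and $\eta\ge n^{-d}$, the number of operations in the worst case is $O_{a,d,\delta}(k\,n^3\log_2 k\,\log_2 n)=\tilde O(k(\log N)^3)$. -/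

import Mathlib

open MeasureTheory

noncomputable section

namespace SparseHadamard

/-! ### Vectors, the Hadamard transform, best `k`-term approximation -/

/-- The index set `𝔽₂ⁿ`; a vector of `ℝ^N`, `N = 2 ^ n`, is a function `Index n → ℝ`. -/
abbrev Index (n : ℕ) : Type := Fin n → ZMod 2

/-- The normalised Walsh-Hadamard transform
`x̂(i) = N^(-1/2) * ∑ j, (-1)^⟨i, j⟩ * x(j)`, with the inner product over `𝔽₂`. -/
def dht {n : ℕ} (x : Index n → ℝ) : Index n → ℝ := fun i =>
  (1 / Real.sqrt ((2 : ℝ) ^ n)) * ∑ j : Index n, (-1 : ℝ) ^ (i ⬝ᵥ j).val * x j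

/-- The `ℓ₁` norm. -/
def l1 {n : ℕ} (x : Index n → ℝ) : ℝ := ∑ i, |x i|

/-- `x` has at most `k` nonzero entries. -/
def IsSparse {n : ℕ} (k : ℕ) (x : Index n → ℝ) : Prop :=
  (Finset.univ.filter fun i => x i ≠ 0).card ≤ k

/-- `h` is `H_k(x)`: it agrees with `x` on a set of `k` coordinates of largest magnitude and is zero
elsewhere. (Ties may be broken in any way, so that there may be several such `h`.) -/
def IsHead {n : ℕ} (k : ℕ) (x h : Index n → ℝ) : Prop :=
  ∃ S : Finset (Index n), S.card = k ∧ (∀ i ∈ S, ∀ j ∉ S, |x j| ≤ |x i|) ∧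
    (∀ i ∈ S, h i = x i) ∧ ∀ i ∉ S, h i = 0

/-- Every `k ≤ N` and every `x` admit a vector `H_k(x)`. -/
theorem exists_isHead {n k : ℕ} (hk : k ≤ 2 ^ n) (x : Index n → ℝ) : ∃ h, IsHead k x h := by
  classical
  have key : ∀ k : ℕ, k ≤ 2 ^ n → ∃ S : Finset (Index n), S.card = k ∧
      ∀ i ∈ S, ∀ j ∉ S, |x j| ≤ |x i| := by
    intro k
    induction k with
    | zero => exact fun _ => ⟨∅, by simp⟩
    | succ k ih =>
      intro hk
      obtain ⟨S, hS, hmax⟩ := ih (by omega)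
      have hne : (Sᶜ : Finset (Index n)).Nonempty := by
        rw [← Finset.card_pos, Finset.card_compl, hS]
        simp [ZMod.card]
        omega
      obtain ⟨m, hm, hm'⟩ := Finset.exists_max_image Sᶜ (fun i => |x i|) hne
      rw [Finset.mem_compl] at hm
      refine ⟨insert m S, by rw [Finset.card_insert_of_notMem hm, hS], ?_⟩
      intro i hi j hj
      rw [Finset.mem_insert, not_or] at hj
      rcases Finset.mem_insert.1 hi with rfl | hi
      · exact hm' j (by simpa using hj.2)
      · exact hmax i hi j hj.2
  obtain ⟨S, hS, hmax⟩ := key k hk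
  exact ⟨fun i => if i ∈ S then x i else 0, S, hS, hmax,
    fun i hi => by simp [hi], fun i hi => by simp [hi]⟩

/-- All coefficients of `y` are binary fixed-point numbers with `b` bits after the binary point and
absolute value at most `2 ^ b`. -/
def IsFixedPoint {n : ℕ} (b : ℕ) (y : Index n → ℝ) : Prop :=
  ∀ i, |y i| ≤ 2 ^ b ∧ ∃ z : ℤ, y i = z / 2 ^ b

/-! ### The machine: a randomized real RAM with query access to a vector

A memory has countably many arrays of natural numbers and countably many arrays of real numbers.
Programs are finite; they consist of assignments, tests and loops. The available operations are
addition, truncated subtraction and comparison of natural numbers, exact arithmetic (`+ - * /`,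
square root) and comparison of real numbers, conversion of a natural number to a real number,
indirect addressing, tossing a fair coin, and querying one coordinate of the input vector. There is
no operation that turns a real number into a natural number. Each operation is charged one unit,
except that a query, whose `n`-bit index is read from memory bit by bit, is charged `n + 1`. -/

/-- Expressions with a natural number as value; `get a i` is entry `i` of array `a`. -/
inductive NExp : Type
  | lit (c : ℕ)
  | get (a : ℕ) (i : NExp)
  | add (e f : NExp)
  | sub (e f : NExp)

/-- Expressions with a real number as value; `get a i` is entry `i` of array `a`. -/
inductive RExp : Type
  | ofNat (e : NExp)
  | get (a : ℕ) (i : NExp)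
  | add (e f : RExp)
  | sub (e f : RExp)
  | mul (e f : RExp)
  | div (e f : RExp)
  | sqrt (e : RExp)

/-- Tests. -/
inductive BExp : Type
  | nlt (e f : NExp)
  | rlt (e f : RExp)
  | neg (b : BExp)
  | conj (b c : BExp)

/-- Programs. `nset a i e` and `rset a i e` assign `e` to entry `i` of array `a`; `coin a i` stores a
fair random bit in entry `i` of the natural-number array `a`; `query a i b o` stores in entry `i` of
the real array `a` the coordinate of the queried vector whose index is the string of `n` bits in
entries `o, …, o + n - 1` of the natural-number array `b`. -/
inductive Cmd : Type
  | skip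
  | nset (a : ℕ) (i e : NExp)
  | rset (a : ℕ) (i : NExp) (e : RExp)
  | coin (a : ℕ) (i : NExp)
  | query (a : ℕ) (i : NExp) (b : ℕ) (o : NExp)
  | seq (c d : Cmd)
  | ite (b : BExp) (c d : Cmd)
  | loop (b : BExp) (c : Cmd)

/-- A state: the memory, the number of operations performed so far, the number of coins tossed so
far, and the list of the indices queried so far (latest first). -/
structure State (n : ℕ) : Type where
  nat : ℕ → ℕ → ℕ
  real : ℕ → ℕ → ℝ
  time : ℕ
  coins : ℕ
  asked : List (Index n)

variable {n : ℕ}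

/-- The value of an expression. -/
def NExp.eval (s : State n) : NExp → ℕ
  | .lit c => c
  | .get a i => s.nat a (i.eval s)
  | .add e f => e.eval s + f.eval s
  | .sub e f => e.eval s - f.eval s

/-- The number of operations in an expression. -/
def NExp.cost : NExp → ℕ
  | .lit _ => 1
  | .get _ i => i.cost + 1
  | .add e f => e.cost + f.cost + 1
  | .sub e f => e.cost + f.cost + 1

/-- The value of an expression (with `y / 0 = 0` and `√y = 0` for `y < 0`). -/
def RExp.eval (s : State n) : RExp → ℝ
  | .ofNat e => (e.eval s : ℝ)
  | .get a i => s.real a (i.eval s)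
  | .add e f => e.eval s + f.eval s
  | .sub e f => e.eval s - f.eval s
  | .mul e f => e.eval s * f.eval s
  | .div e f => e.eval s / f.eval s
  | .sqrt e => Real.sqrt (e.eval s)

/-- The number of operations in an expression. -/
def RExp.cost : RExp → ℕ
  | .ofNat e => e.cost + 1
  | .get _ i => i.cost + 1
  | .add e f => e.cost + f.cost + 1
  | .sub e f => e.cost + f.cost + 1
  | .mul e f => e.cost + f.cost + 1
  | .div e f => e.cost + f.cost + 1
  | .sqrt e => e.cost + 1

/-- The truth value of a test. -/
def BExp.Holds (s : State n) : BExp → Prop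
  | .nlt e f => e.eval s < f.eval s
  | .rlt e f => e.eval s < f.eval s
  | .neg b => ¬ b.Holds s
  | .conj b c => b.Holds s ∧ c.Holds s

/-- The number of operations in a test. -/
def BExp.cost : BExp → ℕ
  | .nlt e f => e.cost + f.cost + 1
  | .rlt e f => e.cost + f.cost + 1
  | .neg b => b.cost + 1
  | .conj b c => b.cost + c.cost + 1

/-- Charge `t` operations. -/
def State.tick (s : State n) (t : ℕ) : State n := { s with time := s.time + t }

/-- Overwrite entry `i` of the natural-number array `a`. -/
def State.setNat (s : State n) (a i v : ℕ) : State n :=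
  { s with nat := Function.update s.nat a (Function.update (s.nat a) i v) }

/-- Overwrite entry `i` of the real array `a`. -/
def State.setReal (s : State n) (a i : ℕ) (v : ℝ) : State n :=
  { s with real := Function.update s.real a (Function.update (s.real a) i v) }

/-- The element of `𝔽₂ⁿ` whose bits are the entries `o, …, o + n - 1` (mod 2) of array `b`. -/
def State.bits (s : State n) (b o : ℕ) : Index n := fun j => (s.nat b (o + j) : ZMod 2)

/-- `Exec y ω c s s'`: with query access to `y` and the sequence `ω` of coin tosses, the program `c`
started in state `s` halts in state `s'`. -/
inductive Exec (y : Index n → ℝ) (ω : ℕ → Bool) : Cmd → State n → State n → Prop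
  | skip (s : State n) : Exec y ω .skip s (s.tick 1)
  | nset (s : State n) (a : ℕ) (i e : NExp) :
      Exec y ω (.nset a i e) s ((s.setNat a (i.eval s) (e.eval s)).tick (i.cost + e.cost + 1))
  | rset (s : State n) (a : ℕ) (i : NExp) (e : RExp) :
      Exec y ω (.rset a i e) s ((s.setReal a (i.eval s) (e.eval s)).tick (i.cost + e.cost + 1))
  | coin (s : State n) (a : ℕ) (i : NExp) :
      Exec y ω (.coin a i) s
        { (s.setNat a (i.eval s) (if ω s.coins then 1 else 0)).tick (i.cost + 1) with
          coins := s.coins + 1 }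
  | query (s : State n) (a : ℕ) (i : NExp) (b : ℕ) (o : NExp) :
      Exec y ω (.query a i b o) s
        { (s.setReal a (i.eval s) (y (s.bits b (o.eval s)))).tick (i.cost + o.cost + n + 1) with
          asked := s.bits b (o.eval s) :: s.asked }
  | seq {c d : Cmd} {s s' s'' : State n} :
      Exec y ω c s s' → Exec y ω d s' s'' → Exec y ω (.seq c d) s s''
  | iteTrue {b : BExp} {c d : Cmd} {s s' : State n} :
      b.Holds s → Exec y ω c (s.tick (b.cost + 1)) s' → Exec y ω (.ite b c d) s s'
  | iteFalse {b : BExp} {c d : Cmd} {s s' : State n} :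
      ¬ b.Holds s → Exec y ω d (s.tick (b.cost + 1)) s' → Exec y ω (.ite b c d) s s'
  | loopDone {b : BExp} {c : Cmd} {s : State n} :
      ¬ b.Holds s → Exec y ω (.loop b c) s (s.tick (b.cost + 1))
  | loopStep {b : BExp} {c : Cmd} {s s' s'' : State n} :
      b.Holds s → Exec y ω c (s.tick (b.cost + 1)) s' → Exec y ω (.loop b c) s' s'' →
      Exec y ω (.loop b c) s s''

/-- The final state is determined by the program, the start, the queried vector and the coins. -/
theorem Exec.deterministic {y : Index n → ℝ} {ω : ℕ → Bool} {c : Cmd} {s t t' : State n}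
    (h : Exec y ω c s t) (h' : Exec y ω c s t') : t = t' := by
  induction h generalizing t' with
  | skip | nset | rset | coin | query => cases h'; rfl
  | seq _ _ ih₁ ih₂ =>
    cases h' with
    | seq h₁ h₂ => obtain rfl := ih₁ h₁; exact ih₂ h₂
  | iteTrue hb _ ih =>
    cases h' with
    | iteTrue _ h₁ => exact ih h₁
    | iteFalse hb' _ => exact absurd hb hb'
  | iteFalse hb _ ih =>
    cases h' with
    | iteTrue hb' _ => exact absurd hb' hb
    | iteFalse _ h₁ => exact ih h₁
  | loopDone hb =>
    cases h' with
    | loopDone _ => rfl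
    | loopStep hb' _ _ => exact absurd hb' hb
  | loopStep hb _ _ ih₁ ih₂ =>
    cases h' with
    | loopDone hb' => exact absurd hb hb'
    | loopStep _ h₁ h₂ => obtain rfl := ih₁ h₁; exact ih₂ h₂

/-- The initial state: the parameters are in the arrays with number `0`, all other entries are
zero. -/
def State.init (n : ℕ) (u : List ℕ) (v : List ℝ) : State n where
  nat a i := if a = 0 then u.getD i 0 else 0
  real a i := if a = 0 then v.getD i 0 else 0
  time := 0
  coins := 0
  asked := []

/-- The vector that a final state represents as a list of index-value pairs: entry `0` of the
natural-number array `1` is the number of pairs, the index of pair `p` is stored as `n` bits in the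
natural-number array `2` from entry `p * n` on, and its value is entry `p` of the real array `1`. -/
def State.output (s : State n) : Index n → ℝ := fun i =>
  ∑ p ∈ Finset.range (s.nat 1 0), if s.bits 2 (p * n) = i then s.real 1 p else 0

/-- The law of an infinite sequence of independent fair coin tosses. -/
def coinLaw : Measure (ℕ → Bool) :=
  Measure.infinitePi fun _ : ℕ => (PMF.uniformOfFintype Bool).toMeasure

/-- On query access to `dht x` with `x ∈ X`, the program always (for all coin tosses) halts after at
most `T` operations. -/
def RunsWithin (P : Cmd) (s₀ : State n) (X : Set (Index n → ℝ)) (T : ℝ) : Prop :=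
  ∀ x ∈ X, ∀ ω, ∃ s, Exec (dht x) ω P s₀ s ∧ (s.time : ℝ) ≤ T

/-- The indices that the program queries depend on the coin tosses, but not on the vector queried. -/
def IsNonadaptive (P : Cmd) (s₀ : State n) (X : Set (Index n → ℝ)) : Prop :=
  ∀ x ∈ X, ∀ x' ∈ X, ∀ ω s s', Exec (dht x) ω P s₀ s → Exec (dht x') ω P s₀ s' →
    s.asked = s'.asked

/-- The output is always `k`-sparse and, for each single `x ∈ X`, with probability at least `1 - η`
over the coin tosses the output `x̃` satisfies `‖x̃ - x‖₁ ≤ c * ‖x - H_k(x)‖₁ + ν * ‖x‖₁`. -/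
def Recovers (P : Cmd) (s₀ : State n) (X : Set (Index n → ℝ)) (k : ℕ) (η c ν : ℝ) : Prop :=
  (∀ x ∈ X, ∀ ω s, Exec (dht x) ω P s₀ s → IsSparse k s.output) ∧
  ∀ x ∈ X, ∀ h, IsHead k x h →
    1 - η ≤ coinLaw.real {ω | ∃ s, Exec (dht x) ω P s₀ s ∧
      l1 (s.output - x) ≤ c * l1 (x - h) + ν * l1 x}

/-- `max {1, log₂ t}`. -/
def lg (t : ℝ) : ℝ := max 1 (Real.logb 2 t)

end SparseHadamard

end

/-! The algorithm hashes the indices linearly. A random `m × n` matrix `M` over `𝔽₂` sends `i` to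
one of `2 ^ m ≥ 64 k` buckets. Reading the transform of `x` at the sums of rows of `M`, shifted by a
vector `u`, and applying a Walsh-Hadamard transform of length `2 ^ m` yields, for every bucket, the
sum of `(-1)^⟨u, i⟩ x(i)` over its members (`walsh_dht`). With `u = 0` this estimates the
coefficients. With `u` a unit vector it reveals a digit: if `|x(i)|` exceeds the absolute sum of the
rest of its bucket, all these sums have the sign of their main term, and comparing signs spells out
`i` (`candidate_hash`).

Let `S` be the support of the head, `σ` the `ℓ₁` norm of `x` off `S`, and `τ = σ / k`. For a fixed
`i`, the rest of its bucket weighs more than `τ` with probability at most `1/32`: a collision with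
another index of `S` and, by Markov's inequality, too large a share of the tail each have
probability at most `k / 2 ^ m` (`card_noisy_mul_le`). In `R` independent repetitions this happens
at least `R / 2` times with probability at most `2 ^ (-R)` (`card_majority_mul_le`).

An index is listed if it is read off at least `R / 2` times; as there are `R 2 ^ m` readings, at
most `2 * 2 ^ m` indices are listed (`length_le_of_tally`). Listed coefficients are estimated by
medians over a second family of `R` matrices, independent of the first one and hence of the list. A
union bound over `S` for the first family and over the list for the second one gives failure
probability at most `3 * 2 ^ m * 2 ^ (-R)` (`card_not_separated_mul_le`), which is at most `η` once
`R ≥ m + 2 + log₂ (1 / η)` (`le_coinLaw_separated`). Otherwise every coefficient of `S` above `τ` is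
listed and every listed estimate is correct up to `τ`. Keeping the `k` largest estimates then costs
at most `σ + 3 k τ = 4 σ` (`l1_selected_sub_le`). This bound holds for all real `x` and has no
additive term, so one program with `c = 4` proves both parts.

The time is of order `R * 2 ^ m * n ^ 2`, where `2 ^ m = O(k)` and `R = O(log k + lg (1 / η))`
(`cost_le`, `mul_minReps_le`). If `R` would exceed `2 ^ n`, a single repetition with the identity as
hash function replaces everything; it has no collisions, and it keeps `log₂ R ≤ n`, which bounds the
cost of computing medians.

Programs are verified with a weakest-precondition calculus that also tracks time. Nonadaptivity is
syntactic: while queries are made, their answers stay in one real array that no test reads; the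
evaluation afterwards queries nothing. -/

noncomputable section

namespace SparseHadamard

variable {n : ℕ}

/-! ### A calculus for programs -/

namespace State

@[simp] theorem tick_nat (s : State n) (t : ℕ) : (s.tick t).nat = s.nat := rfl
@[simp] theorem tick_real (s : State n) (t : ℕ) : (s.tick t).real = s.real := rfl
@[simp] theorem tick_time (s : State n) (t : ℕ) : (s.tick t).time = s.time + t := rfl
@[simp] theorem tick_coins (s : State n) (t : ℕ) : (s.tick t).coins = s.coins := rfl
@[simp] theorem setNat_real (s : State n) (a i v : ℕ) : (s.setNat a i v).real = s.real := rfl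
@[simp] theorem setNat_time (s : State n) (a i v : ℕ) : (s.setNat a i v).time = s.time := rfl
@[simp] theorem setNat_coins (s : State n) (a i v : ℕ) : (s.setNat a i v).coins = s.coins := rfl
@[simp] theorem setReal_nat (s : State n) (a i : ℕ) (v : ℝ) : (s.setReal a i v).nat = s.nat := rfl
@[simp] theorem setReal_time (s : State n) (a i : ℕ) (v : ℝ) :
    (s.setReal a i v).time = s.time := rfl

@[simp] theorem setNat_nat_apply (s : State n) (a i v b j : ℕ) :
    (s.setNat a i v).nat b j = if b = a ∧ j = i then v else s.nat b j := by
  by_cases hb : b = a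
  · subst hb; simp [setNat, Function.update_apply]
  · simp [setNat, hb]

@[simp] theorem setReal_real_apply (s : State n) (a i : ℕ) (v : ℝ) (b j : ℕ) :
    (s.setReal a i v).real b j = if b = a ∧ j = i then v else s.real b j := by
  by_cases hb : b = a
  · subst hb; simp [setReal, Function.update_apply]
  · simp [setReal, hb]

@[simp] theorem setNat_nat_of_ne (s : State n) {a b : ℕ} (i v : ℕ) (h : b ≠ a) :
    (s.setNat a i v).nat b = s.nat b := by simp [setNat, h]

@[simp] theorem setReal_real_of_ne (s : State n) {a b : ℕ} (i : ℕ) (v : ℝ) (h : b ≠ a) :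
    (s.setReal a i v).real b = s.real b := by simp [setReal, h]

end State

/-- The arrays of natural numbers that a program may write. -/
def Cmd.nw : Cmd → List ℕ
  | .skip => []
  | .nset a _ _ => [a]
  | .rset _ _ _ => []
  | .coin a _ => [a]
  | .query _ _ _ _ => []
  | .seq c d => c.nw ++ d.nw
  | .ite _ c d => c.nw ++ d.nw
  | .loop _ c => c.nw

/-- The arrays of real numbers that a program may write. -/
def Cmd.rw : Cmd → List ℕ
  | .skip => []
  | .nset _ _ _ => []
  | .rset a _ _ => [a]
  | .coin _ _ => []
  | .query a _ _ _ => [a]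
  | .seq c d => c.rw ++ d.rw
  | .ite _ c d => c.rw ++ d.rw
  | .loop _ c => c.rw

/-- `s'` agrees with `s` outside the arrays in `W` and `Wr`. -/
structure Frame (W Wr : List ℕ) (s s' : State n) : Prop where
  nat : ∀ a ∉ W, s'.nat a = s.nat a
  real : ∀ a ∉ Wr, s'.real a = s.real a

theorem Frame.refl (W Wr : List ℕ) (s : State n) : Frame W Wr s s := ⟨fun _ _ => rfl, fun _ _ => rfl⟩

theorem Frame.trans {W Wr : List ℕ} {s s' s'' : State n} (h : Frame W Wr s s')
    (h' : Frame W Wr s' s'') : Frame W Wr s s'' :=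
  ⟨fun a ha => (h'.nat a ha).trans (h.nat a ha), fun a ha => (h'.real a ha).trans (h.real a ha)⟩

theorem Frame.mono {W Wr W' Wr' : List ℕ} {s s' : State n} (h : Frame W Wr s s')
    (hW : W ⊆ W') (hWr : Wr ⊆ Wr') : Frame W' Wr' s s' :=
  ⟨fun a ha => h.nat a fun h => ha (hW h), fun a ha => h.real a fun h => ha (hWr h)⟩

theorem Frame.tick {W Wr : List ℕ} {s s' : State n} (h : Frame W Wr s s') (t : ℕ) :
    Frame W Wr s (s'.tick t) := ⟨h.nat, h.real⟩

/-- The frame rule with syntactic write sets: facts about an array that a command never assigns are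
carried across it by computing `nw` and `rw`. -/
theorem Exec.frame {y : Index n → ℝ} {ω : ℕ → Bool} {c : Cmd} {s s' : State n}
    (h : Exec y ω c s s') : Frame c.nw c.rw s s' := by
  induction h with
  | skip s => exact ⟨fun _ _ => rfl, fun _ _ => rfl⟩
  | nset s a i e =>
    refine ⟨fun b hb => ?_, fun _ _ => rfl⟩
    exact s.setNat_nat_of_ne _ _ (by simpa [Cmd.nw] using hb)
  | rset s a i e =>
    refine ⟨fun _ _ => rfl, fun b hb => ?_⟩
    exact s.setReal_real_of_ne _ _ (by simpa [Cmd.rw] using hb)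
  | coin s a i =>
    refine ⟨fun b hb => ?_, fun _ _ => rfl⟩
    exact s.setNat_nat_of_ne _ _ (by simpa [Cmd.nw] using hb)
  | query s a i b o =>
    refine ⟨fun _ _ => rfl, fun b hb => ?_⟩
    exact s.setReal_real_of_ne _ _ (by simpa [Cmd.rw] using hb)
  | seq _ _ ih₁ ih₂ =>
    exact (ih₁.mono (by simp [Cmd.nw]) (by simp [Cmd.rw])).trans
      (ih₂.mono (by simp [Cmd.nw]) (by simp [Cmd.rw]))
  | @iteTrue b c d _ _ _ _ ih =>
    have := ih.mono (W' := (Cmd.ite b c d).nw) (Wr' := (Cmd.ite b c d).rw)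
      (by simp [Cmd.nw]) (by simp [Cmd.rw])
    exact ⟨this.nat, this.real⟩
  | @iteFalse b c d _ _ _ _ ih =>
    have := ih.mono (W' := (Cmd.ite b c d).nw) (Wr' := (Cmd.ite b c d).rw)
      (by simp [Cmd.nw]) (by simp [Cmd.rw])
    exact ⟨this.nat, this.real⟩
  | loopDone _ => exact ⟨fun _ _ => rfl, fun _ _ => rfl⟩
  | loopStep _ _ _ ih₁ ih₂ => exact Frame.trans ⟨ih₁.nat, ih₁.real⟩ ih₂

/-- The program halts in a state that satisfies `Q`. -/
def WP (y : Index n → ℝ) (ω : ℕ → Bool) (c : Cmd) (s : State n) (Q : State n → Prop) : Prop :=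
  ∃ s', Exec y ω c s s' ∧ Q s'

section WP

variable {y : Index n → ℝ} {ω : ℕ → Bool} {s : State n} {Q : State n → Prop}

/-- The consequence rule hands over the frame as well, so that specifications need not mention what
a command leaves alone. -/
theorem WP.mono {c : Cmd} {Q' : State n → Prop} (h : WP y ω c s Q)
    (hQ : ∀ s', Frame c.nw c.rw s s' → Q s' → Q' s') : WP y ω c s Q' :=
  let ⟨s', h₁, h₂⟩ := h
  ⟨s', h₁, hQ s' h₁.frame h₂⟩

@[simp] theorem WP_skip : WP y ω .skip s Q ↔ Q (s.tick 1) :=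
  ⟨fun ⟨_, h, hQ⟩ => by cases h; exact hQ, fun h => ⟨_, .skip s, h⟩⟩

@[simp] theorem WP_nset {a : ℕ} {i e : NExp} : WP y ω (.nset a i e) s Q ↔
    Q ((s.setNat a (i.eval s) (e.eval s)).tick (i.cost + e.cost + 1)) :=
  ⟨fun ⟨_, h, hQ⟩ => by cases h; exact hQ, fun h => ⟨_, .nset s a i e, h⟩⟩

@[simp] theorem WP_rset {a : ℕ} {i : NExp} {e : RExp} : WP y ω (.rset a i e) s Q ↔
    Q ((s.setReal a (i.eval s) (e.eval s)).tick (i.cost + e.cost + 1)) :=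
  ⟨fun ⟨_, h, hQ⟩ => by cases h; exact hQ, fun h => ⟨_, .rset s a i e, h⟩⟩

@[simp] theorem WP_coin {a : ℕ} {i : NExp} : WP y ω (.coin a i) s Q ↔
    Q { (s.setNat a (i.eval s) (if ω s.coins then 1 else 0)).tick (i.cost + 1) with
          coins := s.coins + 1 } :=
  ⟨fun ⟨_, h, hQ⟩ => by cases h; exact hQ, fun h => ⟨_, .coin s a i, h⟩⟩

@[simp] theorem WP_query {a : ℕ} {i : NExp} {b : ℕ} {o : NExp} : WP y ω (.query a i b o) s Q ↔
    Q { (s.setReal a (i.eval s) (y (s.bits b (o.eval s)))).tick (i.cost + o.cost + n + 1) with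
          asked := s.bits b (o.eval s) :: s.asked } :=
  ⟨fun ⟨_, h, hQ⟩ => by cases h; exact hQ, fun h => ⟨_, .query s a i b o, h⟩⟩

@[simp] theorem WP_seq {c d : Cmd} : WP y ω (.seq c d) s Q ↔ WP y ω c s fun s' => WP y ω d s' Q :=
  ⟨fun ⟨_, h, hQ⟩ => by cases h with | seq h₁ h₂ => exact ⟨_, h₁, _, h₂, hQ⟩,
    fun ⟨_, h₁, _, h₂, hQ⟩ => ⟨_, .seq h₁ h₂, hQ⟩⟩

@[simp] theorem WP_ite {b : BExp} {c d : Cmd} : WP y ω (.ite b c d) s Q ↔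
    (b.Holds s → WP y ω c (s.tick (b.cost + 1)) Q) ∧
      (¬ b.Holds s → WP y ω d (s.tick (b.cost + 1)) Q) := by
  constructor
  · rintro ⟨s', h, hQ⟩
    cases h with
    | iteTrue hb h => exact ⟨fun _ => ⟨_, h, hQ⟩, fun hb' => absurd hb hb'⟩
    | iteFalse hb h => exact ⟨fun hb' => absurd hb' hb, fun _ => ⟨_, h, hQ⟩⟩
  · rintro ⟨h₁, h₂⟩
    by_cases hb : b.Holds s
    · obtain ⟨s', h, hQ⟩ := h₁ hb
      exact ⟨s', .iteTrue hb h, hQ⟩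
    · obtain ⟨s', h, hQ⟩ := h₂ hb
      exact ⟨s', .iteFalse hb h, hQ⟩

/-- A loop that makes exactly `N` rounds. -/
theorem WP_loop {b : BExp} {c : Cmd} {N T : ℕ} (I : ℕ → State n → Prop)
    (hT : ∀ i s t, I i s → I i (s.tick t)) (h0 : I 0 s)
    (hI : ∀ i < N, ∀ s', Frame c.nw c.rw s s' → I i s' →
      b.Holds s' ∧ WP y ω c s' fun s'' => s''.time + (b.cost + 1) ≤ s'.time + T ∧ I (i + 1) s'')
    (hN : ∀ s', Frame c.nw c.rw s s' → I N s' → ¬ b.Holds s')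
    (hQ : ∀ s', Frame c.nw c.rw s s' → I N s' →
      s'.time ≤ s.time + (N * T + (b.cost + 1)) → Q s') :
    WP y ω (.loop b c) s Q := by
  have key : ∀ d i, i + d = N → ∀ s₁, Frame c.nw c.rw s s₁ → I i s₁ →
      WP y ω (.loop b c) s₁ fun s₂ => Frame c.nw c.rw s s₂ ∧ I N s₂ ∧
        s₂.time ≤ s₁.time + (d * T + (b.cost + 1)) := by
    intro d
    induction d with
    | zero =>
      intro i hi s₁ hF hs
      obtain rfl : i = N := by omega
      exact ⟨_, .loopDone (hN _ hF hs), hF.tick _, hT _ _ _ hs, by simp⟩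
    | succ d ih =>
      intro i hi s₁ hF hs
      obtain ⟨hb, -⟩ := hI i (by omega) s₁ hF hs
      -- The body starts after the test has been charged. Since `hI` reserves room for one more test
      -- within `T`, the test and the body together take at most `T`.
      obtain ⟨-, s₂, h₂, ht₂, hs₂⟩ := hI i (by omega) (s₁.tick (b.cost + 1)) (hF.tick _)
        (hT _ _ _ hs)
      obtain ⟨s₃, h₃, hF₃, hs₃, ht₃⟩ := ih (i + 1) (by omega) s₂
        ((hF.tick (b.cost + 1)).trans h₂.frame) hs₂
      refine ⟨s₃, .loopStep hb h₂ h₃, hF₃, hs₃, ?_⟩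
      simp only [State.tick_time] at ht₂
      rw [Nat.succ_mul]
      omega
  obtain ⟨s', h, hF, hs, ht⟩ := key N 0 (by omega) s (Frame.refl _ _ _) h0
  exact ⟨s', h, hQ s' hF hs ht⟩

end WP

/-- The scalar variable `v`. -/
abbrev NExp.var (v : ℕ) : NExp := .get v (.lit 0)

/-- `for v in 0, …, b - 1 do c`. -/
def Cmd.for (v : ℕ) (b : NExp) (c : Cmd) : Cmd :=
  .seq (.nset v (.lit 0) (.lit 0))
    (.loop (.nlt (.var v) b) (.seq c (.nset v (.lit 0) (.add (.var v) (.lit 1)))))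

/-- The invariant must survive writes to the counter, so it does not speak of the counter, whose
value is handed over separately. Of the overhead `b.cost + 10` of a round, `b.cost + 4` is the test
and `6` the increment; the same amount covers the initial assignment and the last test. -/
theorem WP_for {y : Index n → ℝ} {ω : ℕ → Bool} {s : State n} {Q : State n → Prop}
    {v : ℕ} {b : NExp} {c : Cmd} {N : ℕ} (T : ℕ) (I : ℕ → State n → Prop) (hv : v ∉ c.nw)
    (hT : ∀ i s t, I i s → I i (s.tick t))
    (hS : ∀ i s x, I i s → I i (s.setNat v 0 x))
    (hb : ∀ s', Frame (v :: c.nw) c.rw s s' → b.eval s' = N) (h0 : I 0 s)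
    (hI : ∀ i < N, ∀ s', Frame (v :: c.nw) c.rw s s' → s'.nat v 0 = i → I i s' →
      WP y ω c s' fun s'' => s''.time + (b.cost + 10) ≤ s'.time + T ∧ I (i + 1) s'')
    (hQ : ∀ s', Frame (v :: c.nw) c.rw s s' → I N s' →
      s'.time ≤ s.time + (N * T + (b.cost + 10)) → Q s') :
    WP y ω (.for v b c) s Q := by
  have hsub : ∀ {s₁ s₂ : State n}, Frame (Cmd.seq c (.nset v (.lit 0) (.add (.var v) (.lit 1)))).nw
      (Cmd.seq c (.nset v (.lit 0) (.add (.var v) (.lit 1)))).rw s₁ s₂ →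
      Frame (v :: c.nw) c.rw s₁ s₂ := fun h =>
    h.mono (by simp [Cmd.nw]) (by simp [Cmd.rw])
  have hs0 : Frame (v :: c.nw) c.rw s ((s.setNat v 0 0).tick 3) :=
    ⟨fun a ha => s.setNat_nat_of_ne _ _ (by simp at ha; exact ha.1), fun _ _ => rfl⟩
  rw [Cmd.for, WP_seq, WP_nset]
  refine WP_loop (N := N) (T := T) (fun i s' => s'.nat v 0 = i ∧ I i s')
    (fun i s t h => ⟨h.1, hT _ _ _ h.2⟩) ⟨by simp [NExp.eval], hT _ _ _ (hS _ _ _ h0)⟩ ?_ ?_ ?_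
  · rintro i hi s' hF ⟨hvi, hs⟩
    have hF' := hs0.trans (hsub hF)
    refine ⟨by simp [BExp.Holds, NExp.eval, hvi, hb s' hF', hi], ?_⟩
    obtain ⟨s'', h₁, ht, hs''⟩ := hI i hi s' hF' hvi hs
    have hv' : s''.nat v 0 = i := by rw [h₁.frame.nat v hv, hvi]
    rw [WP_seq]
    refine ⟨s'', h₁, ?_⟩
    refine WP_nset.2 ⟨by simp [NExp.cost, BExp.cost]; omega, by simp [NExp.eval, hv'], ?_⟩
    exact hT _ _ _ (hS _ _ _ hs'')
  · rintro s' hF ⟨hvi, hs⟩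
    have hF' := hs0.trans (hsub hF)
    simp [BExp.Holds, NExp.eval, hvi, hb s' hF']
  · rintro s' hF ⟨hvi, hs⟩ ht
    refine hQ s' (hs0.trans (hsub hF)) hs ?_
    simp only [NExp.cost, BExp.cost, State.tick_time, State.setNat_time] at ht
    omega

/-! ### Nonadaptivity -/

/-- No array in `H` is read. -/
def RExp.avoids (H : List ℕ) : RExp → Prop
  | .ofNat _ => True
  | .get a _ => a ∉ H
  | .add e f => e.avoids H ∧ f.avoids H
  | .sub e f => e.avoids H ∧ f.avoids H
  | .mul e f => e.avoids H ∧ f.avoids H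
  | .div e f => e.avoids H ∧ f.avoids H
  | .sqrt e => e.avoids H

/-- No array in `H` is read. -/
def BExp.avoids (H : List ℕ) : BExp → Prop
  | .nlt _ _ => True
  | .rlt e f => e.avoids H ∧ f.avoids H
  | .neg b => b.avoids H
  | .conj b c => b.avoids H ∧ c.avoids H

/-- The answers to queries go to the arrays in `H`, which have no influence on the rest of the
memory. -/
def Cmd.confines (H : List ℕ) : Cmd → Prop
  | .skip => True
  | .nset _ _ _ => True
  | .rset a _ e => a ∈ H ∨ e.avoids H
  | .coin _ _ => True
  | .query a _ _ _ => a ∈ H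
  | .seq c d => c.confines H ∧ d.confines H
  | .ite b c d => b.avoids H ∧ c.confines H ∧ d.confines H
  | .loop b c => b.avoids H ∧ c.confines H

/-- There are no queries. -/
def Cmd.queryFree : Cmd → Prop
  | .query _ _ _ _ => False
  | .seq c d => c.queryFree ∧ d.queryFree
  | .ite _ c d => c.queryFree ∧ d.queryFree
  | .loop _ c => c.queryFree
  | _ => True

/-- The states agree but for the times and the arrays in `H`. -/
structure Similar (H : List ℕ) (s t : State n) : Prop where
  nat : s.nat = t.nat
  real : ∀ a ∉ H, s.real a = t.real a
  coins : s.coins = t.coins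
  asked : s.asked = t.asked

theorem NExp.eval_congr {s t : State n} (h : s.nat = t.nat) (e : NExp) : e.eval s = e.eval t := by
  induction e <;> simp_all [NExp.eval]

theorem RExp.eval_congr {H : List ℕ} {s t : State n} (h : Similar H s t) (e : RExp)
    (he : e.avoids H) : e.eval s = e.eval t := by
  induction e <;> simp_all [RExp.eval, RExp.avoids, NExp.eval_congr h.nat, h.real]

theorem BExp.holds_congr {H : List ℕ} {s t : State n} (h : Similar H s t) (b : BExp)
    (hb : b.avoids H) : b.Holds s ↔ b.Holds t := by
  induction b <;>
    simp_all [BExp.Holds, BExp.avoids, NExp.eval_congr h.nat, RExp.eval_congr h]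

theorem Similar.tick {H : List ℕ} {s t : State n} (h : Similar H s t) (u v : ℕ) :
    Similar H (s.tick u) (t.tick v) := ⟨h.nat, h.real, h.coins, h.asked⟩

/-- Noninterference. Natural-number expressions cannot read real numbers and tests avoid `H`, so two
runs with the same coins take the same branches and query the same positions, whatever the answers
are. -/
theorem Exec.similar {H : List ℕ} {y y' : Index n → ℝ} {ω : ℕ → Bool} {c : Cmd}
    {s s' t t' : State n} (h : Exec y ω c s s') (h' : Exec y' ω c t t') (hc : c.confines H)
    (hst : Similar H s t) : Similar H s' t' := by
  induction h generalizing t t' with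
  | skip => cases h'; exact hst.tick _ _
  | nset s a i e =>
    cases h'
    refine Similar.tick ?_ _ _
    rw [NExp.eval_congr hst.nat i, NExp.eval_congr hst.nat e]
    exact ⟨by simp [State.setNat, hst.nat], hst.real, hst.coins, hst.asked⟩
  | rset s a i e =>
    cases h'
    refine Similar.tick (s := s.setReal a _ _) (t := t.setReal a _ _)
      ⟨hst.nat, fun b hb => ?_, hst.coins, hst.asked⟩ _ _
    rw [NExp.eval_congr hst.nat i]
    rcases hc with hc | hc
    · have hba : b ≠ a := fun h => hb (h ▸ hc)
      rw [State.setReal_real_of_ne _ _ _ hba, State.setReal_real_of_ne _ _ _ hba, hst.real b hb]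
    · funext j
      simp [RExp.eval_congr hst e hc, hst.real b hb]
  | coin s a i =>
    cases h'
    refine ⟨?_, hst.real, by simp [hst.coins], hst.asked⟩
    simp [State.setNat, hst.nat, NExp.eval_congr hst.nat i, hst.coins]
  | query s a i b o =>
    cases h'
    have hbits : s.bits b (o.eval s) = t.bits b (o.eval t) := by
      funext j; simp [State.bits, hst.nat, NExp.eval_congr hst.nat o]
    refine ⟨hst.nat, fun d hd => ?_, hst.coins, by simp [hst.asked, hbits]⟩
    have hda : d ≠ a := fun h => hd (h ▸ hc)
    exact (State.setReal_real_of_ne _ _ _ hda).trans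
      ((hst.real d hd).trans (State.setReal_real_of_ne _ _ _ hda).symm)
  | seq _ _ ih₁ ih₂ =>
    cases h' with
    | seq h₁ h₂ => exact ih₂ h₂ hc.2 (ih₁ h₁ hc.1 hst)
  | iteTrue hb _ ih =>
    cases h' with
    | iteTrue _ h₁ => exact ih h₁ hc.2.1 (hst.tick _ _)
    | iteFalse hb' _ => exact absurd ((BExp.holds_congr hst _ hc.1).1 hb) hb'
  | iteFalse hb _ ih =>
    cases h' with
    | iteTrue hb' _ => exact absurd ((BExp.holds_congr hst _ hc.1).2 hb') hb
    | iteFalse _ h₁ => exact ih h₁ hc.2.2 (hst.tick _ _)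
  | loopDone hb =>
    cases h' with
    | loopDone _ => exact hst.tick _ _
    | loopStep hb' _ _ => exact absurd ((BExp.holds_congr hst _ hc.1).2 hb') hb
  | loopStep hb _ _ ih₁ ih₂ =>
    cases h' with
    | loopDone hb' => exact absurd ((BExp.holds_congr hst _ hc.1).1 hb) hb'
    | loopStep _ h₁ h₂ => exact ih₂ h₂ hc (ih₁ h₁ hc.2 (hst.tick _ _))

theorem Exec.asked_eq {y : Index n → ℝ} {ω : ℕ → Bool} {c : Cmd} {s s' : State n}
    (h : Exec y ω c s s') (hc : c.queryFree) : s'.asked = s.asked := by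
  induction h with
  | skip | nset | rset | coin => rfl
  | query => exact hc.elim
  | seq _ _ ih₁ ih₂ => exact (ih₂ hc.2).trans (ih₁ hc.1)
  | iteTrue _ _ ih => exact ih hc.1
  | iteFalse _ _ ih => exact ih hc.2
  | loopDone => rfl
  | loopStep _ _ _ ih₁ ih₂ => exact (ih₂ hc).trans (ih₁ hc)

/-- The first command makes all the queries and is blind to their answers; the second one may
inspect the answers because it asks nothing more. -/
theorem isNonadaptive_seq {H : List ℕ} {c d : Cmd} (hc : c.confines H) (hd : d.queryFree)
    (s₀ : State n) (X : Set (Index n → ℝ)) : IsNonadaptive (.seq c d) s₀ X := by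
  intro x _ x' _ ω s s' h h'
  cases h with
  | seq h₁ h₂ =>
    cases h' with
    | seq h₁' h₂' =>
      rw [h₂.asked_eq hd, h₂'.asked_eq hd]
      exact (h₁.similar h₁' hc ⟨rfl, fun _ _ => rfl, rfl, rfl⟩).asked

/-! ### Names of arrays -/

/- Parameters of the sketch: `2 ^ aM = aB` buckets, `2 ^ aE = aR` repetitions, `aHalf = aR / 2`,
`aId = 1` if the hash function is the identity, `aSize = 2 ^ n`. -/
notation "aM" => (3 : ℕ)
notation "aB" => (4 : ℕ)
notation "aR" => (5 : ℕ)
notation "aE" => (6 : ℕ)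
notation "aHalf" => (7 : ℕ)
notation "aId" => (8 : ℕ)
notation "aSize" => (9 : ℕ)
notation "aTmp" => (10 : ℕ)
notation "aCount" => (11 : ℕ)
/- Loop counters and pointers. -/
notation "aRep" => (12 : ℕ)
notation "aRow" => (13 : ℕ)
notation "aCol" => (14 : ℕ)
notation "aPtr" => (15 : ℕ)
notation "aDst" => (16 : ℕ)
notation "aSrc" => (17 : ℕ)
notation "aStep" => (18 : ℕ)
notation "aBucket" => (19 : ℕ)
notation "aShift" => (20 : ℕ)
notation "aOut" => (21 : ℕ)
notation "aPos" => (22 : ℕ)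
notation "aBase" => (23 : ℕ)
/- The hash matrices, and the combinations of the rows of one of them. -/
notation "aMat" => (24 : ℕ)
notation "aVec" => (25 : ℕ)
/- The list of candidates. -/
notation "aCode" => (26 : ℕ)
notation "aSeen" => (27 : ℕ)
notation "aListed" => (28 : ℕ)
notation "aLen" => (29 : ℕ)
notation "aEnd" => (30 : ℕ)
notation "aBits" => (31 : ℕ)
notation "aAddr" => (32 : ℕ)
notation "aHash" => (33 : ℕ)
notation "aPow" => (34 : ℕ)
notation "aPar" => (35 : ℕ)
notation "aItem" => (36 : ℕ)
notation "aStride" => (37 : ℕ)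
/- Sorting. -/
notation "aPerm" => (38 : ℕ)
notation "aAux" => (39 : ℕ)
notation "aLeft" => (40 : ℕ)
notation "aRight" => (41 : ℕ)
notation "aMid" => (42 : ℕ)
notation "aStop" => (43 : ℕ)
notation "aSortLen" => (45 : ℕ)
notation "aMatBase" => (46 : ℕ)
notation "aFirst" => (47 : ℕ)
/- Arrays of real numbers. -/
notation "rTmp" => (2 : ℕ)
notation "rScale" => (3 : ℕ)
notation "rData" => (4 : ℕ)
notation "rEst" => (5 : ℕ)
notation "rMag" => (6 : ℕ)
notation "rMed" => (7 : ℕ)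

infixr:60 " ;; " => Cmd.seq

/-- Assignment to a scalar variable. -/
abbrev Cmd.put (v : ℕ) (e : NExp) : Cmd := .nset v (.lit 0) e

/-- The parameter `k`. -/
abbrev NExp.sparsity : NExp := .get 0 (.lit 0)

/-- The parameter `n`. -/
abbrev NExp.dim : NExp := .get 0 (.lit 1)

/-- `v := v + e`. -/
abbrev Cmd.inc (v : ℕ) (e : NExp) : Cmd := .put v (.add (.var v) e)

/-- `v := v + 1`. -/
abbrev Cmd.succ (v : ℕ) : Cmd := .inc v (.lit 1)

/-- `v := v + v`. -/
abbrev Cmd.dbl (v : ℕ) : Cmd := .inc v (.var v)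

/-! ### Parameters -/

/-- The number of halvings of `1` until it is at most `η`. -/
def halvings (η : ℝ) : ℕ := ⌈Real.logb 2 (1 / η)⌉₊

/-- A lower bound for the number of repetitions. -/
def minReps (k : ℕ) (η : ℝ) : ℕ := Nat.clog 2 k + 8 + halvings η

/-- With `le_halvings`: doubling `η` until it reaches `1` takes exactly `halvings η` rounds. The
program counts these rounds, since no operation turns a real number into a natural number. -/
theorem lt_halvings {η : ℝ} (hη : 0 < η) {i : ℕ} (hi : i < halvings η) : η * 2 ^ i < 1 := by
  have h := Nat.lt_ceil.1 hi
  rw [Real.lt_logb_iff_rpow_lt (by norm_num) (by positivity), Real.rpow_natCast] at h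
  rw [mul_comm]
  exact (lt_div_iff₀ hη).1 h

theorem le_halvings {η : ℝ} (hη : 0 < η) : 1 ≤ η * 2 ^ halvings η := by
  have h := Nat.le_ceil (Real.logb 2 (1 / η))
  rw [Real.logb_le_iff_le_rpow (by norm_num) (by positivity), Real.rpow_natCast] at h
  rw [mul_comm]
  exact (div_le_iff₀ hη).1 h

theorem clog_le (x : ℕ) : Nat.clog 2 x ≤ x :=
  (Nat.clog_le_iff_le_pow (by norm_num)).2 Nat.lt_two_pow_self.le

theorem two_pow_clog_le {x : ℕ} (hx : 1 ≤ x) : 2 ^ Nat.clog 2 x ≤ 2 * x := by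
  rcases hx.eq_or_lt with rfl | hx
  · simp
  · have h := Nat.pow_pred_clog_lt_self (b := 2) (by norm_num) hx
    obtain ⟨c, hc⟩ : ∃ c, Nat.clog 2 x = c + 1 :=
      ⟨_, (Nat.succ_pred_eq_of_pos (Nat.clog_pos (by norm_num) hx)).symm⟩
    rw [hc, Nat.pred_succ] at h
    rw [hc, pow_succ]
    omega

/-- The number of buckets for sparsity `k`. -/
def bucketCmd : Cmd :=
  .put aM (.lit 6) ;; .put aB (.lit 64) ;; .put aTmp (.lit 1) ;;
  .loop (.nlt (.var aTmp) .sparsity) (.dbl aTmp ;; .dbl aB ;; .succ aM)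

/-- The number of repetitions for failure probability `η`. -/
def repsCmd : Cmd :=
  .put aCount (.add (.var aM) (.lit 2)) ;; .rset rTmp (.lit 0) (.get 0 (.lit 0)) ;;
  .loop (.rlt (.get rTmp (.lit 0)) (.ofNat (.lit 1)))
    (.rset rTmp (.lit 0) (.add (.get rTmp (.lit 0)) (.get rTmp (.lit 0))) ;; .succ aCount) ;;
  .put aR (.lit 1) ;; .put aHalf (.lit 0) ;; .put aE (.lit 0) ;;
  .loop (.nlt (.var aR) (.var aCount)) (.put aHalf (.var aR) ;; .dbl aR ;; .succ aE)

/-- Too many repetitions are replaced by one repetition with the identity as hash function. -/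
def identityCmd : Cmd :=
  .put aSize (.lit 1) ;; .for aCol .dim (.dbl aSize) ;; .put aId (.lit 0) ;;
  .ite (.nlt (.var aSize) (.var aR))
    (.put aId (.lit 1) ;; .put aM .dim ;; .put aB (.var aSize) ;; .put aR (.lit 1) ;;
      .put aE (.lit 0) ;; .put aHalf (.lit 0))
    .skip ;;
  .rset rScale (.lit 0) (.div (.sqrt (.ofNat (.var aSize))) (.ofNat (.var aB)))

section

variable {y : Index n → ℝ} {ω : ℕ → Bool} {s : State n}

theorem WP_bucketCmd {k : ℕ} (hk : s.nat 0 0 = k) :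
    WP y ω bucketCmd s fun s' => s'.time ≤ s.time + (40 * Nat.clog 2 k + 40) ∧
      s'.nat aM 0 = Nat.clog 2 k + 6 ∧ s'.nat aB 0 = 2 ^ (Nat.clog 2 k + 6) := by
  simp only [bucketCmd, WP_seq, WP_nset]
  refine WP_loop (N := Nat.clog 2 k) (T := 30)
    (fun i s' => s'.nat aM 0 = i + 6 ∧ s'.nat aB 0 = 2 ^ (i + 6) ∧ s'.nat aTmp 0 = 2 ^ i)
    (fun _ _ _ h => h) (by simp [NExp.eval]) ?_ ?_ ?_
  · rintro i hi s' hF ⟨h1, h2, h3⟩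
    have hk' : s'.nat 0 0 = k := by
      rw [hF.nat 0 (by decide)]; simp [hk]
    refine ⟨?_, ?_⟩
    · have := (Nat.lt_clog_iff_pow_lt (by norm_num)).1 hi
      simpa [BExp.Holds, NExp.eval, h3, hk'] using this
    · simp [NExp.eval, NExp.cost, BExp.cost, h1, h2, h3, pow_succ]
      omega
  · rintro s' hF ⟨-, -, h3⟩
    have hk' : s'.nat 0 0 = k := by
      rw [hF.nat 0 (by decide)]; simp [hk]
    have := Nat.le_pow_clog (b := 2) (by norm_num) k
    simpa [BExp.Holds, NExp.eval, h3, hk'] using this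
  · rintro s' hF ⟨h1, h2, -⟩ ht
    refine ⟨?_, h1, h2⟩
    simp [NExp.cost, BExp.cost] at ht
    omega

theorem WP_repsCmd {m : ℕ} {η : ℝ} (hη : 0 < η) (hm : s.nat aM 0 = m) (hs : s.real 0 0 = η) :
    WP y ω repsCmd s fun s' => s'.time ≤ s.time + 100 * (m + 2 + halvings η) ∧
      ∃ e, e = Nat.clog 2 (m + 2 + halvings η) ∧ s'.nat aR 0 = 2 ^ e ∧ s'.nat aHalf 0 = 2 ^ e / 2 ∧ s'.nat aE 0 = e := by
  simp only [repsCmd, WP_seq, WP_nset, WP_rset]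
  refine WP_loop (N := halvings η) (T := 30)
    (fun i s' => s'.nat aCount 0 = m + 2 + i ∧ s'.real rTmp 0 = η * 2 ^ i)
    (fun _ _ _ h => h) (by simp [NExp.eval, RExp.eval, hm, hs]) ?_ ?_ ?_
  · rintro i hi s' hF ⟨h1, h2⟩
    refine ⟨?_, ?_⟩
    · simpa [BExp.Holds, NExp.eval, RExp.eval, h2] using lt_halvings hη hi
    · simp [NExp.eval, NExp.cost, BExp.cost, RExp.eval, RExp.cost, h1, h2, pow_succ]
      exact ⟨by omega, by ring⟩
  · rintro s' hF ⟨-, h2⟩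
    simpa [BExp.Holds, NExp.eval, RExp.eval, h2] using le_halvings hη
  rintro s₁ hF₁ ⟨h1, -⟩ ht₁
  simp [NExp.cost, BExp.cost, RExp.cost] at ht₁
  refine WP_loop (N := Nat.clog 2 (m + 2 + halvings η)) (T := 30)
    (fun i s' => s'.nat aR 0 = 2 ^ i ∧ s'.nat aHalf 0 = 2 ^ i / 2 ∧ s'.nat aE 0 = i ∧
      s'.nat aCount 0 = m + 2 + halvings η)
    (fun _ _ _ h => h) (by simp [NExp.eval, h1]) ?_ ?_ ?_
  · rintro i hi s' hF ⟨h1, h2, h3, h4⟩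
    refine ⟨?_, ?_⟩
    · have := (Nat.lt_clog_iff_pow_lt (by norm_num)).1 hi
      simpa [BExp.Holds, NExp.eval, h1, h4] using this
    · simp [NExp.eval, NExp.cost, BExp.cost, h1, h3, h4, pow_succ]
      omega
  · rintro s' hF ⟨h1, -, -, h4⟩
    have := Nat.le_pow_clog (b := 2) (by norm_num) (m + 2 + halvings η)
    simpa [BExp.Holds, NExp.eval, h1, h4] using this
  · rintro s' hF ⟨h1, h2, h3, h4⟩ ht
    have hx := clog_le (m + 2 + halvings η)
    refine ⟨?_, _, rfl, h1, h2, h3⟩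
    simp [NExp.cost, BExp.cost] at ht
    omega

/-- Switching to the identity when `2 ^ e > 2 ^ n` ensures that the exponent kept is at most `n`,
which the cost of sorting relies on. The scale `√N / 2 ^ m` is the factor that turns transformed
data into plain sums over buckets in `walsh_dht`. -/
theorem WP_identityCmd {m e : ℕ} (hn : s.nat 0 1 = n) (hm : s.nat aM 0 = m)
    (hB : s.nat aB 0 = 2 ^ m) (he : s.nat aE 0 = e) (hR : s.nat aR 0 = 2 ^ e)
    (hH : s.nat aHalf 0 = 2 ^ e / 2) :
    WP y ω identityCmd s fun s' => s'.time ≤ s.time + (40 * n + 100) ∧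
      ∃ m' e', (s'.nat aId 0 = 0 ∧ m' = m ∧ e' = e ∧ 2 ^ e ≤ 2 ^ n ∨
        s'.nat aId 0 = 1 ∧ m' = n ∧ e' = 0 ∧ 2 ^ n < 2 ^ e) ∧
      s'.nat aM 0 = m' ∧ s'.nat aB 0 = 2 ^ m' ∧ s'.nat aE 0 = e' ∧ s'.nat aR 0 = 2 ^ e' ∧
      s'.nat aHalf 0 = 2 ^ e' / 2 ∧ s'.real rScale 0 = √(2 ^ n) / 2 ^ m' := by
  simp only [identityCmd, WP_seq, WP_nset]
  refine WP_for (N := n) 30 (fun i s' => s'.nat aSize 0 = 2 ^ i) (by decide)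
    (fun _ _ _ h => h) (fun _ _ _ h => h) ?_ (by simp [NExp.eval]) ?_ ?_
  · intro s' hF
    simp [NExp.eval, hF.nat 0 (by decide), hn]
  · intro i hi s' hF hv h
    simp [NExp.eval, NExp.cost, h, pow_succ]
    omega
  intro s₁ hF hs₁ ht
  have hF3 := hF.nat aM (by decide)
  have hF4 := hF.nat aB (by decide)
  have hF5 := hF.nat aR (by decide)
  have hF6 := hF.nat aE (by decide)
  have hF7 := hF.nat aHalf (by decide)
  have hF0 := hF.nat 0 (by decide)
  simp [NExp.cost] at ht
  simp only [WP_ite, WP_seq, WP_nset, WP_rset, WP_skip]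
  refine ⟨fun hlt => ?_, fun hlt => ?_⟩
  · refine ⟨?_, n, 0, Or.inr ⟨?_, rfl, rfl, ?_⟩, ?_⟩
    · simp [NExp.cost, BExp.cost, RExp.cost]; omega
    · simp [NExp.eval]
    · simpa [BExp.Holds, NExp.eval, hs₁, hF5, hR] using hlt
    · simp [NExp.eval, RExp.eval, hs₁, hF0, hn]
  · refine ⟨?_, m, e, Or.inl ⟨?_, rfl, rfl, ?_⟩, ?_⟩
    · simp [NExp.cost, BExp.cost, RExp.cost]; omega
    · simp [NExp.eval]
    · simpa [BExp.Holds, NExp.eval, hs₁, hF5, hR] using hlt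
    · simp [NExp.eval, RExp.eval, hs₁, hF3, hF4, hF5, hF6, hF7, hm, hB, he, hR, hH]

end

/-! ### Sampling and measuring -/

/-- The entries of the hash matrices, one after the other. -/
def entry (ω : ℕ → Bool) (n m f q : ℕ) : ℕ :=
  if 0 < f then (if q / n % m = q % n then 1 else 0) else if ω q then 1 else 0

/-- Two layouts rest on this: the entries of the matrices (`m` rows of length `n` each), and the
data (`n + 1` shifts with `2 ^ m` buckets each). -/
theorem flat_div_mod {m n ρ r j : ℕ} (hr : r < m) (hj : j < n) :
    ((ρ * m + r) * n + j) / n % m = r ∧ ((ρ * m + r) * n + j) / n / m = ρ ∧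
      ((ρ * m + r) * n + j) % n = j := by
  have h1 : ((ρ * m + r) * n + j) / n = ρ * m + r := by
    rw [Nat.mul_comm, Nat.mul_add_div (by omega), Nat.div_eq_of_lt hj, Nat.add_zero]
  have h2 : ((ρ * m + r) * n + j) % n = j := by
    rw [Nat.mul_comm, Nat.mul_add_mod, Nat.mod_eq_of_lt hj]
  refine ⟨?_, ?_, h2⟩
  · rw [h1, Nat.mul_comm, Nat.mul_add_mod, Nat.mod_eq_of_lt hr]
  · rw [h1, Nat.mul_comm, Nat.mul_add_div (by omega), Nat.div_eq_of_lt hr, Nat.add_zero]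

/-- The first `p` entries have been sampled. -/
def Sampled (ω : ℕ → Bool) (n m f p : ℕ) (s : State n) : Prop :=
  s.nat aPtr 0 = p ∧ (f = 0 → s.coins = p) ∧ ∀ q < p, s.nat aMat q = entry ω n m f q

/-- Sample one entry. -/
def entryCmd : Cmd :=
  .ite (.nlt (.lit 0) (.var aId))
    (.ite (.conj (.neg (.nlt (.var aRow) (.var aCol))) (.neg (.nlt (.var aCol) (.var aRow))))
      (.nset aMat (.var aPtr) (.lit 1)) (.nset aMat (.var aPtr) (.lit 0)))
    (.coin aMat (.var aPtr)) ;;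
  .succ aPtr

theorem WP_entryCmd {y : Index n → ℝ} {ω : ℕ → Bool} {s : State n} {m f p : ℕ}
    (hf : s.nat aId 0 = f) (hr : s.nat aRow 0 = p / n % m) (hj : s.nat aCol 0 = p % n)
    (h : Sampled ω n m f p s) :
    WP y ω entryCmd s fun s' => s'.time ≤ s.time + 40 ∧ Sampled ω n m f (p + 1) s' := by
  obtain ⟨h1, h2, h3⟩ := h
  simp only [entryCmd, WP_seq, WP_ite, WP_nset, WP_coin]
  refine ⟨fun hb => ⟨fun hb' => ?_, fun hb' => ?_⟩, fun hb => ?_⟩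
  · have hf0 : 0 < f := by simpa [BExp.Holds, NExp.eval, hf] using hb
    have hrj : p / n % m = p % n := by
      simp [BExp.Holds, NExp.eval, hr, hj] at hb'; omega
    refine ⟨by simp [NExp.cost, BExp.cost], by simp [NExp.eval, h1],
      fun h => absurd h hf0.ne', Nat.forall_lt_succ_right.2 ⟨fun q hq => ?_, ?_⟩⟩
    · simp [NExp.eval, h1, hq.ne, h3 q hq]
    · simp [entry, NExp.eval, h1, hf0, hrj]
  · have hf0 : 0 < f := by simpa [BExp.Holds, NExp.eval, hf] using hb
    have hrj : p / n % m ≠ p % n := by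
      intro h
      simp [BExp.Holds, NExp.eval, hr, hj, h] at hb'
    refine ⟨by simp [NExp.cost, BExp.cost], by simp [NExp.eval, h1],
      fun h => absurd h hf0.ne', Nat.forall_lt_succ_right.2 ⟨fun q hq => ?_, ?_⟩⟩
    · simp [NExp.eval, h1, hq.ne, h3 q hq]
    · simp [entry, NExp.eval, h1, hf0, hrj]
  · have hf0 : f = 0 := by simpa [BExp.Holds, NExp.eval, hf] using hb
    refine ⟨by simp [NExp.cost, BExp.cost], by simp [NExp.eval, h1],
      fun h => by simp [h2 h], Nat.forall_lt_succ_right.2 ⟨fun q hq => ?_, ?_⟩⟩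
    · simp [NExp.eval, h1, hq.ne, h3 q hq]
    · simp [entry, NExp.eval, h1, hf0, h2 hf0]

/-- Sample the hash matrices. -/
def sampleCmd : Cmd :=
  .put aPtr (.lit 0) ;;
  .for aRep (.add (.var aR) (.var aR)) (.for aRow (.var aM) (.for aCol .dim entryCmd))

theorem WP_sampleCmd {y : Index n → ℝ} {ω : ℕ → Bool} {s : State n} {m f R : ℕ}
    (hn : s.nat 0 1 = n) (hm : s.nat aM 0 = m) (hR : s.nat aR 0 = R) (hf : s.nat aId 0 = f)
    (hc : s.coins = 0) :
    WP y ω sampleCmd s fun s' =>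
      s'.time ≤ s.time + ((R + R) * (m * (n * 60 + 40) + 40) + 40) ∧
      ∀ q < (R + R) * m * n, s'.nat aMat q = entry ω n m f q := by
  simp only [sampleCmd, WP_seq, WP_nset]
  refine WP_for (N := R + R) (m * (n * 60 + 40) + 40) (fun ρ => Sampled ω n m f (ρ * m * n))
    (by decide) (fun _ _ _ h => h) (fun _ _ _ h => h) ?_
    (by simp [Sampled, NExp.eval, hc]) ?_ ?_
  · intro s' hF
    simp [NExp.eval, hF.nat aR (by decide), hR]
  · intro ρ hρ s₁ hF₁ _ h₁
    have hm₁ : s₁.nat aM 0 = m := by rw [hF₁.nat aM (by decide)]; simp [hm]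
    have hn₁ : s₁.nat 0 1 = n := by rw [hF₁.nat 0 (by decide)]; simp [hn]
    have hf₁ : s₁.nat aId 0 = f := by rw [hF₁.nat aId (by decide)]; simp [hf]
    refine WP_for (N := m) (n * 60 + 40) (fun r => Sampled ω n m f ((ρ * m + r) * n)) (by decide)
      (fun _ _ _ h => h) (fun _ _ _ h => h) ?_ (by simpa using h₁) ?_ ?_
    · intro s' hF
      simp [NExp.eval, hF.nat aM (by decide), hm₁]
    · intro r hr s₂ hF₂ hr₂ h₂
      have hn₂ : s₂.nat 0 1 = n := by rw [hF₂.nat 0 (by decide), hn₁]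
      have hf₂ : s₂.nat aId 0 = f := by rw [hF₂.nat aId (by decide), hf₁]
      refine WP_for (N := n) 60 (fun j => Sampled ω n m f ((ρ * m + r) * n + j)) (by decide)
        (fun _ _ _ h => h) (fun _ _ _ h => h) ?_ (by simpa using h₂) ?_ ?_
      · intro s' hF
        simp [NExp.eval, hF.nat 0 (by decide), hn₂]
      · rintro j hj s₃ hF₃ hj₃ h₃
        have hf₃ : s₃.nat aId 0 = f := by rw [hF₃.nat aId (by decide), hf₂]
        have hr₃ : s₃.nat aRow 0 = r := by rw [hF₃.nat aRow (by decide), hr₂]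
        obtain ⟨hd, -, hmod⟩ := flat_div_mod (ρ := ρ) hr hj
        refine (WP_entryCmd hf₃ (by rw [hr₃, hd]) (by rw [hj₃, hmod]) h₃).mono
          fun s' _ h => ⟨?_, h.2⟩
        have := h.1
        simp [NExp.cost]
        omega
      · intro s' hF' h ht
        refine ⟨?_, by convert h using 1; ring⟩
        simp [NExp.cost] at ht ⊢
        omega
    · intro s' hF' h ht
      refine ⟨?_, by convert h using 1; ring⟩
      simp [NExp.cost] at ht ⊢
      omega
  · intro s' hF' h ht
    refine ⟨?_, h.2.2⟩
    simp [NExp.cost] at ht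
    omega

/-- Add a row to one of the sums. -/
def sumCmd : Cmd :=
  .nset aVec (.var aDst)
    (.add (.get aVec (.var aSrc)) (.get aMat (.add (.var aPtr) (.var aCol)))) ;;
  .succ aDst ;; .succ aSrc

/-- Compute all sums of rows of a hash matrix. -/
def tableCmd : Cmd :=
  .put aDst .dim ;; .put aStep (.lit 1) ;;
  .for aRow (.var aM) (
    .put aSrc (.lit 0) ;;
    .for aBucket (.var aStep) (.for aCol .dim sumCmd) ;;
    .inc aPtr .dim ;; .dbl aStep)

/-- The sum of the rows of `M` with index in the binary expansion of `w < 2 ^ r`. -/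
def rowSum (M : ℕ → ℕ → ℕ) : ℕ → ℕ → ℕ → ℕ
  | 0, _, _ => 0
  | r + 1, w, j => if w < 2 ^ r then rowSum M r w j else rowSum M r (w - 2 ^ r) j + M r j

theorem rowSum_zero (M : ℕ → ℕ → ℕ) (r j : ℕ) : rowSum M r 0 j = 0 := by
  induction r with
  | zero => rfl
  | succ r ih => simp [rowSum, ih]

/-- The first `p` entries of the table of sums of at most `r` rows have been computed. -/
def Tabled (M : ℕ → ℕ → ℕ) (n r a p : ℕ) (s : State n) : Prop :=
  s.nat aSrc 0 = a ∧ s.nat aDst 0 = p ∧ ∀ q < p, s.nat aVec q = rowSum M r (q / n) (q % n)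

theorem WP_sumCmd {y : Index n → ℝ} {ω : ℕ → Bool} {s : State n} {r a p : ℕ} {M : ℕ → ℕ → ℕ}
    (h : Tabled M n r a p s)
    (hp : s.nat aVec a + s.nat aMat (s.nat aPtr 0 + s.nat aCol 0) = rowSum M r (p / n) (p % n)) :
    WP y ω sumCmd s fun s' => s'.time ≤ s.time + 40 ∧ Tabled M n r (a + 1) (p + 1) s' := by
  obtain ⟨h1, h2, h3⟩ := h
  simp only [sumCmd, WP_seq, WP_nset]
  refine ⟨by simp [NExp.cost], by simp [NExp.eval, h1], by simp [NExp.eval, h2],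
    Nat.forall_lt_succ_right.2 ⟨fun q hq => ?_, ?_⟩⟩
  · simp [NExp.eval, h2, hq.ne, h3 q hq]
  · simp [NExp.eval, h2, h1, hp]

/-- The sums that involve row `r` are the earlier sums with that row added, so each new entry takes
one addition. The earlier sums start with the empty one, which `hz` supplies. The time bound charges
a full table for every row; the extra factor `m` is affordable as `m` is `O(n)`. -/
theorem WP_tableCmd {y : Index n → ℝ} {ω : ℕ → Bool} {s : State n} {m a : ℕ} {M : ℕ → ℕ → ℕ}
    (hn : s.nat 0 1 = n) (hm : s.nat aM 0 = m) (hp : s.nat aPtr 0 = a)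
    (hM : ∀ r < m, ∀ j < n, s.nat aMat (a + r * n + j) = M r j)
    (hz : ∀ q < n, s.nat aVec q = 0) :
    WP y ω tableCmd s fun s' =>
      s'.time ≤ s.time + (m * (2 ^ m * (n * 60 + 40) + 60) + 40) ∧
      s'.nat aPtr 0 = a + m * n ∧
      ∀ q < 2 ^ m * n, s'.nat aVec q = rowSum M m (q / n) (q % n) := by
  simp only [tableCmd, WP_seq, WP_nset]
  refine WP_for (N := m) (2 ^ m * (n * 60 + 40) + 60)
    (fun r s' => s'.nat aPtr 0 = a + r * n ∧ s'.nat aStep 0 = 2 ^ r ∧ s'.nat aDst 0 = 2 ^ r * n ∧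
      ∀ q < 2 ^ r * n, s'.nat aVec q = rowSum M r (q / n) (q % n)) (by decide)
    (fun _ _ _ h => h) (fun _ _ _ h => h) ?_ ?_ ?_ ?_
  · intro s' hF
    simp [NExp.eval, hF.nat aM (by decide), hm]
  · simpa [NExp.eval, hp, hn, rowSum] using hz
  · rintro r hr s₁ hF₁ hr₁ ⟨h11, h12, h13, h14⟩
    have hn₁ : s₁.nat 0 1 = n := by rw [hF₁.nat 0 (by decide)]; simp [hn]
    have hA₁ : s₁.nat aMat = s.nat aMat := by
      rw [hF₁.nat aMat (by decide)]; simp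
    have hpow : 2 ^ r ≤ 2 ^ m := Nat.pow_le_pow_right (by norm_num) hr.le
    simp only [WP_seq, WP_nset]
    refine WP_for (N := 2 ^ r) (n * 60 + 40)
      (fun w => Tabled M n (r + 1) (w * n) ((2 ^ r + w) * n)) (by decide)
      (fun _ _ _ h => h) (fun _ _ _ h => h) ?_ ?_ ?_ ?_
    · intro s' hF
      simp [NExp.eval, hF.nat aStep (by decide), h12]
    · simp [Tabled, NExp.eval, h13]
      intro q hq
      rw [h14 q hq, rowSum, if_pos (Nat.div_lt_of_lt_mul (by rwa [Nat.mul_comm]))]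
    · rintro w hw s₂ hF₂ - h₂
      have hn₂ : s₂.nat 0 1 = n := by rw [hF₂.nat 0 (by decide)]; simp [hn₁]
      have hA₂ : s₂.nat aMat = s.nat aMat := by
        rw [hF₂.nat aMat (by decide)]; simp [hA₁]
      have hp₂ : s₂.nat aPtr 0 = a + r * n := by
        rw [hF₂.nat aPtr (by decide)]; simp [h11]
      refine WP_for (N := n) 60
        (fun j => Tabled M n (r + 1) (w * n + j) ((2 ^ r + w) * n + j)) (by decide)
        (fun _ _ _ h => h) (fun _ _ _ h => h) ?_ (by simpa using h₂) ?_ ?_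
      · intro s' hF
        simp [NExp.eval, hF.nat 0 (by decide), hn₂]
      · rintro j hj s₃ hF₃ hj₃ h₃
        have hA₃ : s₃.nat aMat = s.nat aMat := by rw [hF₃.nat aMat (by decide), hA₂]
        have hp₃ : s₃.nat aPtr 0 = a + r * n := by rw [hF₃.nat aPtr (by decide), hp₂]
        have hdm : ∀ v, (v * n + j) / n = v ∧ (v * n + j) % n = j := fun v => by
          rw [Nat.mul_comm, Nat.mul_add_div (by omega), Nat.div_eq_of_lt hj, Nat.mul_add_mod,
            Nat.mod_eq_of_lt hj]
          simp
        have hlt : w * n + j < (2 ^ r + w) * n + j := by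
          have : 0 < 2 ^ r * n := Nat.mul_pos (by positivity) (by omega)
          rw [Nat.add_mul]; omega
        have hsrc := h₃.2.2 _ hlt
        rw [(hdm w).1, (hdm w).2, rowSum, if_pos hw] at hsrc
        refine (WP_sumCmd h₃ ?_).mono fun s' _ h => ⟨?_, h.2⟩
        · rw [hsrc, hp₃, hj₃, hA₃, hM r hr j hj, (hdm _).1, (hdm _).2, rowSum, if_neg (by omega),
            Nat.add_sub_cancel_left]
        · have := h.1
          simp [NExp.cost]
          omega
      · intro s' hF' h ht
        have e1 : w * n + n = (w + 1) * n := by ring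
        have e2 : (2 ^ r + w) * n + n = (2 ^ r + (w + 1)) * n := by ring
        rw [e1, e2] at h
        refine ⟨?_, h⟩
        simp [NExp.cost] at ht ⊢
        omega
    · rintro s₂ hF₂ ⟨h1, h2, h3⟩ ht
      have hn₂ : s₂.nat 0 1 = n := by rw [hF₂.nat 0 (by decide)]; simp [hn₁]
      have hp₂ : s₂.nat aPtr 0 = a + r * n := by
        rw [hF₂.nat aPtr (by decide)]; simp [h11]
      have hs₂ : s₂.nat aStep 0 = 2 ^ r := by
        rw [hF₂.nat aStep (by decide)]; simp [h12]
      have := Nat.mul_le_mul_right (n * 60 + 40) hpow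
      have e : (2 ^ r + 2 ^ r) * n = 2 ^ (r + 1) * n := by ring
      rw [e] at h2 h3
      refine ⟨?_, ?_, ?_, ?_, ?_⟩
      · simp [NExp.cost] at ht ⊢; omega
      · simp [NExp.eval, hn₂, hp₂]; ring
      · simp [NExp.eval, hs₂]; ring
      · simpa using h2
      · simpa using h3
  · rintro s' hF ⟨h1, -, -, h4⟩ ht
    refine ⟨?_, h1, h4⟩
    simp [NExp.cost] at ht
    omega

/-- Add `1` to the entry of the current sum of rows that belongs to the shift. -/
def shiftCmd (f : NExp → NExp → NExp) : Cmd :=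
  .ite (.nlt (.lit 0) (.var aShift))
    (.nset aVec (.add (.var aPos) (.sub (.var aShift) (.lit 1)))
      (f (.get aVec (.add (.var aPos) (.sub (.var aShift) (.lit 1)))) (.lit 1))) .skip

/-- Query a shifted sum of rows. -/
def askOneCmd : Cmd :=
  shiftCmd .add ;;
  .query rData (.var aOut) aVec (.var aPos) ;;
  .rset rData (.var aOut) (.mul (.get rScale (.lit 0)) (.get rData (.var aOut))) ;;
  shiftCmd .sub ;;
  .inc aPos .dim ;; .succ aOut

/-- Query the sums of rows, shifted by the zero vector and by the unit vectors. -/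
def askCmd : Cmd :=
  .for aShift (.add .dim (.lit 1)) (.put aPos (.lit 0) ;; .for aBucket (.var aB) askOneCmd)

/-- The index that is queried for bucket `w` and shift `t`. -/
def point (n : ℕ) (M : ℕ → ℕ → ℕ) (m t w : ℕ) : Index n := fun j =>
  ((rowSum M m w j + if (j : ℕ) + 1 = t then 1 else 0 : ℕ) : ZMod 2)

/-- The first `p` data have been collected. -/
def Asked (D : ℕ → ℝ) (v : ℕ → ℕ) (p : ℕ) (s : State n) : Prop :=
  s.nat aOut 0 = p ∧ s.nat aVec = v ∧ ∀ q < p, s.real rData q = D q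

/-- The unit vector is added to the table in place and removed after the query, so that shifting
takes constant time. Entries are natural numbers that are only reduced modulo `2` when they are read
as bits, hence subtracting `1` restores them. -/
theorem WP_askOneCmd {y : Index n → ℝ} {ω : ℕ → Bool} {s : State n} {p o t : ℕ}
    {c : ℝ} {D : ℕ → ℝ} {v : ℕ → ℕ} (hn : s.nat 0 1 = n) (ht : s.nat aShift 0 = t)
    (hc : s.real rScale 0 = c) (ho : s.nat aPos 0 = o)
    (hD : D p = c * y fun j => ((v (o + j) + if (j : ℕ) + 1 = t then 1 else 0 : ℕ) : ZMod 2))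
    (h : Asked D v p s) :
    WP y ω askOneCmd s fun s' => s'.time ≤ s.time + (n + 80) ∧ s'.nat aPos 0 = o + n ∧
      Asked D v (p + 1) s' := by
  obtain ⟨h1, h2, h3⟩ := h
  by_cases ht0 : t = 0
  · subst ht0
    simp only [askOneCmd, shiftCmd, WP_seq, WP_ite, WP_skip, WP_nset, WP_query, WP_rset]
    simp only [BExp.Holds, NExp.eval, RExp.eval, State.tick_nat, State.setReal_nat, ht,
      lt_irrefl, false_imp_iff, not_false_eq_true, true_imp_iff, true_and]
    refine ⟨?_, ?_, ?_, ?_, Nat.forall_lt_succ_right.2 ⟨fun q hq => ?_, ?_⟩⟩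
    · simp [NExp.cost, BExp.cost, RExp.cost]; omega
    · simp [ho, hn]
    · simp [h1]
    · simpa using h2
    · simp [h1, hq.ne, h3 q hq]
    · rw [hD]
      simp [h1, hc, ho]
      left
      congr 1
      funext j
      simp [State.bits, h2]
  · have ht1 := Nat.pos_of_ne_zero ht0
    simp only [askOneCmd, shiftCmd, WP_seq, WP_ite, WP_skip, WP_nset, WP_query, WP_rset]
    have hsh : aShift ≠ aVec := by decide
    simp only [BExp.Holds, NExp.eval, RExp.eval, State.tick_nat, State.setReal_nat, ht,
      State.setNat_nat_of_ne _ _ _ hsh, ht1, not_true_eq_false,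
      false_imp_iff, true_imp_iff, and_true]
    refine ⟨?_, ?_, ?_, ?_, Nat.forall_lt_succ_right.2 ⟨fun q hq => ?_, ?_⟩⟩
    · simp [NExp.cost, BExp.cost, RExp.cost]; omega
    · simp [ho, hn]
    · simp [h1]
    · funext q
      by_cases hq : q = o + (t - 1) <;> simp [hq, h2, ho]
    · simp [h1, hq.ne, h3 q hq]
    · rw [hD]
      simp [h1, hc, ho]
      left
      congr 1
      funext j
      by_cases hj : (j : ℕ) + 1 = t
      · have : o + (j : ℕ) = o + (t - 1) := by omega
        simp [State.bits, h2, hj, this]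
      · have : (j : ℕ) ≠ t - 1 := by omega
        simp [State.bits, h2, hj, this]

theorem WP_askCmd {y : Index n → ℝ} {ω : ℕ → Bool} {s : State n} {m ρ : ℕ} {M : ℕ → ℕ → ℕ} {c : ℝ}
    {D : ℕ → ℝ}
    (hn : s.nat 0 1 = n) (hB : s.nat aB 0 = 2 ^ m) (ho : s.nat aOut 0 = ρ * (n + 1) * 2 ^ m)
    (hc : s.real rScale 0 = c)
    (hV : ∀ q < 2 ^ m * n, s.nat aVec q = rowSum M m (q / n) (q % n))
    (hD : ∀ t < n + 1, ∀ w < 2 ^ m, D ((ρ * (n + 1) + t) * 2 ^ m + w) = c * y (point n M m t w))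
    (hY : ∀ q < ρ * (n + 1) * 2 ^ m, s.real rData q = D q) :
    WP y ω askCmd s fun s' =>
      s'.time ≤ s.time + ((n + 1) * (2 ^ m * (n + 100) + 50) + 50) ∧
      s'.nat aOut 0 = (ρ + 1) * (n + 1) * 2 ^ m ∧ s'.nat aVec = s.nat aVec ∧
      ∀ q < (ρ + 1) * (n + 1) * 2 ^ m, s'.real rData q = D q := by
  simp only [askCmd]
  refine WP_for (N := n + 1) (2 ^ m * (n + 100) + 50)
    (fun t => Asked D (s.nat aVec) ((ρ * (n + 1) + t) * 2 ^ m))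
    (by decide) (fun _ _ _ h => h) (fun _ _ _ h => h) ?_ ⟨ho, rfl, hY⟩ ?_ ?_
  · intro s' hF
    simp [NExp.eval, hF.nat 0 (by decide), hn]
  · intro t ht s₁ hF₁ ht₁ h₁
    have hn₁ : s₁.nat 0 1 = n := by rw [hF₁.nat 0 (by decide), hn]
    have hB₁ : s₁.nat aB 0 = 2 ^ m := by rw [hF₁.nat aB (by decide), hB]
    have hc₁ : s₁.real rScale 0 = c := by rw [hF₁.real rScale (by decide), hc]
    simp only [WP_seq, WP_nset]
    refine WP_for (N := 2 ^ m) (n + 100) (fun w s' => s'.nat aPos 0 = w * n ∧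
        Asked D (s.nat aVec) ((ρ * (n + 1) + t) * 2 ^ m + w) s') (by decide)
      (fun _ _ _ h => h) (fun _ _ _ h => h) ?_ ?_ ?_ ?_
    · intro s' hF
      simp [NExp.eval, hF.nat aB (by decide), hB₁]
    · exact ⟨by simp [NExp.eval], h₁⟩
    · rintro w hw s₂ hF₂ - ⟨h20, h₂⟩
      have hn₂ : s₂.nat 0 1 = n := by rw [hF₂.nat 0 (by decide)]; simp [hn₁]
      have ht₂ : s₂.nat aShift 0 = t := by rw [hF₂.nat aShift (by decide)]; simp [ht₁]
      have hc₂ : s₂.real rScale 0 = c := by rw [hF₂.real rScale (by decide)]; simp [hc₁]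
      refine (WP_askOneCmd hn₂ ht₂ hc₂ h20 ?_ h₂).mono fun s' _ h => ⟨?_, ?_, h.2.2⟩
      · rw [hD t ht w hw]
        congr 2
        funext j
        have hj := j.2
        rw [point, hV]
        · rw [Nat.mul_comm w, Nat.mul_add_div (by omega), Nat.div_eq_of_lt hj, Nat.mul_add_mod,
            Nat.mod_eq_of_lt hj, Nat.add_zero w]
        · have := Nat.mul_le_mul_right n (show w + 1 ≤ 2 ^ m from hw)
          rw [Nat.add_mul] at this
          omega
      · have := h.1
        simp [NExp.cost]
        omega
      · rw [h.2.1]; ring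
    · rintro s' hF ⟨-, h⟩ ht'
      refine ⟨?_, by convert h using 1; ring⟩
      simp [NExp.cost] at ht' ⊢
      omega
  · intro s' hF h ht'
    have e : (ρ * (n + 1) + (n + 1)) * 2 ^ m = (ρ + 1) * (n + 1) * 2 ^ m := by ring
    rw [e] at h
    have hc : ((NExp.dim.add (NExp.lit 1)).cost + 10) ≤ 50 := by simp [NExp.cost]
    exact ⟨by omega, h⟩

/-- Query all data. -/
def measureCmd : Cmd :=
  .put aPtr (.lit 0) ;; .put aOut (.lit 0) ;;
  .for aRep (.add (.var aR) (.var aR)) (tableCmd ;; askCmd)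

theorem WP_measureCmd {y : Index n → ℝ} {ω : ℕ → Bool} {s : State n} {m R : ℕ}
    {M : ℕ → ℕ → ℕ → ℕ} {c : ℝ} {D : ℕ → ℝ}
    (hn : s.nat 0 1 = n) (hm : s.nat aM 0 = m) (hB : s.nat aB 0 = 2 ^ m) (hR : s.nat aR 0 = R)
    (hc : s.real rScale 0 = c)
    (hM : ∀ ρ < R + R, ∀ r < m, ∀ j < n, s.nat aMat ((ρ * m + r) * n + j) = M ρ r j)
    (hz : ∀ q < n, s.nat aVec q = 0)
    (hD : ∀ ρ < R + R, ∀ t < n + 1, ∀ w < 2 ^ m,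
      D ((ρ * (n + 1) + t) * 2 ^ m + w) = c * y (point n (M ρ) m t w)) :
    WP y ω measureCmd s fun s' =>
      s'.time ≤ s.time + ((R + R) * (m * (2 ^ m * (n * 60 + 40) + 60) +
        (n + 1) * (2 ^ m * (n + 100) + 50) + 120) + 30) ∧
      s'.nat aOut 0 = (R + R) * (n + 1) * 2 ^ m ∧
      ∀ q < (R + R) * (n + 1) * 2 ^ m, s'.real rData q = D q := by
  simp only [measureCmd, WP_seq, WP_nset]
  refine WP_for (N := R + R)
    (m * (2 ^ m * (n * 60 + 40) + 60) + (n + 1) * (2 ^ m * (n + 100) + 50) + 120)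
    (fun ρ s' => s'.nat aPtr 0 = ρ * m * n ∧ s'.nat aOut 0 = ρ * (n + 1) * 2 ^ m ∧
      (∀ q < n, s'.nat aVec q = 0) ∧ ∀ q < ρ * (n + 1) * 2 ^ m, s'.real rData q = D q)
    (by decide) (fun _ _ _ h => h) (fun _ _ _ h => h) ?_ ?_ ?_ ?_
  · intro s' hF
    simp [NExp.eval, hF.nat aR (by decide), hR]
  · simpa [NExp.eval] using hz
  · rintro ρ hρ s₁ hF₁ - ⟨h1, h2, h3, h4⟩
    have hn₁ : s₁.nat 0 1 = n := by rw [hF₁.nat 0 (by decide)]; simp [hn]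
    have hm₁ : s₁.nat aM 0 = m := by rw [hF₁.nat aM (by decide)]; simp [hm]
    have hB₁ : s₁.nat aB 0 = 2 ^ m := by rw [hF₁.nat aB (by decide)]; simp [hB]
    have hc₁ : s₁.real rScale 0 = c := by rw [hF₁.real rScale (by decide)]; simp [hc]
    have hM₁ : ∀ r < m, ∀ j < n, s₁.nat aMat (ρ * m * n + r * n + j) = M ρ r j := by
      intro r hr j hj
      rw [hF₁.nat aMat (by decide), ← hM ρ hρ r hr j hj, Nat.add_mul]
      simp
    rw [WP_seq]
    refine (WP_tableCmd hn₁ hm₁ h1 hM₁ h3).mono fun s₂ hF₂ ⟨ht₂, hp₂, hV₂⟩ => ?_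
    have hn₂ : s₂.nat 0 1 = n := by rw [hF₂.nat 0 (by decide), hn₁]
    have hB₂ : s₂.nat aB 0 = 2 ^ m := by rw [hF₂.nat aB (by decide), hB₁]
    have ho₂ : s₂.nat aOut 0 = ρ * (n + 1) * 2 ^ m := by rw [hF₂.nat aOut (by decide), h2]
    have hc₂ : s₂.real rScale 0 = c := by rw [hF₂.real rScale (by decide), hc₁]
    refine (WP_askCmd hn₂ hB₂ ho₂ hc₂ hV₂ (hD ρ hρ) fun q hq => ?_).mono
      fun s₃ hF₃ ⟨ht₃, ho₃, hV₃, hY₃⟩ => ⟨?_, ?_, ho₃, ?_, hY₃⟩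
    · rw [hF₂.real rData (by decide), h4 q hq]
    · simp [NExp.cost]
      omega
    · rw [hF₃.nat aPtr (by decide), hp₂]
      ring
    -- The first `n` entries of the finished table are again the empty sum, from which the table of
    -- the next matrix can be built.
    · intro q hq
      have : q < 2 ^ m * n := hq.trans_le (Nat.le_mul_of_pos_left n (by positivity))
      rw [hV₃, hV₂ q this, Nat.div_eq_of_lt hq, rowSum_zero]
  · rintro s' hF ⟨-, h', -, h⟩ ht
    refine ⟨?_, h', h⟩
    simp [NExp.cost] at ht
    omega

/-! ### The fast Walsh-Hadamard transform -/

/-- The unnormalised Walsh-Hadamard transform of the first `2 ^ r` entries of `f`. -/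
def walsh : ℕ → (ℕ → ℝ) → ℕ → ℝ
  | 0, f, _ => f 0
  | r + 1, f, z => if z < 2 ^ r then walsh r f z + walsh r (fun w => f (2 ^ r + w)) z
      else walsh r f (z - 2 ^ r) - walsh r (fun w => f (2 ^ r + w)) (z - 2 ^ r)

/-- The transforms of all blocks of length `2 ^ r`. -/
def walshBlocks (r : ℕ) (f : ℕ → ℝ) (p : ℕ) : ℝ :=
  walsh r (fun w => f (p / 2 ^ r * 2 ^ r + w)) (p % 2 ^ r)

theorem walshBlocks_block (r : ℕ) (f : ℕ → ℝ) (b : ℕ) {z : ℕ} (hz : z < 2 ^ r) :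
    walshBlocks r f (b * 2 ^ r + z) = walsh r (fun w => f (b * 2 ^ r + w)) z := by
  have h1 : (b * 2 ^ r + z) / 2 ^ r = b := by
    rw [Nat.mul_comm, Nat.mul_add_div (by positivity), Nat.div_eq_of_lt hz, Nat.add_zero]
  have h2 : (b * 2 ^ r + z) % 2 ^ r = z := by
    rw [Nat.mul_comm, Nat.mul_add_mod, Nat.mod_eq_of_lt hz]
  rw [walshBlocks, h1, h2]

theorem walshBlocks_zero (f : ℕ → ℝ) (p : ℕ) : walshBlocks 0 f p = f p := by
  simp [walshBlocks, walsh]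

/-- With `walshBlocks_right`, the butterfly: one level of the recursion for `walsh`, expressed in
positions of the flat array. -/
theorem walshBlocks_left (r : ℕ) (f : ℕ → ℝ) (b : ℕ) {z : ℕ} (hz : z < 2 ^ r) :
    walshBlocks (r + 1) f (b * 2 ^ (r + 1) + z) =
      walshBlocks r f (b * 2 ^ (r + 1) + z) + walshBlocks r f (b * 2 ^ (r + 1) + 2 ^ r + z) := by
  have e1 : b * 2 ^ (r + 1) = 2 * b * 2 ^ r := by ring
  have e2 : b * 2 ^ (r + 1) + 2 ^ r = (2 * b + 1) * 2 ^ r := by ring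
  rw [walshBlocks_block _ _ _ (by rw [pow_succ]; omega), e2, walshBlocks_block _ _ _ hz, e1,
    walshBlocks_block _ _ _ hz, walsh, if_pos hz]
  simp only [Nat.add_mul, one_mul, add_assoc]

theorem walshBlocks_right (r : ℕ) (f : ℕ → ℝ) (b : ℕ) {z : ℕ} (hz : z < 2 ^ r) :
    walshBlocks (r + 1) f (b * 2 ^ (r + 1) + 2 ^ r + z) =
      walshBlocks r f (b * 2 ^ (r + 1) + z) - walshBlocks r f (b * 2 ^ (r + 1) + 2 ^ r + z) := by
  have e1 : b * 2 ^ (r + 1) = 2 * b * 2 ^ r := by ring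
  have e2 : b * 2 ^ (r + 1) + 2 ^ r = (2 * b + 1) * 2 ^ r := by ring
  have e3 : b * 2 ^ (r + 1) + 2 ^ r + z = b * 2 ^ (r + 1) + (2 ^ r + z) := by ring
  have e4 : 2 ^ r + z - 2 ^ r = z := by omega
  nth_rw 1 [e3]
  rw [walshBlocks_block _ _ _ (by rw [pow_succ]; omega), e2, walshBlocks_block _ _ _ hz, e1,
    walshBlocks_block _ _ _ hz, walsh, if_neg (by omega), e4]
  simp only [Nat.add_mul, one_mul, add_assoc]

/-- One butterfly of the transform. -/
def butterflyCmd : Cmd :=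
  .rset rTmp (.lit 0) (.sub (.get rData (.add (.var aBase) (.var aPos)))
    (.get rData (.add (.add (.var aBase) (.var aStep)) (.var aPos)))) ;;
  .rset rData (.add (.var aBase) (.var aPos))
    (.add (.get rData (.add (.var aBase) (.var aPos)))
      (.get rData (.add (.add (.var aBase) (.var aStep)) (.var aPos)))) ;;
  .rset rData (.add (.add (.var aBase) (.var aStep)) (.var aPos)) (.get rTmp (.lit 0))

/-- The Walsh-Hadamard transform of all blocks of data. -/
def walshCmd : Cmd :=
  .put aStep (.lit 1) ;;
  .for aRow (.var aM) (
    .put aBase (.lit 0) ;;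
    .loop (.nlt (.var aBase) (.var aOut))
      (.for aPos (.var aStep) butterflyCmd ;; .inc aBase (.var aStep) ;; .inc aBase (.var aStep)) ;;
    .dbl aStep)

/-- The butterflies of the blocks before `b`, and `i` butterflies of the block at `b`, have
replaced the values of `f` by the values of `g`. -/
def Mixed (f g : ℕ → ℝ) (N b h i : ℕ) (s : State n) : Prop :=
  ∀ p < N, s.real rData p = if p < b + i ∨ b + h ≤ p ∧ p < b + h + i then g p else f p

theorem WP_butterflyCmd {y : Index n → ℝ} {ω : ℕ → Bool} {s : State n} {f g : ℕ → ℝ}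
    {N b h i : ℕ} (hi : i < h) (hN : b + h + h ≤ N) (hb : s.nat aBase 0 = b)
    (hh : s.nat aStep 0 = h) (hp : s.nat aPos 0 = i)
    (hl : g (b + i) = f (b + i) + f (b + h + i)) (hr : g (b + h + i) = f (b + i) - f (b + h + i))
    (hs : Mixed f g N b h i s) :
    WP y ω butterflyCmd s fun s' => s'.time ≤ s.time + 60 ∧ Mixed f g N b h (i + 1) s' := by
  have h1 := hs (b + i) (by omega)
  have h2 := hs (b + h + i) (by omega)
  rw [if_neg (by omega)] at h1 h2
  simp only [butterflyCmd, WP_seq, WP_rset]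
  refine ⟨by simp [NExp.cost, RExp.cost], fun p hpN => ?_⟩
  simp [NExp.eval, RExp.eval, hb, hh, hp, h1, h2]
  by_cases e1 : p = b + h + i
  · subst e1
    rw [if_pos rfl, if_pos (by omega), hr]
  by_cases e2 : p = b + i
  · subst e2
    rw [if_neg e1, if_pos rfl, if_pos (by omega), hl]
  · rw [if_neg e1, if_neg e2, hs p hpN]
    congr 1
    apply propext
    omega

/-- The data of all repetitions and shifts are consecutive blocks of length `2 ^ m`, so a single
in-place pass per level transforms all of them. At level `r < m` the array splits into `N * 2 ^ (m -
r - 1)` blocks of length `2 ^ (r + 1)`. -/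
theorem WP_walshCmd {y : Index n → ℝ} {ω : ℕ → Bool} {s : State n} {m N : ℕ}
    (hm : s.nat aM 0 = m) (hN : s.nat aOut 0 = N * 2 ^ m) :
    WP y ω walshCmd s fun s' =>
      s'.time ≤ s.time + (m * (N * 2 ^ m * 100 + 60) + 40) ∧
      ∀ p < N * 2 ^ m, s'.real rData p = walshBlocks m (s.real rData) p := by
  set f := s.real rData with hf
  simp only [walshCmd, WP_seq, WP_nset]
  refine WP_for (N := m) (N * 2 ^ m * 100 + 60) (fun r s' => s'.nat aStep 0 = 2 ^ r ∧
    ∀ p < N * 2 ^ m, s'.real rData p = walshBlocks r f p) (by decide)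
    (fun _ _ _ h => h) (fun _ _ _ h => h) ?_ ?_ ?_ ?_
  · intro s' hF
    simp [NExp.eval, hF.nat aM (by decide), hm]
  · simp [NExp.eval, walshBlocks_zero, hf]
  · rintro r hr s₁ hF₁ - ⟨h11, h12⟩
    have ho₁ : s₁.nat aOut 0 = N * 2 ^ m := by rw [hF₁.nat aOut (by decide)]; simp [hN]
    have hblocks : N * 2 ^ (m - r - 1) * 2 ^ (r + 1) = N * 2 ^ m := by
      rw [mul_assoc, ← pow_add]
      congr 2
      omega
    simp only [WP_seq, WP_nset]
    refine WP_loop (N := N * 2 ^ (m - r - 1)) (T := 2 ^ (r + 1) * 100)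
      (fun b s' => s'.nat aBase 0 = b * 2 ^ (r + 1) ∧
        Mixed (walshBlocks r f) (walshBlocks (r + 1) f) (N * 2 ^ m) (b * 2 ^ (r + 1)) (2 ^ r) 0 s')
      (fun _ _ _ h => h) ?_ ?_ ?_ ?_
    · refine ⟨by simp [NExp.eval], fun p hp => ?_⟩
      rw [if_neg (by omega)]
      simpa using h12 p hp
    · rintro b hb s₂ hF₂ ⟨h21, h22⟩
      have hlt : b * 2 ^ (r + 1) + 2 ^ (r + 1) ≤ N * 2 ^ m := by
        rw [← hblocks, ← Nat.succ_mul]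
        exact Nat.mul_le_mul_right _ hb
      have hpos : 0 < 2 ^ r := by positivity
      have ho₂ : s₂.nat aOut 0 = N * 2 ^ m := by rw [hF₂.nat aOut (by decide)]; simp [ho₁]
      have hs₂ : s₂.nat aStep 0 = 2 ^ r := by rw [hF₂.nat aStep (by decide)]; simp [h11]
      refine ⟨?_, ?_⟩
      · simp [BExp.Holds, NExp.eval, h21, ho₂]
        rw [pow_succ] at hlt ⊢
        omega
      rw [WP_seq]
      refine WP_for (N := 2 ^ r) 80 (Mixed (walshBlocks r f) (walshBlocks (r + 1) f) (N * 2 ^ m)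
        (b * 2 ^ (r + 1)) (2 ^ r)) (by decide) (fun _ _ _ h => h) (fun _ _ _ h => h) ?_ h22 ?_ ?_
      · intro s' hF
        simp [NExp.eval, hF.nat aStep (by decide), hs₂]
      · intro i hi s₃ hF₃ hi₃ h₃
        refine (WP_butterflyCmd hi ?_ (by rw [hF₃.nat aBase (by decide), h21])
          (by rw [hF₃.nat aStep (by decide), hs₂]) hi₃ (walshBlocks_left r f b hi)
          (walshBlocks_right r f b hi) h₃).mono fun s' _ h => ⟨?_, h.2⟩
        · rw [pow_succ] at hlt ⊢
          omega
        · have := h.1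
          simp [NExp.cost]
          omega
      · intro s₃ hF₃ h₃ ht
        have hb₃ : s₃.nat aBase 0 = b * 2 ^ (r + 1) := by rw [hF₃.nat aBase (by decide), h21]
        have hs₃ : s₃.nat aStep 0 = 2 ^ r := by rw [hF₃.nat aStep (by decide), hs₂]
        simp only [WP_seq, WP_nset]
        refine ⟨?_, ?_, fun p hp => ?_⟩
        · simp [NExp.cost, BExp.cost, pow_succ] at ht ⊢
          omega
        · simp [NExp.eval, hb₃, hs₃]
          ring
        · refine Eq.trans ?_ ((h₃ p hp).trans ?_)
          · simp
          · congr 1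
            apply propext
            have : (b + 1) * 2 ^ (r + 1) = b * 2 ^ (r + 1) + 2 ^ r + 2 ^ r := by ring
            rw [this]
            omega
    · rintro s₂ hF₂ ⟨h21, -⟩
      have ho₂ : s₂.nat aOut 0 = N * 2 ^ m := by rw [hF₂.nat aOut (by decide)]; simp [ho₁]
      simp [BExp.Holds, NExp.eval, h21, ho₂, hblocks]
    · rintro s₂ hF₂ ⟨h21, h22⟩ ht
      have hs₂ : s₂.nat aStep 0 = 2 ^ r := by rw [hF₂.nat aStep (by decide)]; simp [h11]
      have e : N * 2 ^ (m - r - 1) * (2 ^ (r + 1) * 100) = N * 2 ^ m * 100 := by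
        rw [← mul_assoc, hblocks]
      rw [e] at ht
      refine ⟨?_, ?_, fun p hp => ?_⟩
      · simp [NExp.cost, BExp.cost] at ht ⊢
        omega
      · simp [NExp.eval, hs₂]
        ring
      · refine Eq.trans ?_ ((h22 p hp).trans ?_)
        · simp
        · rw [hblocks, if_pos (by omega)]
  · rintro s' hF ⟨-, h⟩ ht
    refine ⟨?_, h⟩
    simp [NExp.cost] at ht
    omega

/-! ### Identification of the large coefficients -/

/-- The digits of an index, as natural numbers. -/
def digit (i : Index n) (j : ℕ) : ℕ := if h : j < n then (i ⟨j, h⟩).val else 0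

/-- The number with binary digits `f 0, …, f (j - 1)`. -/
def horner (f : ℕ → ℕ) : ℕ → ℕ
  | 0 => 0
  | j + 1 => horner f j + horner f j + f j

/-- The number that is used as the address of an index. -/
def code (i : Index n) : ℕ := horner (digit i) n

theorem digit_lt (i : Index n) (j : ℕ) : digit i j < 2 := by
  unfold digit
  split_ifs with h
  · exact (i ⟨j, h⟩).val_lt
  · norm_num

/-- The parity of a Horner value is its last digit, so the digits can be recovered one by one.
Injectivity allows counters to be kept at the address `code i`; as the memory starts out as zero,
they need no initialisation. -/
theorem code_injective : Function.Injective (code : Index n → ℕ) := by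
  have key : ∀ f g : ℕ → ℕ, (∀ j, f j < 2) → (∀ j, g j < 2) → ∀ j, horner f j = horner g j →
      ∀ l < j, f l = g l := by
    intro f g hf hg j
    induction j with
    | zero => intro _ l hl; omega
    | succ j ih =>
      intro h
      simp only [horner] at h
      have h1 := hf j
      have h2 := hg j
      refine Nat.forall_lt_succ_right.2 ⟨ih (by omega), by omega⟩
  intro i i' h
  funext j
  have := key _ _ (digit_lt i) (digit_lt i') n h j j.2
  simp only [digit, j.2, dif_pos, Fin.eta] at this
  exact ZMod.val_injective 2 this

/-- The index that is read off from the signs of the data for a bucket. -/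
def decode (n : ℕ) (Y : ℕ → ℝ) (B q : ℕ) : Index n := fun j =>
  if Y q * Y (q + ((j : ℕ) + 1) * B) < 0 then 1 else 0

/-- Read off an index. -/
def decodeCmd : Cmd :=
  .put aPos (.var aSrc) ;; .put aCode (.lit 0) ;;
  .for aCol .dim (
    .inc aPos (.var aB) ;;
    .ite (.rlt (.mul (.get rData (.var aSrc)) (.get rData (.var aPos))) (.ofNat (.lit 0)))
      (.nset aBits (.add (.var aEnd) (.var aCol)) (.lit 1) ;; .dbl aCode ;; .succ aCode)
      (.nset aBits (.add (.var aEnd) (.var aCol)) (.lit 0) ;; .dbl aCode))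

/-- The digits are written behind the bits of the listed indices before it is known whether the new
index will be listed. A rejected candidate is overwritten by the next one, and the bits in front are
untouched. -/
theorem WP_decodeCmd {y : Index n → ℝ} {ω : ℕ → Bool} {s : State n} {B q e : ℕ}
    (hn : s.nat 0 1 = n) (hB : s.nat aB 0 = B) (hq : s.nat aSrc 0 = q) (he : s.nat aEnd 0 = e) :
    WP y ω decodeCmd s fun s' => s'.time ≤ s.time + (n * 80 + 40) ∧
      s'.nat aCode 0 = code (decode n (s.real rData) B q) ∧
      (∀ j < n, s'.nat aBits (e + j) = digit (decode n (s.real rData) B q) j) ∧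
      ∀ p < e, s'.nat aBits p = s.nat aBits p := by
  set i := decode n (s.real rData) B q with hi
  simp only [decodeCmd, WP_seq, WP_nset]
  refine WP_for (N := n) 80 (fun j s' => s'.nat aPos 0 = q + j * B ∧
      s'.nat aCode 0 = horner (digit i) j ∧ (∀ l < j, s'.nat aBits (e + l) = digit i l) ∧
      ∀ p < e, s'.nat aBits p = s.nat aBits p) (by decide)
    (fun _ _ _ h => h) (fun _ _ _ h => h) ?_ ?_ ?_ ?_
  · intro s' hF
    simp [NExp.eval, hF.nat 0 (by decide), hn]
  · simp [NExp.eval, horner, hq]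
  · rintro j hj s₁ hF₁ hj₁ ⟨h1, h2, h3, h4⟩
    have hB₁ : s₁.nat aB 0 = B := by rw [hF₁.nat aB (by decide)]; simp [hB]
    have hq₁ : s₁.nat aSrc 0 = q := by rw [hF₁.nat aSrc (by decide)]; simp [hq]
    have he₁ : s₁.nat aEnd 0 = e := by rw [hF₁.nat aEnd (by decide)]; simp [he]
    have hY₁ : s₁.real rData = s.real rData := by rw [hF₁.real rData (by decide)]; simp
    have e1 : q + j * B + B = q + (j + 1) * B := by ring
    simp only [WP_seq, WP_ite, WP_nset]
    refine ⟨fun hb => ?_, fun hb => ?_⟩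
    · have hd : digit i j = 1 := by
        simp [BExp.Holds, RExp.eval, NExp.eval, hq₁, hY₁, h1, hB₁, e1] at hb
        simp [digit, hj, hi, decode, hb, ZMod.val_one]
      refine ⟨by simp [NExp.cost, BExp.cost, RExp.cost], ?_, ?_,
        Nat.forall_lt_succ_right.2 ⟨fun l hl => ?_, ?_⟩, fun p hp => ?_⟩
      · simp [NExp.eval, h1, hB₁, e1]
      · simp [NExp.eval, h2, horner, hd]
      · simp [NExp.eval, he₁, hj₁, hl.ne, h3 l hl]
      · simp [NExp.eval, he₁, hj₁, hd]
      · have : p ≠ e + j := by omega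
        simp [NExp.eval, he₁, hj₁, h4 p hp, this]
    · have hd : digit i j = 0 := by
        simp [BExp.Holds, RExp.eval, NExp.eval, hq₁, hY₁, h1, hB₁, e1] at hb
        simp [digit, hj, hi, decode, hb]
      refine ⟨by simp [NExp.cost, BExp.cost, RExp.cost], ?_, ?_,
        Nat.forall_lt_succ_right.2 ⟨fun l hl => ?_, ?_⟩, fun p hp => ?_⟩
      · simp [NExp.eval, h1, hB₁, e1]
      · simp [NExp.eval, h2, horner, hd]
      · simp [NExp.eval, he₁, hj₁, hl.ne, h3 l hl]
      · simp [NExp.eval, he₁, hj₁, hd]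
      · have : p ≠ e + j := by omega
        simp [NExp.eval, he₁, hj₁, h4 p hp, this]
  · rintro s' hF ⟨-, h2, h3, h4⟩ ht
    refine ⟨?_, h2, h3, h4⟩
    simp [NExp.cost] at ht
    omega

/-- The number of occurrences of `i` among the first `P` candidates. -/
def tally (c : ℕ → Index n) (P : ℕ) (i : Index n) : ℕ :=
  ∑ p ∈ Finset.range P, if c p = i then 1 else 0

/-- The list of the indices that are stored in the memory. -/
structure Stored (l : List (Index n)) (s : State n) : Prop where
  len : s.nat aLen 0 = l.length
  fin : s.nat aEnd 0 = l.length * n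
  addr : ∀ p < l.length, s.nat aAddr p = p * n
  bits : ∀ (p : ℕ) (h : p < l.length), ∀ j < n, s.nat aBits (p * n + j) = digit l[p] j

/-- After `P` candidates, those of them that have occurred at least `R / 2` times are listed. -/
structure Listing (c : ℕ → Index n) (R P : ℕ) (l : List (Index n)) (s : State n) : Prop where
  stored : Stored l s
  nodup : l.Nodup
  mem : ∀ i, i ∈ l ↔ R ≤ 2 * tally c P i
  seen : ∀ i : Index n, s.nat aSeen (code i) = 2 * tally c P i
  listed : ∀ i : Index n, s.nat aListed (code i) = if i ∈ l then 1 else 0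

/-- Read off an index, count it, and list it if it has occurred often enough. -/
def recordCmd : Cmd :=
  decodeCmd ;;
  .nset aSeen (.var aCode) (.add (.get aSeen (.var aCode)) (.lit 2)) ;;
  .ite (.conj (.neg (.nlt (.get aSeen (.var aCode)) (.var aR)))
      (.nlt (.get aListed (.var aCode)) (.lit 1)))
    (.nset aListed (.var aCode) (.lit 1) ;; .nset aAddr (.var aLen) (.var aEnd) ;;
      .succ aLen ;; .inc aEnd .dim)
    .skip ;;
  .succ aSrc

/-- Counting in steps of `2` permits a comparison with `R` instead of `R / 2`. The flag in `aListed`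
makes an index enter only when it first reaches the threshold, which keeps the list free of
duplicates. -/
theorem WP_recordCmd {y : Index n → ℝ} {ω : ℕ → Bool} {s : State n} {B q R P : ℕ}
    {c : ℕ → Index n} {l : List (Index n)}
    (hn : s.nat 0 1 = n) (hB : s.nat aB 0 = B) (hR : s.nat aR 0 = R) (hq : s.nat aSrc 0 = q)
    (hc : decode n (s.real rData) B q = c P) (hs : Listing c R P l s) :
    WP y ω recordCmd s fun s' => s'.time ≤ s.time + (n * 80 + 140) ∧ s'.nat aSrc 0 = q + 1 ∧
      ∃ l', Listing c R (P + 1) l' s' := by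
  rw [recordCmd, WP_seq]
  refine (WP_decodeCmd hn hB hq hs.stored.fin).mono fun s₁ hF₁ ⟨ht, h1, h2, h3⟩ => ?_
  rw [hc] at h1 h2
  have hn₁ : s₁.nat 0 1 = n := by rw [hF₁.nat 0 (by decide), hn]
  have hR₁ : s₁.nat aR 0 = R := by rw [hF₁.nat aR (by decide), hR]
  have hq₁ : s₁.nat aSrc 0 = q := by rw [hF₁.nat aSrc (by decide), hq]
  have hseen : ∀ i : Index n, s₁.nat aSeen (code i) = 2 * tally c P i := fun i => by
    rw [hF₁.nat aSeen (by decide), hs.seen]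
  have hlisted : ∀ i : Index n, s₁.nat aListed (code i) = if i ∈ l then 1 else 0 := fun i => by
    rw [hF₁.nat aListed (by decide), hs.listed]
  have hlen : s₁.nat aLen 0 = l.length := by rw [hF₁.nat aLen (by decide), hs.stored.len]
  have hend : s₁.nat aEnd 0 = l.length * n := by rw [hF₁.nat aEnd (by decide), hs.stored.fin]
  have haddr : ∀ p < l.length, s₁.nat aAddr p = p * n := fun p hp => by
    rw [hF₁.nat aAddr (by decide), hs.stored.addr p hp]
  have hbits : ∀ (p : ℕ) (h : p < l.length), ∀ j < n,
      s₁.nat aBits (p * n + j) = digit l[p] j := fun p hp j hj => by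
    rw [h3, hs.stored.bits p hp j hj]
    have := Nat.mul_le_mul_right n (show p + 1 ≤ l.length from hp)
    rw [Nat.add_mul] at this
    omega
  have htally : ∀ i, tally c (P + 1) i = tally c P i + if c P = i then 1 else 0 := fun i =>
    Finset.sum_range_succ _ _
  have hcode : ∀ i : Index n, code i = code (c P) ↔ i = c P := fun i => code_injective.eq_iff
  simp only [WP_seq, WP_nset, WP_ite, WP_skip]
  refine ⟨fun hb => ?_, fun hb => ?_⟩
  · simp [BExp.Holds, NExp.eval, h1, hseen, hR₁, hlisted] at hb
    obtain ⟨hb1, hb2⟩ := hb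
    refine ⟨by simp [NExp.cost, BExp.cost]; omega, by simp [NExp.eval, hq₁], l ++ [c P],
      ⟨?_, ?_, ?_, ?_⟩, ?_, fun i => ?_, fun i => ?_, fun i => ?_⟩
    · simp [NExp.eval, hlen]
    · simp [NExp.eval, hend, hn₁]; ring
    · simp only [List.length_append, List.length_cons, List.length_nil, zero_add]
      refine Nat.forall_lt_succ_right.2 ⟨fun p hp => ?_, ?_⟩
      · simp [NExp.eval, hlen, hp.ne, haddr p hp]
      · simp [NExp.eval, hlen, hend]
    · intro p hp j hj
      simp only [List.length_append, List.length_cons, List.length_nil, zero_add] at hp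
      rcases Nat.lt_succ_iff_lt_or_eq.1 hp with hp | rfl
      · simp [List.getElem_append_left hp, hbits p hp j hj]
      · simp [h2 j hj]
    · exact List.Nodup.append hs.nodup (List.nodup_singleton _) (by simpa using hb2)
    · rw [htally, List.mem_append, hs.mem, List.mem_singleton]
      by_cases hi : c P = i
      · subst hi; simp; omega
      · simp [hi, Ne.symm hi]
    · rw [htally]
      by_cases hi : c P = i
      · subst hi; simp [NExp.eval, h1, hseen]; ring
      · simp [NExp.eval, h1, hcode, hi, Ne.symm hi, hseen]
    · by_cases hi : c P = i
      · subst hi; simp [NExp.eval, h1]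
      · simp [NExp.eval, h1, hcode, Ne.symm hi, hlisted]
  · simp [BExp.Holds, NExp.eval, h1, hseen, hR₁, hlisted] at hb
    refine ⟨by simp [NExp.cost, BExp.cost]; omega, by simp [NExp.eval, hq₁], l,
      ⟨?_, ?_, ?_, ?_⟩, hs.nodup, fun i => ?_, fun i => ?_, fun i => ?_⟩
    · simp [hlen]
    · simp [hend]
    · intro p hp
      simp [haddr p hp]
    · intro p hp j hj
      simp [hbits p hp j hj]
    · rw [htally, hs.mem]
      by_cases hi : c P = i
      · subst hi
        simp only [if_true]
        constructor
        · omega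
        · intro h
          exact (hs.mem _).1 (hb (by omega))
      · simp [hi]
    · rw [htally]
      by_cases hi : c P = i
      · subst hi; simp [NExp.eval, h1, hseen]; ring
      · simp [NExp.eval, h1, hcode, hi, Ne.symm hi, hseen]
    · simp [hlisted]

/-- List the indices that are read off from the data for many hash functions. -/
def identifyCmd : Cmd :=
  .put aStride (.lit 0) ;; .for aCol (.add .dim (.lit 1)) (.inc aStride (.var aB)) ;;
  .put aLen (.lit 0) ;; .put aEnd (.lit 0) ;; .put aBase (.lit 0) ;;
  .for aRep (.var aR) (
    .put aSrc (.var aBase) ;; .for aBucket (.var aB) recordCmd ;; .inc aBase (.var aStride))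

theorem WP_identifyCmd {y : Index n → ℝ} {ω : ℕ → Bool} {s : State n} {B R : ℕ}
    {c : ℕ → Index n}
    (hn : s.nat 0 1 = n) (hB : s.nat aB 0 = B) (hR : s.nat aR 0 = R) (hR0 : 0 < R)
    (hseen : s.nat aSeen = 0) (hlisted : s.nat aListed = 0)
    (hc : ∀ ρ < R, ∀ z < B, c (ρ * B + z) = decode n (s.real rData) B (ρ * (n + 1) * B + z)) :
    WP y ω identifyCmd s fun s' =>
      s'.time ≤ s.time + (R * (B * (n * 80 + 160) + 50) + n * 30 + 100) ∧
      s'.nat aStride 0 = (n + 1) * B ∧ s'.nat aBase 0 = R * (n + 1) * B ∧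
      ∃ l, Listing c R (R * B) l s' := by
  simp only [identifyCmd, WP_seq, WP_nset]
  refine WP_for (N := n + 1) 30 (fun t s' => s'.nat aStride 0 = t * B) (by decide)
    (fun _ _ _ h => h) (fun _ _ _ h => h) ?_ (by simp [NExp.eval]) ?_ ?_
  · intro s' hF
    simp [NExp.eval, hF.nat 0 (by decide), hn]
  · intro t ht s₁ hF₁ _ h
    have hB₁ : s₁.nat aB 0 = B := by rw [hF₁.nat aB (by decide)]; simp [hB]
    simp [NExp.eval, NExp.cost, h, hB₁]
    ring
  intro s₀ hF₀ hst₀ ht₀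
  have hn₀ : s₀.nat 0 1 = n := by rw [hF₀.nat 0 (by decide)]; simp [hn]
  have hB₀ : s₀.nat aB 0 = B := by rw [hF₀.nat aB (by decide)]; simp [hB]
  have hR₀ : s₀.nat aR 0 = R := by rw [hF₀.nat aR (by decide)]; simp [hR]
  have hY₀ : s₀.real rData = s.real rData := by rw [hF₀.real rData (by decide)]; simp
  have hseen₀ : s₀.nat aSeen = 0 := by rw [hF₀.nat aSeen (by decide)]; simp [hseen]
  have hlisted₀ : s₀.nat aListed = 0 := by rw [hF₀.nat aListed (by decide)]; simp [hlisted]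
  refine WP_for (N := R) (B * (n * 80 + 160) + 50) (fun ρ s' => s'.nat aBase 0 = ρ * (n + 1) * B ∧
      ∃ l, Listing c R (ρ * B) l s') (by decide)
    (fun _ _ _ ⟨h, l, hs⟩ => ⟨h, l, ⟨hs.1.1, hs.1.2, hs.1.3, hs.1.4⟩, hs.2, hs.3, hs.4, hs.5⟩)
    (fun _ _ _ ⟨h, l, hs⟩ => ⟨h, l, ⟨hs.1.1, hs.1.2, hs.1.3, hs.1.4⟩, hs.2, hs.3, hs.4, hs.5⟩)
    ?_ ?_ ?_ ?_
  · intro s' hF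
    simp [NExp.eval, hF.nat aR (by decide), hR₀]
  · refine ⟨by simp [NExp.eval], [], ⟨?_, ?_, ?_, ?_⟩, List.nodup_nil, fun i => ?_, fun i => ?_,
      fun i => ?_⟩
    · simp [NExp.eval]
    · simp [NExp.eval]
    · simp
    · simp
    -- The empty list is correct at the start because `R > 0`: a tally of zero is below the
    -- threshold.
    · simp [tally]; omega
    · simp [tally, hseen₀]
    · simp [hlisted₀]
  · rintro ρ hρ s₁ hF₁ - ⟨hb₁, h₁⟩
    have hn₁ : s₁.nat 0 1 = n := by rw [hF₁.nat 0 (by decide)]; simp [hn₀]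
    have hB₁ : s₁.nat aB 0 = B := by rw [hF₁.nat aB (by decide)]; simp [hB₀]
    have hR₁ : s₁.nat aR 0 = R := by rw [hF₁.nat aR (by decide)]; simp [hR₀]
    have hst₁ : s₁.nat aStride 0 = (n + 1) * B := by
      rw [hF₁.nat aStride (by decide)]; simp [hst₀]
    have hY₁ : s₁.real rData = s.real rData := by rw [hF₁.real rData (by decide)]; simp [hY₀]
    simp only [WP_seq, WP_nset]
    refine WP_for (N := B) (n * 80 + 160) (fun z s' => s'.nat aSrc 0 = ρ * (n + 1) * B + z ∧
        ∃ l, Listing c R (ρ * B + z) l s') (by decide)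
      (fun _ _ _ ⟨h, l, hs⟩ => ⟨h, l, ⟨hs.1.1, hs.1.2, hs.1.3, hs.1.4⟩, hs.2, hs.3, hs.4, hs.5⟩)
      (fun _ _ _ ⟨h, l, hs⟩ => ⟨h, l, ⟨hs.1.1, hs.1.2, hs.1.3, hs.1.4⟩, hs.2, hs.3, hs.4, hs.5⟩)
      ?_ ?_ ?_ ?_
    · intro s' hF
      simp [NExp.eval, hF.nat aB (by decide), hB₁]
    · obtain ⟨l, hs⟩ := h₁
      exact ⟨by simp [NExp.eval, hb₁], l, ⟨hs.1.1, hs.1.2, hs.1.3, hs.1.4⟩, hs.2, hs.3, hs.4, hs.5⟩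
    · rintro z hz s₂ hF₂ - ⟨h21, l, h22⟩
      have hn₂ : s₂.nat 0 1 = n := by rw [hF₂.nat 0 (by decide)]; simp [hn₁]
      have hB₂ : s₂.nat aB 0 = B := by rw [hF₂.nat aB (by decide)]; simp [hB₁]
      have hR₂ : s₂.nat aR 0 = R := by rw [hF₂.nat aR (by decide)]; simp [hR₁]
      have hY₂ : s₂.real rData = s.real rData := by rw [hF₂.real rData (by decide)]; simp [hY₁]
      refine (WP_recordCmd hn₂ hB₂ hR₂ h21 (by rw [hY₂, hc ρ hρ z hz]) h22).mono
        fun s' _ h => ⟨?_, h.2.1, h.2.2⟩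
      have := h.1
      simp [NExp.cost]
      omega
    · rintro s₂ hF₂ ⟨-, l, hs⟩ ht
      have hb₂ : s₂.nat aBase 0 = ρ * (n + 1) * B := by
        rw [hF₂.nat aBase (by decide)]; simp [hb₁]
      have hst₂ : s₂.nat aStride 0 = (n + 1) * B := by
        rw [hF₂.nat aStride (by decide)]; simp [hst₁]
      have e : ρ * B + B = (ρ + 1) * B := by ring
      rw [e] at hs
      refine ⟨?_, ?_, l, ⟨hs.1.1, hs.1.2, hs.1.3, hs.1.4⟩, hs.2, hs.3, hs.4, hs.5⟩
      · simp [NExp.cost] at ht ⊢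
        omega
      · simp [NExp.eval, hb₂, hst₂]
        ring
  · rintro s' hF ⟨hb, hl⟩ ht
    have hst : s'.nat aStride 0 = (n + 1) * B := by
      rw [hF.nat aStride (by decide)]; simp [hst₀]
    refine ⟨?_, hst, hb, hl⟩
    simp [NExp.cost] at ht ht₀
    omega

/-! ### Sorting -/

/-- The list of the entries of `f` at `a, …, a + l - 1`. -/
def segment (f : ℕ → ℕ) (a l : ℕ) : List ℕ := (List.range' a l).map f

theorem segment_zero (f : ℕ → ℕ) (a : ℕ) : segment f a 0 = [] := rfl

theorem segment_succ (f : ℕ → ℕ) (a l : ℕ) : segment f a (l + 1) = f a :: segment f (a + 1) l := by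
  simp [segment, List.range'_succ]

theorem segment_concat (f : ℕ → ℕ) (a l : ℕ) :
    segment f a (l + 1) = segment f a l ++ [f (a + l)] := by
  simp [segment, List.range'_1_concat]

theorem segment_add (f : ℕ → ℕ) (a l l' : ℕ) :
    segment f a (l + l') = segment f a l ++ segment f (a + l) l' := by
  have := List.range'_append (s := a) (m := l) (n := l') (step := 1)
  rw [one_mul] at this
  rw [segment, ← this, List.map_append]
  rfl

theorem segment_congr {f g : ℕ → ℕ} {a b l : ℕ} (h : ∀ i < l, f (a + i) = g (b + i)) :
    segment f a l = segment g b l := by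
  induction l with
  | zero => rfl
  | succ l ih =>
    rw [segment_concat, segment_concat, ih fun i hi => h i (by omega), h l (by omega)]

/-- Comparison of positions by the values of `κ`. -/
def byKey (κ : ℕ → ℝ) (p q : ℕ) : Bool := decide (κ p ≤ κ q)

/-- The list is sorted by the values of `κ`. -/
def SortedBy (κ : ℕ → ℝ) (l : List ℕ) : Prop := l.Pairwise fun p q => κ p ≤ κ q

theorem SortedBy.merge {κ : ℕ → ℝ} {l l' : List ℕ} (h : SortedBy κ l) (h' : SortedBy κ l') :
    SortedBy κ (l.merge l' (byKey κ)) := by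
  unfold SortedBy at *
  have := List.pairwise_merge (le := byKey κ)
    (fun a b c hab hbc => by
      simp only [byKey, decide_eq_true_eq] at *; exact hab.trans hbc)
    (fun a b => by simpa [byKey] using le_total (κ a) (κ b)) l l'
    (by simpa [byKey] using h) (by simpa [byKey] using h')
  simpa [byKey] using this

/-- Move the smaller one of the first elements of two sorted blocks. -/
def pickCmd (a : ℕ) : Cmd :=
  .ite (.conj (.nlt (.var aLeft) (.var aMid))
      (.neg (.conj (.nlt (.var aRight) (.var aStop))
        (.rlt (.get a (.get aPerm (.var aRight))) (.get a (.get aPerm (.var aLeft)))))))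
    (.nset aAux (.var aPos) (.get aPerm (.var aLeft)) ;; .succ aLeft)
    (.nset aAux (.var aPos) (.get aPerm (.var aRight)) ;; .succ aRight)

/-- Merge two sorted blocks. -/
def mergeCmd (a : ℕ) : Cmd :=
  .put aMid (.add (.var aBase) (.var aStep)) ;; .put aStop (.add (.var aMid) (.var aStep)) ;;
  .put aLeft (.var aBase) ;; .put aRight (.var aMid) ;;
  .for aPos (.add (.var aStep) (.var aStep)) (pickCmd a) ;;
  .for aPos (.add (.var aStep) (.var aStep))
    (.nset aPerm (.add (.var aBase) (.var aPos)) (.get aAux (.var aPos)))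

/-- Sort the positions `0, …, aSortLen - 1` by the entries of the real array `a`. -/
def sortCmd (a : ℕ) : Cmd :=
  .for aPos (.var aSortLen) (.nset aPerm (.var aPos) (.var aPos)) ;;
  .put aStep (.lit 1) ;;
  .loop (.nlt (.var aStep) (.var aSortLen)) (
    .put aBase (.lit 0) ;;
    .loop (.nlt (.var aBase) (.var aSortLen))
      (mergeCmd a ;; .inc aBase (.var aStep) ;; .inc aBase (.var aStep)) ;;
    .dbl aStep)

/-- After `o` steps of merging, `l` is what remains to be moved. -/
structure Merging (κ : ℕ → ℝ) (f : ℕ → ℕ) (mid last o : ℕ) (l : List ℕ) (s : State n) : Prop where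
  perm : s.nat aPerm = f
  left : s.nat aLeft 0 ≤ mid
  right : s.nat aRight 0 ≤ last
  count : (mid - s.nat aLeft 0) + (last - s.nat aRight 0) + o = last - (mid - (last - mid))
  eq : segment (s.nat aAux) 0 o ++ (segment f (s.nat aLeft 0) (mid - s.nat aLeft 0)).merge
    (segment f (s.nat aRight 0) (last - s.nat aRight 0)) (byKey κ) = l

/-- What has been moved, followed by the merge of what remains, is always the same list `l`, and a
step takes off the head of that merge. Ties go to the left block, as `List.merge` does with `byKey`.
The bound `last - (mid - (last - mid))` is twice the length of a block. -/
theorem WP_pickCmd {y : Index n → ℝ} {ω : ℕ → Bool} {s : State n} {a mid last o : ℕ}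
    {κ : ℕ → ℝ} {f : ℕ → ℕ} {l : List ℕ} (hκ : s.real a = κ) (hmid : s.nat aMid 0 = mid)
    (hlast : s.nat aStop 0 = last) (ho : s.nat aPos 0 = o)
    (hlt : o < last - (mid - (last - mid))) (h : Merging κ f mid last o l s) :
    WP y ω (pickCmd a) s fun s' => s'.time ≤ s.time + 40 ∧ Merging κ f mid last (o + 1) l s' := by
  obtain ⟨h1, h2, h3, h4, h5⟩ := h
  generalize hi : s.nat aLeft 0 = i at *
  generalize hj : s.nat aRight 0 = j at *
  have haux : ∀ v, segment (fun q => if q = o then v else s.nat aAux q) 0 (o + 1) =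
      segment (s.nat aAux) 0 o ++ [v] := fun v => by
    rw [segment_concat]
    congr 1
    · refine segment_congr fun q hq => ?_
      simp [hq.ne]
    · simp
  simp only [pickCmd, WP_ite, WP_seq, WP_nset]
  refine ⟨fun hb => ?_, fun hb => ?_⟩
  · simp [BExp.Holds, RExp.eval, NExp.eval, hκ, hmid, hlast, hi, hj, h1] at hb
    obtain ⟨hb1, hb2⟩ := hb
    obtain ⟨d, hd⟩ : ∃ d, mid - i = d + 1 := ⟨mid - i - 1, by omega⟩
    have hd' : mid - (i + 1) = d := by omega
    refine ⟨by simp [NExp.cost, BExp.cost, RExp.cost], ?_, ?_, ?_, ?_, ?_⟩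
    · simpa using h1
    · simpa [NExp.eval, hi] using hb1
    · simpa [hj] using h3
    · simp [NExp.eval, hi, hj]; omega
    · have e := haux (f i)
      rw [hd, segment_succ] at h5
      refine Eq.trans ?_ h5
      have e' : ∀ g : ℕ → ℕ, (∀ q, g q = if q = o then f i else s.nat aAux q) →
          segment g 0 (o + 1) = segment (s.nat aAux) 0 o ++ [f i] := fun g hg => by
        rw [← e]; congr 1; funext q; exact hg q
      rw [e' _ fun q => by simp [NExp.eval, ho, hi, h1]]
      simp [NExp.eval, hi, hj, hd']
      by_cases hjs : j < last
      · obtain ⟨e, he⟩ : ∃ e, last - j = e + 1 := ⟨last - j - 1, by omega⟩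
        rw [he, segment_succ f j, List.cons_merge_cons, if_pos (by simpa [byKey] using hb2 hjs)]
      · rw [show last - j = 0 by omega]
        simp [segment_zero, List.merge_right]
  · simp [BExp.Holds, RExp.eval, NExp.eval, hκ, hmid, hlast, hi, hj, h1] at hb
    have hjs : j < last := by
      by_contra hjs
      exact hjs (hb (by omega)).1
    obtain ⟨e, he⟩ : ∃ e, last - j = e + 1 := ⟨last - j - 1, by omega⟩
    have he' : last - (j + 1) = e := by omega
    refine ⟨by simp [NExp.cost, BExp.cost, RExp.cost], ?_, ?_, ?_, ?_, ?_⟩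
    · simpa using h1
    · simpa [hi] using h2
    · simpa [NExp.eval, hj] using hjs
    · simp [NExp.eval, hi, hj]; omega
    · rw [he, segment_succ f j] at h5
      refine Eq.trans ?_ h5
      have e' : ∀ g : ℕ → ℕ, (∀ q, g q = if q = o then f j else s.nat aAux q) →
          segment g 0 (o + 1) = segment (s.nat aAux) 0 o ++ [f j] := fun g hg => by
        rw [← haux]; congr 1; funext q; exact hg q
      rw [e' _ fun q => by simp [NExp.eval, ho, hj, h1]]
      simp [NExp.eval, hi, hj, he']
      by_cases him : i < mid
      · obtain ⟨d, hd⟩ : ∃ d, mid - i = d + 1 := ⟨mid - i - 1, by omega⟩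
        have hlt := (hb him).2
        rw [hd, segment_succ f i, List.cons_merge_cons, if_neg (by simpa [byKey] using hlt)]
      · rw [show mid - i = 0 by omega]
        simp [segment_zero]

theorem WP_mergeCmd {y : Index n → ℝ} {ω : ℕ → Bool} {s : State n} {a b h : ℕ} {κ : ℕ → ℝ}
    (hκ : s.real a = κ) (hb : s.nat aBase 0 = b) (hh : s.nat aStep 0 = h) :
    WP y ω (mergeCmd a) s fun s' => s'.time ≤ s.time + (2 * h * 90 + 80) ∧
      segment (s'.nat aPerm) b (2 * h) = (segment (s.nat aPerm) b h).merge
        (segment (s.nat aPerm) (b + h) h) (byKey κ) ∧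
      ∀ p, p < b ∨ b + 2 * h ≤ p → s'.nat aPerm p = s.nat aPerm p := by
  set f := s.nat aPerm with hf
  set l := (segment f b h).merge (segment f (b + h) h) (byKey κ) with hl
  simp only [mergeCmd, WP_seq, WP_nset]
  refine WP_for (N := h + h) 60 (fun o => Merging κ f (b + h) (b + h + h) o l)
    (by simp [pickCmd, Cmd.nw])
    (fun _ _ _ h => ⟨h.1, h.2, h.3, h.4, h.5⟩) (fun _ _ _ h => ⟨h.1, h.2, h.3, h.4, h.5⟩) ?_ ?_ ?_ ?_
  · intro s' hF
    simp [NExp.eval, hF.nat aStep (by simp [pickCmd, Cmd.nw]), hh]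
  · refine ⟨?_, ?_, ?_, ?_, ?_⟩
    · simp [hf]
    · simp [NExp.eval, hb]
    · simp [NExp.eval, hb, hh]
    · simp [NExp.eval, hb, hh]; omega
    · simp [NExp.eval, hb, hh, segment_zero, hl]
  · intro o ho s₁ hF₁ ho₁ h₁
    refine (WP_pickCmd ?_ ?_ ?_ ho₁ (by omega) h₁).mono fun s' _ h => ⟨?_, h.2⟩
    · rw [hF₁.real a (by simp [pickCmd, Cmd.rw])]; simp [hκ]
    · rw [hF₁.nat aMid (by simp [pickCmd, Cmd.nw])]; simp [NExp.eval, hb, hh]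
    · rw [hF₁.nat aStop (by simp [pickCmd, Cmd.nw])]; simp [NExp.eval, hb, hh]
    · have := h.1
      simp [NExp.cost]
      omega
  intro s₁ hF₁ h₁ ht₁
  have hb₁ : s₁.nat aBase 0 = b := by rw [hF₁.nat aBase (by simp [pickCmd, Cmd.nw])]; simp [hb]
  have hh₁ : s₁.nat aStep 0 = h := by rw [hF₁.nat aStep (by simp [pickCmd, Cmd.nw])]; simp [hh]
  obtain ⟨k1, k2, k3, k4, k5⟩ := h₁
  -- After `2 * h` steps, `count` forces both blocks to be exhausted, so that `aAux` holds the
  -- entire merge.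
  rw [show b + h - s₁.nat aLeft 0 = 0 by omega, show b + h + h - s₁.nat aRight 0 = 0 by omega,
    segment_zero, segment_zero, List.nil_merge, List.append_nil] at k5
  refine WP_for (N := h + h) 30 (fun o s' => s'.nat aAux = s₁.nat aAux ∧
      ∀ p, s'.nat aPerm p = if b ≤ p ∧ p < b + o then s₁.nat aAux (p - b) else f p) (by decide)
    (fun _ _ _ h => h) (fun _ _ _ h => h) ?_ ?_ ?_ ?_
  · intro s' hF
    simp [NExp.eval, hF.nat aStep (by decide), hh₁]
  · refine ⟨rfl, fun p => ?_⟩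
    rw [if_neg (by omega), k1]
  · rintro o ho s₂ hF₂ ho₂ ⟨h21, h22⟩
    have hb₂ : s₂.nat aBase 0 = b := by rw [hF₂.nat aBase (by decide), hb₁]
    rw [WP_nset]
    refine ⟨by simp [NExp.cost], by simpa using h21, fun p => ?_⟩
    simp only [State.tick_nat, State.setNat_nat_apply, NExp.eval, hb₂, ho₂, h21, h22, true_and]
    by_cases hp : p = b + o
    · subst hp
      rw [if_pos rfl, if_pos (by omega)]
      simp
    · rw [if_neg hp]
      congr 1
      apply propext
      omega
  · rintro s₂ hF₂ ⟨-, h22⟩ ht₂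
    refine ⟨?_, ?_, fun p hp => ?_⟩
    · simp [NExp.cost] at ht₁ ht₂
      omega
    · rw [← k5, two_mul]
      refine segment_congr fun i hi => ?_
      rw [h22, if_pos (by omega), Nat.add_sub_cancel_left, Nat.zero_add]
    · rw [h22, if_neg (by omega)]

/-- Bottom-up merge sort. Both uses sort a power of two of positions, which is why the numbers of
repetitions and of buckets are rounded up to such powers: all blocks then have equal length. -/
theorem WP_sortCmd {y : Index n → ℝ} {ω : ℕ → Bool} {s : State n} {a e : ℕ} {κ : ℕ → ℝ}
    (hκ : s.real a = κ) (hlen : s.nat aSortLen 0 = 2 ^ e) :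
    WP y ω (sortCmd a) s fun s' =>
      s'.time ≤ s.time + (2 ^ e * 30 + e * (2 ^ e * 160 + 60) + 60) ∧
      SortedBy κ (segment (s'.nat aPerm) 0 (2 ^ e)) ∧
      (segment (s'.nat aPerm) 0 (2 ^ e)).Perm (List.range (2 ^ e)) := by
  simp only [sortCmd, WP_seq]
  refine WP_for (N := 2 ^ e) 30 (fun i s' => ∀ p < i, s'.nat aPerm p = p) (by decide)
    (fun _ _ _ h => h) (fun _ _ _ h => h) ?_ (by simp) ?_ ?_
  · intro s' hF
    simp [NExp.eval, hF.nat aSortLen (by decide), hlen]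
  · intro i hi s₁ hF₁ hi₁ h₁
    rw [WP_nset]
    refine ⟨by simp [NExp.cost], Nat.forall_lt_succ_right.2 ⟨fun p hp => ?_, ?_⟩⟩
    · simp [NExp.eval, hi₁, hp.ne, h₁ p hp]
    · simp [NExp.eval, hi₁]
  intro s₁ hF₁ h₁ ht₁
  have hlen₁ : s₁.nat aSortLen 0 = 2 ^ e := by rw [hF₁.nat aSortLen (by decide), hlen]
  have hκ₁ : s₁.real a = κ := by rw [hF₁.real a (by simp [Cmd.rw]), hκ]
  rw [WP_nset]
  refine WP_loop (N := e) (T := 2 ^ e * 160 + 60) (fun r s' => s'.nat aStep 0 = 2 ^ r ∧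
      (∀ b < 2 ^ (e - r), SortedBy κ (segment (s'.nat aPerm) (b * 2 ^ r) (2 ^ r))) ∧
      (segment (s'.nat aPerm) 0 (2 ^ e)).Perm (List.range (2 ^ e)))
    (fun _ _ _ h => h) ?_ ?_ ?_ ?_
  · refine ⟨by simp [NExp.eval], fun b _ => ?_, ?_⟩
    · simp [segment, SortedBy]
    · rw [List.range_eq_range', ← List.map_id (List.range' 0 (2 ^ e))]
      refine List.Perm.of_eq (segment_congr (g := id) fun i hi => ?_)
      simp [h₁ i hi]
  · rintro r hr s₂ hF₂ ⟨h21, h22, h23⟩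
    have hlen₂ : s₂.nat aSortLen 0 = 2 ^ e := by
      rw [hF₂.nat aSortLen (by simp [mergeCmd, pickCmd, Cmd.nw, Cmd.for])]; simp [hlen₁]
    have hκ₂ : s₂.real a = κ := by
      rw [hF₂.real a (by simp [mergeCmd, pickCmd, Cmd.rw, Cmd.for])]; simp [hκ₁]
    have hpow : 2 ^ (e - r - 1) * 2 ^ (r + 1) = 2 ^ e := by
      rw [← pow_add]; congr 1; omega
    have hpow' : 2 ^ (e - r) = 2 * 2 ^ (e - r - 1) := by
      rw [← pow_succ']; congr 1; omega
    refine ⟨?_, ?_⟩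
    · simpa [BExp.Holds, NExp.eval, h21, hlen₂] using Nat.pow_lt_pow_right (by norm_num) hr
    simp only [WP_seq, WP_nset]
    refine WP_loop (N := 2 ^ (e - r - 1)) (T := 2 ^ (r + 1) * 160)
      (fun b s' => s'.nat aBase 0 = b * 2 ^ (r + 1) ∧
        (∀ c < b, SortedBy κ (segment (s'.nat aPerm) (c * 2 ^ (r + 1)) (2 ^ (r + 1)))) ∧
        (∀ p, b * 2 ^ (r + 1) ≤ p → s'.nat aPerm p = s₂.nat aPerm p) ∧
        (segment (s'.nat aPerm) 0 (2 ^ e)).Perm (List.range (2 ^ e)))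
      (fun _ _ _ h => h) ?_ ?_ ?_ ?_
    · exact ⟨by simp [NExp.eval], by simp, by simp, by simpa using h23⟩
    · rintro b hb s₃ hF₃ ⟨h31, h32, h33, h34⟩
      have hlen₃ : s₃.nat aSortLen 0 = 2 ^ e := by
        rw [hF₃.nat aSortLen (by simp [mergeCmd, pickCmd, Cmd.nw, Cmd.for])]; simp [hlen₂]
      have hκ₃ : s₃.real a = κ := by
        rw [hF₃.real a (by simp [mergeCmd, pickCmd, Cmd.rw, Cmd.for])]; simp [hκ₂]
      have hs₃ : s₃.nat aStep 0 = 2 ^ r := by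
        rw [hF₃.nat aStep (by simp [mergeCmd, pickCmd, Cmd.nw, Cmd.for])]; simp [h21]
      have hle : b * 2 ^ (r + 1) + 2 ^ (r + 1) ≤ 2 ^ e := by
        rw [← hpow, ← Nat.succ_mul]
        exact Nat.mul_le_mul_right _ hb
      have hpos : 0 < 2 ^ (r + 1) := by positivity
      have hr1 : 2 ^ (r + 1) = 2 * 2 ^ r := by ring
      refine ⟨?_, ?_⟩
      · simp [BExp.Holds, NExp.eval, h31, hlen₃]
        omega
      simp only [WP_seq, WP_nset]
      refine (WP_mergeCmd hκ₃ h31 hs₃).mono fun s₄ hF₄ ⟨ht₄, hm₄, hp₄⟩ => ?_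
      have hb₄ : s₄.nat aBase 0 = b * 2 ^ (r + 1) := by
        rw [hF₄.nat aBase (by simp [mergeCmd, pickCmd, Cmd.nw, Cmd.for]), h31]
      have hs₄ : s₄.nat aStep 0 = 2 ^ r := by
        rw [hF₄.nat aStep (by simp [mergeCmd, pickCmd, Cmd.nw, Cmd.for]), hs₃]
      rw [← hr1] at hm₄ hp₄
      have hpos' : 0 < 2 ^ r := by positivity
      refine ⟨?_, ?_, ?_, ?_, ?_⟩
      · simp [NExp.cost, BExp.cost]
        omega
      · simp [NExp.eval, hb₄, hs₄]
        ring
      · have hold : ∀ c < 2 ^ (e - r), b * 2 ^ (r + 1) ≤ c * 2 ^ r →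
            SortedBy κ (segment (s₃.nat aPerm) (c * 2 ^ r) (2 ^ r)) := by
          intro c hc hbc
          rw [segment_congr (g := s₂.nat aPerm) (b := c * 2 ^ r) fun i _ => h33 _ (by omega)]
          exact h22 c hc
        simp only [State.tick_nat]
        refine Nat.forall_lt_succ_right.2 ⟨fun c hc => ?_, ?_⟩
        · have hc' : c * 2 ^ (r + 1) + 2 ^ (r + 1) ≤ b * 2 ^ (r + 1) := by
            rw [← Nat.succ_mul]
            exact Nat.mul_le_mul_right _ hc
          rw [segment_congr (g := s₃.nat aPerm) (b := c * 2 ^ (r + 1)) fun i hi => ?_]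
          · exact h32 c hc
          · simpa using hp₄ _ (by omega)
        · have e1 : b * 2 ^ (r + 1) = 2 * b * 2 ^ r := by ring
          have e2 : b * 2 ^ (r + 1) + 2 ^ r = (2 * b + 1) * 2 ^ r := by ring
          have := (hold (2 * b) (by omega) (by omega)).merge (hold (2 * b + 1) (by omega)
            (by rw [← e2]; omega))
          rw [← e1, ← e2, ← hm₄] at this
          simpa using this
      · intro p hp
        have e1 : (b + 1) * 2 ^ (r + 1) = b * 2 ^ (r + 1) + 2 ^ (r + 1) := by ring
        rw [e1] at hp
        simp [hp₄ p (by omega), h33 p (by omega)]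
      · refine List.Perm.trans ?_ h34
        simp only [State.tick_nat]
        have hmerge := List.merge_perm_append (byKey κ)
          (xs := segment (s₃.nat aPerm) (b * 2 ^ (r + 1)) (2 ^ r))
          (ys := segment (s₃.nat aPerm) (b * 2 ^ (r + 1) + 2 ^ r) (2 ^ r))
        rw [← hm₄, ← segment_add, ← two_mul, ← hr1] at hmerge
        -- The array consists of the part before the merged block, this block, and the rest; only
        -- the middle part has been permuted.
        obtain ⟨d, hd⟩ : ∃ d, 2 ^ e = b * 2 ^ (r + 1) + 2 ^ (r + 1) + d := ⟨_, (Nat.add_sub_of_le hle).symm⟩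
        rw [hd]
        simp only [segment_add, Nat.zero_add]
        refine (List.Perm.append (List.Perm.append (List.Perm.of_eq ?_) ?_) (List.Perm.of_eq ?_))
        · exact segment_congr fun i hi => by simpa using hp₄ _ (by omega)
        · simpa using hmerge
        · exact segment_congr fun i hi => by simpa using hp₄ _ (by omega)
    · rintro s₃ hF₃ ⟨h31, -⟩
      have hlen₃ : s₃.nat aSortLen 0 = 2 ^ e := by
        rw [hF₃.nat aSortLen (by simp [mergeCmd, pickCmd, Cmd.nw, Cmd.for])]; simp [hlen₂]
      simp [BExp.Holds, NExp.eval, h31, hlen₃, hpow]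
    · rintro s₃ hF₃ ⟨-, h32, -, h34⟩ ht₃
      have hs₃ : s₃.nat aStep 0 = 2 ^ r := by
        rw [hF₃.nat aStep (by simp [mergeCmd, pickCmd, Cmd.nw, Cmd.for])]; simp [h21]
      rw [← mul_assoc, hpow] at ht₃
      refine ⟨?_, ?_, ?_, ?_⟩
      · simp [NExp.cost, BExp.cost] at ht₃ ⊢
        omega
      · simp [NExp.eval, hs₃]
        ring
      · simpa [Nat.sub_sub] using h32
      · simpa using h34
  · rintro s' hF ⟨h1, -⟩
    have hlen' : s'.nat aSortLen 0 = 2 ^ e := by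
      rw [hF.nat aSortLen (by simp [mergeCmd, pickCmd, Cmd.nw, Cmd.for])]; simp [hlen₁]
    simp [BExp.Holds, NExp.eval, h1, hlen']
  · rintro s' hF ⟨-, h2, h3⟩ ht
    refine ⟨?_, by simpa using h2 0 (by positivity), h3⟩
    simp [NExp.cost, BExp.cost] at ht₁ ht
    omega

/-! ### Estimation of the coefficients -/

/-- The parity of the product of a row with an index. -/
def hashBit (M : ℕ → ℕ → ℕ) (i : Index n) (r : ℕ) : ℕ :=
  (∑ j ∈ Finset.range n, M r j * digit i j) % 2

/-- The number with the binary digits `hashBit M i r`. -/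
def hash (M : ℕ → ℕ → ℕ) (i : Index n) : ℕ → ℕ
  | 0 => 0
  | r + 1 => hash M i r + 2 ^ r * hashBit M i r

theorem hashBit_lt (M : ℕ → ℕ → ℕ) (i : Index n) (r : ℕ) : hashBit M i r < 2 :=
  Nat.mod_lt _ (by norm_num)

theorem hash_lt (M : ℕ → ℕ → ℕ) (i : Index n) (r : ℕ) : hash M i r < 2 ^ r := by
  induction r with
  | zero => simp [hash]
  | succ r ih =>
    have := Nat.mul_le_mul_left (2 ^ r) (Nat.le_of_lt_succ (hashBit_lt M i r))
    rw [hash, pow_succ]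
    omega

/-- Compute the hash value of an index. -/
def hashCmd : Cmd :=
  .put aHash (.lit 0) ;; .put aPow (.lit 1) ;;
  .for aRow (.var aM) (
    .put aPar (.lit 0) ;;
    .for aCol .dim (
      .ite (.conj (.nlt (.lit 0) (.get aBits (.add (.var aSrc) (.var aCol))))
          (.nlt (.lit 0) (.get aMat (.var aPtr))))
        (.put aPar (.sub (.lit 1) (.var aPar))) .skip ;;
      .succ aPtr) ;;
    .ite (.nlt (.lit 0) (.var aPar)) (.inc aHash (.var aPow)) .skip ;;
    .dbl aPow)

theorem WP_hashCmd {y : Index n → ℝ} {ω : ℕ → Bool} {s : State n} {m a b : ℕ} {M : ℕ → ℕ → ℕ}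
    {i : Index n} (hn : s.nat 0 1 = n) (hm : s.nat aM 0 = m) (hp : s.nat aPtr 0 = a)
    (hb : s.nat aSrc 0 = b) (hM : ∀ r < m, ∀ j < n, s.nat aMat (a + r * n + j) = M r j)
    (hM1 : ∀ r j, M r j < 2) (hi : ∀ j < n, s.nat aBits (b + j) = digit i j) :
    WP y ω hashCmd s fun s' => s'.time ≤ s.time + (m * (n * 50 + 60) + 30) ∧
      s'.nat aPtr 0 = a + m * n ∧ s'.nat aHash 0 = hash M i m := by
  simp only [hashCmd, WP_seq, WP_nset]
  refine WP_for (N := m) (n * 50 + 60) (fun r s' => s'.nat aPtr 0 = a + r * n ∧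
      s'.nat aHash 0 = hash M i r ∧ s'.nat aPow 0 = 2 ^ r) (by decide)
    (fun _ _ _ h => h) (fun _ _ _ h => h) ?_ ?_ ?_ ?_
  · intro s' hF
    simp [NExp.eval, hF.nat aM (by decide), hm]
  · simp [NExp.eval, hp, hash]
  · rintro r hr s₁ hF₁ - ⟨h11, h12, h13⟩
    have hn₁ : s₁.nat 0 1 = n := by rw [hF₁.nat 0 (by decide)]; simp [hn]
    have hb₁ : s₁.nat aSrc 0 = b := by rw [hF₁.nat aSrc (by decide)]; simp [hb]
    have hA₁ : s₁.nat aMat = s.nat aMat := by rw [hF₁.nat aMat (by decide)]; simp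
    have hi₁ : s₁.nat aBits = s.nat aBits := by rw [hF₁.nat aBits (by decide)]; simp
    simp only [WP_seq, WP_nset]
    refine WP_for (N := n) 50 (fun j s' => s'.nat aPtr 0 = a + r * n + j ∧
        s'.nat aPar 0 = (∑ l ∈ Finset.range j, M r l * digit i l) % 2) (by decide)
      (fun _ _ _ h => h) (fun _ _ _ h => h) ?_ ?_ ?_ ?_
    · intro s' hF
      simp [NExp.eval, hF.nat 0 (by decide), hn₁]
    · simp [NExp.eval, h11]
    · rintro j hj s₂ hF₂ hj₂ ⟨h21, h22⟩
      have hb₂ : s₂.nat aSrc 0 = b := by rw [hF₂.nat aSrc (by decide)]; simp [hb₁]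
      have hA₂ : s₂.nat aMat (a + r * n + j) = M r j := by
        rw [hF₂.nat aMat (by decide)]; simp [hA₁, hM r hr j hj]
      have hi₂ : s₂.nat aBits (b + j) = digit i j := by
        rw [hF₂.nat aBits (by decide)]; simp [hi₁, hi j hj]
      have hd := digit_lt i j
      have hM2 := hM1 r j
      simp only [WP_seq, WP_ite, WP_nset, WP_skip]
      refine ⟨fun hc => ?_, fun hc => ?_⟩
      · simp [BExp.Holds, NExp.eval, hb₂, hj₂, hi₂, h21, hA₂] at hc
        have e1 : M r j = 1 := by omega
        have e2 : digit i j = 1 := by omega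
        refine ⟨by simp [NExp.cost, BExp.cost], by simp [NExp.eval, h21]; ring, ?_⟩
        simp [NExp.eval, h22, Finset.sum_range_succ, e1, e2]
        omega
      · simp [BExp.Holds, NExp.eval, hb₂, hj₂, hi₂, h21, hA₂] at hc
        have e : M r j * digit i j = 0 := by
          rcases Nat.eq_zero_or_pos (digit i j) with h | h
          · rw [h, mul_zero]
          · rw [hc h, zero_mul]
        refine ⟨by simp [NExp.cost, BExp.cost], by simp [NExp.eval, h21]; ring, ?_⟩
        simp [NExp.eval, h22, Finset.sum_range_succ, e]
    · rintro s₂ hF₂ ⟨h21, h22⟩ ht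
      have h12₂ : s₂.nat aHash 0 = hash M i r := by
        rw [hF₂.nat aHash (by decide)]; simp [h12]
      have h13₂ : s₂.nat aPow 0 = 2 ^ r := by
        rw [hF₂.nat aPow (by decide)]; simp [h13]
      change s₂.nat aPar 0 = hashBit M i r at h22
      have hlt := hashBit_lt M i r
      simp only [WP_ite, WP_nset, WP_skip]
      refine ⟨fun hc => ?_, fun hc => ?_⟩
      · simp [BExp.Holds, NExp.eval, h22] at hc
        have e : hashBit M i r = 1 := by omega
        refine ⟨?_, ?_, ?_, ?_⟩
        · simp [NExp.cost, BExp.cost] at ht ⊢; omega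
        · simp [h21]; ring
        · simp [NExp.eval, h12₂, h13₂, hash, e]
        · simp [NExp.eval, h13₂]; ring
      · simp [BExp.Holds, NExp.eval, h22] at hc
        refine ⟨?_, ?_, ?_, ?_⟩
        · simp [NExp.cost, BExp.cost] at ht ⊢; omega
        · simp [h21]; ring
        · simp [h12₂, hash, hc]
        · simp [NExp.eval, h13₂]; ring
  · rintro s' hF ⟨h1, h2, -⟩ ht
    refine ⟨?_, h1, h2⟩
    simp [NExp.cost] at ht
    omega

/-- At least half of the first `R` values are at least `x`, and at least half are at most `x`. -/
def IsMedian (v : ℕ → ℝ) (R : ℕ) (x : ℝ) : Prop :=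
  R ≤ 2 * ((Finset.range R).filter fun ρ => x ≤ v ρ).card ∧
    R ≤ 2 * ((Finset.range R).filter fun ρ => v ρ ≤ x).card

theorem card_filter_range (R : ℕ) (p : ℕ → Prop) [DecidablePred p] :
    ((Finset.range R).filter p).card = (List.range R).countP p := by
  rw [List.countP_eq_length_filter]
  rfl

/-- The positions from `R / 2` on hold `R - R / 2` values that are at least the median, and the
positions up to `R / 2` hold `R / 2 + 1` values that are at most the median. Both numbers are at
least half of `R`. -/
theorem SortedBy.isMedian {κ : ℕ → ℝ} {f : ℕ → ℕ} {R : ℕ} (hR : 0 < R)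
    (h : SortedBy κ (segment f 0 R)) (hp : (segment f 0 R).Perm (List.range R)) :
    IsMedian κ R (κ (f (R / 2))) := by
  have hlt : R / 2 < R := Nat.div_lt_self hR (by norm_num)
  have hsplit := segment_add f 0 (R / 2) (R - R / 2)
  rw [Nat.add_sub_of_le hlt.le] at hsplit
  obtain ⟨d, hd⟩ : ∃ d, R - R / 2 = d + 1 := ⟨R - R / 2 - 1, by omega⟩
  rw [hd, segment_succ, Nat.zero_add] at hsplit
  rw [hsplit] at h
  obtain ⟨-, h2, h3⟩ := List.pairwise_append.1 h
  have hl : ∀ a l, (segment f a l).length = l := fun a l => by simp [segment]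
  constructor
  · rw [card_filter_range, ← hp.countP_eq, hsplit, List.countP_append]
    have : (f (R / 2) :: segment f (R / 2 + 1) d).countP
        (fun ρ => decide (κ (f (R / 2)) ≤ κ ρ)) = d + 1 := by
      rw [List.countP_eq_length.2, List.length_cons, hl]
      intro q hq
      rcases List.mem_cons.1 hq with rfl | hq
      · simp
      · simpa using List.rel_of_pairwise_cons h2 hq
    omega
  · rw [card_filter_range, ← hp.countP_eq, hsplit, List.countP_append]
    have h4 : (segment f 0 (R / 2)).countP (fun ρ => decide (κ ρ ≤ κ (f (R / 2)))) = R / 2 := by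
      rw [List.countP_eq_length.2, hl]
      intro q hq
      simpa using h3 q hq _ List.mem_cons_self
    have h5 : 1 ≤ (f (R / 2) :: segment f (R / 2 + 1) d).countP
        (fun ρ => decide (κ ρ ≤ κ (f (R / 2)))) := by
      rw [List.countP_cons_of_pos (by simp)]
      omega
    omega

/-- Estimate a coefficient by the median of its estimates. -/
def estimateCmd : Cmd :=
  .put aPtr (.var aMatBase) ;; .put aDst (.var aFirst) ;;
  .for aRep (.var aR) (
    hashCmd ;; .rset rEst (.var aRep) (.get rData (.add (.var aDst) (.var aHash))) ;;
    .inc aDst (.var aStride)) ;;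
  .put aSortLen (.var aR) ;; sortCmd rEst ;;
  .rset rMed (.var aItem) (.get rEst (.get aPerm (.var aHalf))) ;;
  .rset rMag (.var aItem) (.sqrt (.mul (.get rMed (.var aItem)) (.get rMed (.var aItem))))

theorem WP_estimateCmd {y : Index n → ℝ} {ω : ℕ → Bool} {s : State n} {m e a b d st p : ℕ}
    {M : ℕ → ℕ → ℕ → ℕ} {i : Index n} (hn : s.nat 0 1 = n) (hm : s.nat aM 0 = m)
    (hR : s.nat aR 0 = 2 ^ e) (hH : s.nat aHalf 0 = 2 ^ e / 2) (ha : s.nat aMatBase 0 = a)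
    (hd : s.nat aFirst 0 = d) (hst : s.nat aStride 0 = st) (hp : s.nat aItem 0 = p)
    (hb : s.nat aSrc 0 = b)
    (hM : ∀ ρ < 2 ^ e, ∀ r < m, ∀ j < n, s.nat aMat (a + ρ * (m * n) + r * n + j) = M ρ r j)
    (hM1 : ∀ ρ r j, M ρ r j < 2) (hi : ∀ j < n, s.nat aBits (b + j) = digit i j) :
    WP y ω estimateCmd s fun s' =>
      s'.time ≤ s.time + (2 ^ e * (m * (n * 50 + 60) + 140) + e * (2 ^ e * 160 + 60) + 200) ∧
      (∀ q, q ≠ p → s'.real rMed q = s.real rMed q ∧ s'.real rMag q = s.real rMag q) ∧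
      s'.real rMag p = |s'.real rMed p| ∧
      IsMedian (fun ρ => s.real rData (d + ρ * st + hash (M ρ) i m)) (2 ^ e) (s'.real rMed p) := by
  simp only [estimateCmd, WP_seq, WP_nset]
  refine WP_for (N := 2 ^ e) (m * (n * 50 + 60) + 80) (fun ρ s' =>
      s'.nat aPtr 0 = a + ρ * (m * n) ∧ s'.nat aDst 0 = d + ρ * st ∧
      ∀ q < ρ, s'.real rEst q = s.real rData (d + q * st + hash (M q) i m)) (by decide)
    (fun _ _ _ h => h) (fun _ _ _ h => h) ?_ ?_ ?_ ?_
  · intro s' hF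
    simp [NExp.eval, hF.nat aR (by decide), hR]
  · simp [NExp.eval, ha, hd]
  · rintro ρ hρ s₁ hF₁ hρ₁ ⟨h11, h12, h13⟩
    have hn₁ : s₁.nat 0 1 = n := by rw [hF₁.nat 0 (by decide)]; simp [hn]
    have hm₁ : s₁.nat aM 0 = m := by rw [hF₁.nat aM (by decide)]; simp [hm]
    have hb₁ : s₁.nat aSrc 0 = b := by rw [hF₁.nat aSrc (by decide)]; simp [hb]
    have hst₁ : s₁.nat aStride 0 = st := by rw [hF₁.nat aStride (by decide)]; simp [hst]
    have hA₁ : s₁.nat aMat = s.nat aMat := by rw [hF₁.nat aMat (by decide)]; simp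
    have hi₁ : s₁.nat aBits = s.nat aBits := by rw [hF₁.nat aBits (by decide)]; simp
    have hY₁ : s₁.real rData = s.real rData := by rw [hF₁.real rData (by decide)]; simp
    rw [WP_seq]
    refine (WP_hashCmd (i := i) hn₁ hm₁ h11 hb₁ (by rw [hA₁]; exact hM ρ hρ) (hM1 ρ)
      (by rw [hi₁]; exact hi)).mono fun s₂ hF₂ ⟨ht₂, hp₂, hh₂⟩ => ?_
    have hd₂ : s₂.nat aDst 0 = d + ρ * st := by rw [hF₂.nat aDst (by decide), h12]
    have hst₂ : s₂.nat aStride 0 = st := by rw [hF₂.nat aStride (by decide), hst₁]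
    have hρ₂ : s₂.nat aRep 0 = ρ := by rw [hF₂.nat aRep (by decide), hρ₁]
    have hY₂ : s₂.real rData = s.real rData := by rw [hF₂.real rData (by decide), hY₁]
    have hE₂ : s₂.real rEst = s₁.real rEst := hF₂.real rEst (by decide)
    simp only [WP_seq, WP_nset, WP_rset]
    refine ⟨?_, ?_, ?_, Nat.forall_lt_succ_right.2 ⟨fun q hq => ?_, ?_⟩⟩
    · simp [NExp.cost, RExp.cost]
      omega
    · simp [hp₂]; ring
    · simp [NExp.eval, hd₂, hst₂]; ring
    · simp [NExp.eval, hρ₂, hq.ne, hE₂, h13 q hq]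
    · simp [NExp.eval, RExp.eval, hρ₂, hd₂, hh₂, hY₂]
  rintro s₁ hF₁ ⟨-, -, h₁⟩ ht₁
  have hR₁ : s₁.nat aR 0 = 2 ^ e := by rw [hF₁.nat aR (by decide)]; simp [hR]
  have hH₁ : s₁.nat aHalf 0 = 2 ^ e / 2 := by rw [hF₁.nat aHalf (by decide)]; simp [hH]
  have hp₁ : s₁.nat aItem 0 = p := by rw [hF₁.nat aItem (by decide)]; simp [hp]
  have hMed₁ : s₁.real rMed = s.real rMed := by rw [hF₁.real rMed (by decide)]; simp
  have hMag₁ : s₁.real rMag = s.real rMag := by rw [hF₁.real rMag (by decide)]; simp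
  refine (WP_sortCmd (a := rEst) (e := e) rfl (by simp [NExp.eval, hR₁])).mono
    fun s₂ hF₂ ⟨ht₂, hsort, hperm⟩ => ?_
  have hH₂ : s₂.nat aHalf 0 = 2 ^ e / 2 := by rw [hF₂.nat aHalf (by decide)]; simp [hH₁]
  have hp₂ : s₂.nat aItem 0 = p := by rw [hF₂.nat aItem (by decide)]; simp [hp₁]
  have hMed₂ : s₂.real rMed = s.real rMed := by rw [hF₂.real rMed (by decide)]; simp [hMed₁]
  have hMag₂ : s₂.real rMag = s.real rMag := by rw [hF₂.real rMag (by decide)]; simp [hMag₁]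
  have hE₂ : s₂.real rEst = s₁.real rEst := by rw [hF₂.real rEst (by decide)]; simp
  have hmed := hsort.isMedian (by positivity) hperm
  simp only [State.tick_real, State.setNat_real] at hmed
  simp only [WP_rset]
  refine ⟨?_, fun q hq => ⟨?_, ?_⟩, ?_, ?_⟩
  · simp [NExp.cost, RExp.cost] at ht₁ ht₂ ⊢
    have : 2 ^ e * (m * (n * 50 + 60) + 80) + 2 ^ e * 30 + 2 ^ e * 30 =
      2 ^ e * (m * (n * 50 + 60) + 140) := by ring
    omega
  · simp [NExp.eval, hp₂, hq, hMed₂]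
  · simp [NExp.eval, hp₂, hq, hMag₂]
  · simp [NExp.eval, RExp.eval, hp₂, Real.sqrt_mul_self_eq_abs]
  · have hval : ∀ ρ < 2 ^ e, s₁.real rEst ρ = s.real rData (d + ρ * st + hash (M ρ) i m) := h₁
    have hfin : ∀ P : ℝ → Prop, [DecidablePred P] →
        (Finset.range (2 ^ e)).filter (fun ρ => P (s₁.real rEst ρ)) =
        (Finset.range (2 ^ e)).filter
          (fun ρ => P (s.real rData (d + ρ * st + hash (M ρ) i m))) := by
      intro P _
      refine Finset.filter_congr fun ρ hρ => ?_
      rw [hval ρ (Finset.mem_range.1 hρ)]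
    rw [IsMedian, hfin (fun x => s₁.real rEst (s₂.nat aPerm (2 ^ e / 2)) ≤ x),
      hfin (fun x => x ≤ s₁.real rEst (s₂.nat aPerm (2 ^ e / 2)))] at hmed
    simpa [IsMedian, NExp.eval, RExp.eval, hp₂, hH₂, hE₂] using hmed

/-- Estimate the coefficients with listed indices. -/
def estimateAllCmd : Cmd :=
  .put aFirst (.var aBase) ;; .put aMatBase (.lit 0) ;;
  .for aRep (.var aR) (.for aRow (.var aM) (.inc aMatBase .dim)) ;;
  .put aSrc (.lit 0) ;;
  .for aItem (.var aLen) (estimateCmd ;; .inc aSrc .dim)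

/-- The numbers that are stored for the listed indices are medians of `Y`. -/
structure Estimated (Y : Index n → ℕ → ℝ) (R : ℕ) (l : List (Index n)) (P : ℕ) (s : State n) :
    Prop where
  rest : ∀ p, P ≤ p → s.real rMed p = 0
  mag : ∀ p, s.real rMag p = |s.real rMed p|
  median : ∀ (p : ℕ) (h : p < l.length), p < P → IsMedian (Y l[p]) R (s.real rMed p)

/-- The matrices and data for estimation lie behind those for identification. The machine cannot
multiply natural numbers, so the offset `2 ^ e * m * n` of the matrices is added up row by row. -/
theorem WP_estimateAllCmd {y : Index n → ℝ} {ω : ℕ → Bool} {s : State n} {m e d st : ℕ}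
    {M : ℕ → ℕ → ℕ → ℕ} {l : List (Index n)} (hn : s.nat 0 1 = n) (hm : s.nat aM 0 = m)
    (hR : s.nat aR 0 = 2 ^ e) (hH : s.nat aHalf 0 = 2 ^ e / 2) (hd : s.nat aBase 0 = d)
    (hst : s.nat aStride 0 = st)
    (hM : ∀ ρ < 2 ^ e, ∀ r < m, ∀ j < n,
      s.nat aMat (((2 ^ e + ρ) * m + r) * n + j) = M ρ r j)
    (hM1 : ∀ ρ r j, M ρ r j < 2) (hl : Stored l s) (hMed : s.real rMed = 0)
    (hMag : s.real rMag = 0) :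
    WP y ω estimateAllCmd s fun s' =>
      s'.time ≤ s.time + (2 ^ e * (m * 30 + 40) + l.length *
        (2 ^ e * (m * (n * 50 + 60) + 140) + e * (2 ^ e * 160 + 60) + 240) + 60) ∧
      Estimated (fun i ρ => s.real rData (d + ρ * st + hash (M ρ) i m)) (2 ^ e) l l.length s' := by
  simp only [estimateAllCmd, WP_seq, WP_nset]
  refine WP_for (N := 2 ^ e) (m * 30 + 40) (fun ρ s' => s'.nat aMatBase 0 = ρ * (m * n))
    (by decide) (fun _ _ _ h => h) (fun _ _ _ h => h) ?_ (by simp [NExp.eval]) ?_ ?_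
  · intro s' hF
    simp [NExp.eval, hF.nat aR (by decide), hR]
  · intro ρ hρ s₁ hF₁ _ h₁
    have hn₁ : s₁.nat 0 1 = n := by rw [hF₁.nat 0 (by decide)]; simp [hn]
    have hm₁ : s₁.nat aM 0 = m := by rw [hF₁.nat aM (by decide)]; simp [hm]
    refine WP_for (N := m) 30 (fun r s' => s'.nat aMatBase 0 = ρ * (m * n) + r * n)
      (by decide) (fun _ _ _ h => h) (fun _ _ _ h => h) ?_ (by simp [h₁]) ?_ ?_
    · intro s' hF
      simp [NExp.eval, hF.nat aM (by decide), hm₁]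
    · intro r hr s₂ hF₂ _ h₂
      have hn₂ : s₂.nat 0 1 = n := by rw [hF₂.nat 0 (by decide), hn₁]
      rw [WP_nset]
      refine ⟨by simp [NExp.cost], ?_⟩
      simp [NExp.eval, h₂, hn₂]
      ring
    · intro s₂ hF₂ h₂ ht₂
      refine ⟨?_, by rw [h₂]; ring⟩
      simp [NExp.cost] at ht₂ ⊢
      omega
  intro s₁ hF₁ h₁ ht₁
  have hn₁ : s₁.nat 0 1 = n := by rw [hF₁.nat 0 (by decide)]; simp [hn]
  have hm₁ : s₁.nat aM 0 = m := by rw [hF₁.nat aM (by decide)]; simp [hm]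
  have hR₁ : s₁.nat aR 0 = 2 ^ e := by rw [hF₁.nat aR (by decide)]; simp [hR]
  have hH₁ : s₁.nat aHalf 0 = 2 ^ e / 2 := by rw [hF₁.nat aHalf (by decide)]; simp [hH]
  have hd₁ : s₁.nat aFirst 0 = d := by rw [hF₁.nat aFirst (by decide)]; simp [NExp.eval, hd]
  have hst₁ : s₁.nat aStride 0 = st := by rw [hF₁.nat aStride (by decide)]; simp [hst]
  have hA₁ : s₁.nat aMat = s.nat aMat := by rw [hF₁.nat aMat (by decide)]; simp
  have hB₁ : s₁.nat aBits = s.nat aBits := by rw [hF₁.nat aBits (by decide)]; simp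
  have hL₁ : s₁.nat aLen 0 = l.length := by rw [hF₁.nat aLen (by decide)]; simp [hl.len]
  have hY₁ : s₁.real rData = s.real rData := by rw [hF₁.real rData (by decide)]; simp
  have hMed₁ : s₁.real rMed = 0 := by rw [hF₁.real rMed (by decide)]; simp [hMed]
  have hMag₁ : s₁.real rMag = 0 := by rw [hF₁.real rMag (by decide)]; simp [hMag]
  refine WP_for (N := l.length)
    (2 ^ e * (m * (n * 50 + 60) + 140) + e * (2 ^ e * 160 + 60) + 240)
    (fun p s' => s'.nat aSrc 0 = p * n ∧
      Estimated (fun i ρ => s.real rData (d + ρ * st + hash (M ρ) i m)) (2 ^ e) l p s')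
    (by decide) (fun _ _ _ h => ⟨h.1, h.2.1, h.2.2, h.2.3⟩)
    (fun _ _ _ h => ⟨h.1, h.2.1, h.2.2, h.2.3⟩) ?_ ?_ ?_ ?_
  · intro s' hF
    simp [NExp.eval, hF.nat aLen (by decide), hL₁]
  · refine ⟨by simp [NExp.eval], fun p _ => ?_, fun p => ?_, fun p _ hp => absurd hp (by omega)⟩
    · simp [hMed₁]
    · simp [hMed₁, hMag₁]
  · rintro p hp s₂ hF₂ hp₂ ⟨hs₂, h₂⟩
    have hn₂ : s₂.nat 0 1 = n := by rw [hF₂.nat 0 (by decide)]; simp [hn₁]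
    have hm₂ : s₂.nat aM 0 = m := by rw [hF₂.nat aM (by decide)]; simp [hm₁]
    have hR₂ : s₂.nat aR 0 = 2 ^ e := by rw [hF₂.nat aR (by decide)]; simp [hR₁]
    have hH₂ : s₂.nat aHalf 0 = 2 ^ e / 2 := by rw [hF₂.nat aHalf (by decide)]; simp [hH₁]
    have hd₂ : s₂.nat aFirst 0 = d := by rw [hF₂.nat aFirst (by decide)]; simp [hd₁]
    have hst₂ : s₂.nat aStride 0 = st := by rw [hF₂.nat aStride (by decide)]; simp [hst₁]
    have ha₂ : s₂.nat aMatBase 0 = 2 ^ e * (m * n) := by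
      rw [hF₂.nat aMatBase (by decide)]; simp [h₁]
    have hA₂ : s₂.nat aMat = s.nat aMat := by rw [hF₂.nat aMat (by decide)]; simp [hA₁]
    have hB₂ : s₂.nat aBits = s.nat aBits := by rw [hF₂.nat aBits (by decide)]; simp [hB₁]
    have hY₂ : s₂.real rData = s.real rData := by rw [hF₂.real rData (by decide)]; simp [hY₁]
    have hM₂ : ∀ ρ < 2 ^ e, ∀ r < m, ∀ j < n,
        s₂.nat aMat (2 ^ e * (m * n) + ρ * (m * n) + r * n + j) = M ρ r j := by
      intro ρ hρ r hr j hj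
      rw [hA₂, ← hM ρ hρ r hr j hj]
      congr 1
      ring
    rw [WP_seq]
    refine (WP_estimateCmd hn₂ hm₂ hR₂ hH₂ ha₂ hd₂ hst₂ hp₂ hs₂ hM₂ hM1
      (i := l[p]) (by rw [hB₂]; exact hl.bits p hp)).mono fun s₃ hF₃ ⟨ht₃, hq₃, hm₃, hi₃⟩ => ?_
    have hs₃ : s₃.nat aSrc 0 = p * n := by rw [hF₃.nat aSrc (by decide), hs₂]
    have hn₃ : s₃.nat 0 1 = n := by rw [hF₃.nat 0 (by decide), hn₂]
    rw [WP_nset]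
    refine ⟨?_, ?_, fun q hq => ?_, fun q => ?_, fun q hq hqp => ?_⟩
    · simp [NExp.cost]
      omega
    · simp [NExp.eval, hs₃, hn₃]; ring
    · simpa [(hq₃ q (by omega)).1] using h₂.rest q (by omega)
    · simp only [State.tick_real, State.setNat_real]
      by_cases h : q = p
      · rw [h, hm₃]
      · rw [(hq₃ q h).1, (hq₃ q h).2, h₂.mag]
    · simp only [State.tick_real, State.setNat_real]
      by_cases h : q = p
      · subst h
        simpa [hY₂] using hi₃
      · rw [(hq₃ q h).1]
        exact h₂.median q hq (by omega)
  · rintro s' hF ⟨-, h⟩ ht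
    refine ⟨?_, h⟩
    simp [NExp.cost] at ht ht₁
    omega

/-! ### The output -/

/-- Output the `k` largest medians. -/
def outputCmd : Cmd :=
  .put aSortLen (.add (.var aB) (.var aB)) ;; sortCmd rMag ;;
  .put aPtr (.var aSortLen) ;; .put aDst (.lit 0) ;;
  .for aItem .sparsity (
    .put aPtr (.sub (.var aPtr) (.lit 1)) ;;
    .put aSrc (.get aAddr (.get aPerm (.var aPtr))) ;;
    .for aCol .dim (.nset 2 (.var aDst) (.get aBits (.add (.var aSrc) (.var aCol))) ;;
      .succ aDst) ;;
    .rset 1 (.var aItem) (.get rMed (.get aPerm (.var aPtr)))) ;;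
  .put 1 .sparsity

/-- The values `sel 0, …, sel (k - 1)` are distinct positions below `N` with the largest entries. -/
structure IsTop (κ : ℕ → ℝ) (N k : ℕ) (sel : ℕ → ℕ) : Prop where
  lt : ∀ q < k, sel q < N
  inj : ∀ q < k, ∀ q' < k, sel q = sel q' → q = q'
  le : ∀ q < k, ∀ p < N, (∀ q' < k, sel q' ≠ p) → κ p ≤ κ (sel q)

theorem SortedBy.isTop {κ : ℕ → ℝ} {f : ℕ → ℕ} {N k : ℕ} (hk : k ≤ N)
    (h : SortedBy κ (segment f 0 N)) (hp : (segment f 0 N).Perm (List.range N)) :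
    IsTop κ N k fun q => f (N - 1 - q) := by
  have hl : (segment f 0 N).length = N := by simp [segment]
  have hg : ∀ t (ht : t < (segment f 0 N).length), (segment f 0 N)[t] = f t := fun t ht => by
    simp [segment]
  have hnd : (segment f 0 N).Nodup := hp.nodup_iff.2 List.nodup_range
  refine ⟨fun q hq => ?_, fun q hq q' hq' he => ?_, fun q hq p hpN hpq => ?_⟩
  · rw [← List.mem_range, ← hp.mem_iff, ← hg (N - 1 - q) (by omega)]
    exact List.getElem_mem _
  · have := (hnd.getElem_inj_iff (hi := by omega) (hj := by omega) (i := N - 1 - q)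
      (j := N - 1 - q')).1 (by rw [hg, hg]; exact he)
    omega
  · have hmem : p ∈ segment f 0 N := by rw [hp.mem_iff]; exact List.mem_range.2 hpN
    obtain ⟨t, ht, rfl⟩ := List.getElem_of_mem hmem
    rw [hg] at hpq ⊢
    have htk : t < N - k := by
      by_contra hlt
      exact hpq (N - 1 - t) (by omega) (congrArg f (by omega))
    have := List.pairwise_iff_getElem.1 h t (N - 1 - q) ht (by omega) (by omega)
    rwa [hg, hg] at this

/-- The vector that is given by the `k` largest medians. -/
def selected (l : List (Index n)) (med : ℕ → ℝ) (sel : ℕ → ℕ) (k : ℕ) : Index n → ℝ := fun i =>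
  ∑ q ∈ Finset.range k, if l[sel q]? = some i then med (sel q) else 0

/-- Sorting all `2 ^ (m + 1)` positions, listed or not, makes the length a power of two and
guarantees that there are `k` positions to choose from. Positions behind the list hold the median
`0`. -/
theorem WP_outputCmd {y : Index n → ℝ} {ω : ℕ → Bool} {s : State n} {m k R : ℕ}
    {l : List (Index n)} {Y : Index n → ℕ → ℝ} (hn : s.nat 0 1 = n) (hk : s.nat 0 0 = k)
    (hkm : k ≤ 2 ^ m) (hB : s.nat aB 0 = 2 ^ m) (hl : Stored l s)
    (hY : Estimated Y R l l.length s) :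
    WP y ω outputCmd s fun s' =>
      s'.time ≤ s.time + (2 ^ (m + 1) * 30 + (m + 1) * (2 ^ (m + 1) * 160 + 60) +
        k * (n * 30 + 100) + 140) ∧
      s'.nat 1 0 = k ∧
      ∃ sel, IsTop (fun p => |s.real rMed p|) (2 ^ (m + 1)) k sel ∧
        s'.output = selected l (s.real rMed) sel k := by
  have hk' : k ≤ 2 ^ (m + 1) := by rw [pow_succ]; omega
  simp only [outputCmd, WP_seq, WP_nset]
  have hmag : s.real rMag = fun p => |s.real rMed p| := funext hY.mag
  refine (WP_sortCmd (e := m + 1) (κ := fun p => |s.real rMed p|) (by simpa using hmag)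
    (by simp [NExp.eval, hB]; ring)).mono fun s₁ hF₁ ⟨ht₁, hsort, hperm⟩ => ?_
  have hn₁ : s₁.nat 0 1 = n := by rw [hF₁.nat 0 (by decide)]; simp [hn]
  have hk₁ : s₁.nat 0 0 = k := by rw [hF₁.nat 0 (by decide)]; simp [hk]
  have hlen₁ : s₁.nat aSortLen 0 = 2 ^ (m + 1) := by
    rw [hF₁.nat aSortLen (by decide)]; simp [NExp.eval, hB]; ring
  have hA₁ : s₁.nat aAddr = s.nat aAddr := by rw [hF₁.nat aAddr (by decide)]; simp
  have hB₁ : s₁.nat aBits = s.nat aBits := by rw [hF₁.nat aBits (by decide)]; simp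
  have hM₁ : s₁.real rMed = s.real rMed := by rw [hF₁.real rMed (by decide)]; simp
  set f := s₁.nat aPerm with hf
  set sel : ℕ → ℕ := fun q => f (2 ^ (m + 1) - 1 - q) with hsel
  have htop : IsTop (fun p => |s.real rMed p|) (2 ^ (m + 1)) k sel := hsort.isTop hk' hperm
  refine WP_for (N := k) (n * 30 + 100) (fun q s' => s'.nat aPtr 0 = 2 ^ (m + 1) - q ∧
      s'.nat aDst 0 = q * n ∧
      (∀ p < q * n, s'.nat 2 p = s.nat aBits (s.nat aAddr (sel (p / n)) + p % n)) ∧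
      ∀ p < q, s'.real 1 p = s.real rMed (sel p)) (by decide)
    (fun _ _ _ h => h) (fun _ _ _ h => h) ?_ ?_ ?_ ?_
  · intro s' hF
    simp [NExp.eval, hF.nat 0 (by decide), hk₁]
  · simp [NExp.eval, hlen₁]
  · rintro q hq s₂ hF₂ hq₂ ⟨h21, h22, h23, h24⟩
    have hn₂ : s₂.nat 0 1 = n := by rw [hF₂.nat 0 (by decide)]; simp [hn₁]
    have hA₂ : s₂.nat aAddr = s.nat aAddr := by rw [hF₂.nat aAddr (by decide)]; simp [hA₁]
    have hB₂ : s₂.nat aBits = s.nat aBits := by rw [hF₂.nat aBits (by decide)]; simp [hB₁]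
    have hf₂ : s₂.nat aPerm = f := by rw [hF₂.nat aPerm (by decide)]; simp [hf]
    have hM₂ : s₂.real rMed = s.real rMed := by rw [hF₂.real rMed (by decide)]; simp [hM₁]
    have e1 : 2 ^ (m + 1) - q - 1 = 2 ^ (m + 1) - 1 - q := by omega
    simp only [WP_seq, WP_nset]
    refine WP_for (N := n) 30 (fun j s' => s'.nat aDst 0 = q * n + j ∧
      ∀ p < q * n + j, s'.nat 2 p = s.nat aBits (s.nat aAddr (sel (p / n)) + p % n)) (by decide)
      (fun _ _ _ h => h) (fun _ _ _ h => h) ?_ ?_ ?_ ?_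
    · intro s' hF
      simp [NExp.eval, hF.nat 0 (by decide), hn₂]
    · simpa [h22] using h23
    · rintro j hj s₃ hF₃ hj₃ ⟨h31, h32⟩
      have hs₃ : s₃.nat aSrc 0 = s.nat aAddr (sel q) := by
        rw [hF₃.nat aSrc (by decide)]
        simp [NExp.eval, hA₂, hf₂, h21, e1, hsel]
      have hB₃ : s₃.nat aBits = s.nat aBits := by rw [hF₃.nat aBits (by decide)]; simp [hB₂]
      have e2 : (q * n + j) / n = q ∧ (q * n + j) % n = j := by
        rw [Nat.mul_comm, Nat.mul_add_div (by omega), Nat.div_eq_of_lt hj, Nat.mul_add_mod,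
          Nat.mod_eq_of_lt hj]
        simp
      simp only [WP_seq, WP_nset]
      refine ⟨by simp [NExp.cost], by simp [NExp.eval, h31]; ring, fun p hp => ?_⟩
      rcases (Nat.lt_succ_iff_lt_or_eq (n := q * n + j)).1 hp with hp | rfl
      · simp [NExp.eval, h31, hp.ne, h32 p hp]
      · simp only [e2]
        simp [NExp.eval, h31, hs₃, hj₃, hB₃]
    · rintro s₃ hF₃ ⟨h31, h32⟩ ht₃
      have hp₃ : s₃.nat aPtr 0 = 2 ^ (m + 1) - 1 - q := by
        rw [hF₃.nat aPtr (by decide)]; simp [NExp.eval, h21, e1]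
      have hf₃ : s₃.nat aPerm = f := by rw [hF₃.nat aPerm (by decide)]; simp [hf₂]
      have hM₃ : s₃.real rMed = s.real rMed := by rw [hF₃.real rMed (by decide)]; simp [hM₂]
      have hq₃ : s₃.nat aItem 0 = q := by rw [hF₃.nat aItem (by decide)]; simp [hq₂]
      have hr₃ : s₃.real 1 = s₂.real 1 := by rw [hF₃.real 1 (by decide)]; simp
      have e3 : q * n + n = (q + 1) * n := by ring
      rw [e3] at h31 h32
      rw [WP_rset]
      refine ⟨?_, ?_, by simpa using h31, by simpa using h32,
        Nat.forall_lt_succ_right.2 ⟨fun p hp => ?_, ?_⟩⟩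
      · simp [NExp.cost, RExp.cost] at ht₃ ⊢
        omega
      · simp [hp₃]; omega
      · simp [NExp.eval, hq₃, hp.ne, hr₃, h24 p hp]
      · simp [NExp.eval, RExp.eval, hq₃, hf₃, hp₃, hM₃, hsel]
  · rintro s₂ hF₂ ⟨-, -, h23, h24⟩ ht₂
    have hk₂ : s₂.nat 0 0 = k := by rw [hF₂.nat 0 (by decide)]; simp [hk₁]
    refine ⟨?_, by simp [NExp.eval, hk₂], sel, htop, ?_⟩
    · simp [NExp.cost] at ht₁ ht₂ ⊢
      omega
    · funext i
      simp only [State.output, selected]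
      refine Finset.sum_congr (by simp [NExp.eval, hk₂]) fun q hq => ?_
      have hq' : q < k := by
        rw [Finset.mem_range] at hq
        simpa [NExp.eval, hk₂] using hq
      simp only [State.tick_real, State.setNat_real, h24 q hq']
      by_cases hlt : sel q < l.length
      · congr 1
        rw [List.getElem?_eq_getElem hlt, Option.some_inj]
        congr 1
        funext j
        have hj := j.2
        have e2 : (q * n + (j : ℕ)) / n = q ∧ (q * n + (j : ℕ)) % n = j := by
          rw [Nat.mul_comm, Nat.mul_add_div (by omega), Nat.div_eq_of_lt hj, Nat.mul_add_mod,
            Nat.mod_eq_of_lt hj]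
          simp
        have hlt' : q * n + (j : ℕ) < k * n := by
          have := Nat.mul_le_mul_right n (show q + 1 ≤ k from hq')
          rw [Nat.add_mul] at this
          omega
        have := h23 _ hlt'
        rw [e2.1, e2.2, hl.addr _ hlt, hl.bits _ hlt _ hj] at this
        simp [State.bits, this, digit, hj]
      -- A position behind the list contributes the value `0`, so it does not matter which index is
      -- written next to it.
      · rw [hY.rest _ (by omega)]
        simp

/-! ### The data are sums over buckets -/

/-- The character `i ↦ (-1) ^ ⟨u, i⟩`. -/
def chi (u i : Index n) : ℝ := (-1) ^ (u ⬝ᵥ i).val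

theorem chi_add (u v i : Index n) : chi (u + v) i = chi u i * chi v i := by
  have key : ∀ a b : ZMod 2, (-1 : ℝ) ^ (a + b).val = (-1) ^ a.val * (-1) ^ b.val := by
    intro a b
    rw [ZMod.val_add, ← pow_add, neg_one_pow_eq_pow_mod_two (n := a.val + b.val)]
  rw [chi, add_dotProduct, key]
  rfl

theorem abs_chi (u i : Index n) : |chi u i| = 1 := by simp [chi, abs_pow]

/-- The vector of `𝔽₂ⁿ` with the given entries modulo `2`. -/
def toIndex (n : ℕ) (f : ℕ → ℕ) : Index n := fun j => (f j : ZMod 2)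

theorem hashBit_eq_val (M : ℕ → ℕ → ℕ) (r : ℕ) (i : Index n) :
    hashBit M i r = (toIndex n (M r) ⬝ᵥ i).val := by
  have h : toIndex n (M r) ⬝ᵥ i = ((∑ j ∈ Finset.range n, M r j * digit i j : ℕ) : ZMod 2) := by
    rw [dotProduct, Finset.sum_range, Nat.cast_sum]
    refine Finset.sum_congr rfl fun j _ => ?_
    simp [toIndex, digit, j.2]
  rw [h, ZMod.val_natCast, hashBit]

theorem chi_toIndex (M : ℕ → ℕ → ℕ) (r : ℕ) (i : Index n) :
    chi (toIndex n (M r)) i = (-1) ^ hashBit M i r := by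
  rw [chi, hashBit_eq_val]

theorem walsh_congr {r : ℕ} {f g : ℕ → ℝ} (h : ∀ w < 2 ^ r, f w = g w) (z : ℕ) :
    walsh r f z = walsh r g z := by
  induction r generalizing f g z with
  | zero => exact h 0 (by norm_num)
  | succ r ih =>
    rw [pow_succ] at h
    simp only [walsh, ih (f := f) (g := g) fun w hw => h w (by omega),
      ih (f := fun w => f (2 ^ r + w)) (g := fun w => g (2 ^ r + w)) fun w hw =>
        h (2 ^ r + w) (by omega)]

theorem walsh_mul (r : ℕ) (c : ℝ) (f : ℕ → ℝ) (z : ℕ) :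
    walsh r (fun w => c * f w) z = c * walsh r f z := by
  induction r generalizing f z with
  | zero => rfl
  | succ r ih =>
    simp only [walsh, ih f, ih fun w => f (2 ^ r + w)]
    split_ifs <;> ring

/-- Induction on the number of rows. Adding row `r` to the point multiplies the term of `i` by `(-1)
^ hashBit M i r`, so the sum and the difference in the butterfly double the terms with one value of
this bit and cancel those with the other. The shift `a` is general because the second half is the
case of the shift by row `r` plus `a`. -/
theorem walsh_rowSum (M : ℕ → ℕ → ℕ) (x : Index n → ℝ) (r : ℕ) (a : Index n) {z : ℕ}
    (hz : z < 2 ^ r) :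
    walsh r (fun w => ∑ i, chi (toIndex n (rowSum M r w) + a) i * x i) z =
      2 ^ r * ∑ i, if hash M i r = z then chi a i * x i else 0 := by
  induction r generalizing a z with
  | zero =>
    have hz0 : z = 0 := by simpa using hz
    have : toIndex n (rowSum M 0 0) = 0 := by
      funext j
      simp [toIndex, rowSum]
    simp [walsh, hz0, this, hash]
  | succ r ih =>
    have h1 : ∀ z, z < 2 ^ r →
        walsh r (fun w => ∑ i, chi (toIndex n (rowSum M (r + 1) w) + a) i * x i) z =
        2 ^ r * ∑ i, if hash M i r = z then chi a i * x i else 0 := by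
      intro z hz
      rw [← ih a hz]
      refine walsh_congr (fun w hw => ?_) z
      have : rowSum M (r + 1) w = rowSum M r w := by
        funext j
        rw [rowSum, if_pos hw]
      rw [this]
    have h2 : ∀ z, z < 2 ^ r →
        walsh r (fun w => ∑ i, chi (toIndex n (rowSum M (r + 1) (2 ^ r + w)) + a) i * x i) z =
        2 ^ r * ∑ i, if hash M i r = z then (-1) ^ hashBit M i r * (chi a i * x i) else 0 := by
      intro z hz
      have := ih (toIndex n (M r) + a) hz
      simp only [chi_add, chi_toIndex] at this
      simp only [mul_assoc] at this
      rw [← this]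
      refine walsh_congr (fun w hw => Finset.sum_congr rfl fun i _ => ?_) z
      have : toIndex n (rowSum M (r + 1) (2 ^ r + w)) =
          toIndex n (rowSum M r w) + toIndex n (M r) := by
        funext j
        simp [toIndex, rowSum]
      rw [this]
      simp only [chi_add, chi_toIndex]
      ring
    rw [walsh]
    split_ifs with hzr
    · rw [h1 z hzr, h2 z hzr, ← mul_add, ← Finset.sum_add_distrib, pow_succ, mul_assoc,
        Finset.mul_sum Finset.univ _ (2 : ℝ)]
      congr 1
      refine Finset.sum_congr rfl fun i _ => ?_
      have hb := hashBit_lt M i r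
      rcases (show hashBit M i r = 0 ∨ hashBit M i r = 1 by omega) with hb | hb
      · simp only [hash, hb, mul_zero, add_zero, pow_zero, one_mul]
        split_ifs <;> ring
      · have : hash M i r + 2 ^ r ≠ z := by omega
        simp only [hash, hb, mul_one, this, if_false, pow_one]
        split_ifs <;> ring
    · have hz' : z - 2 ^ r < 2 ^ r := by rw [pow_succ] at hz; omega
      rw [h1 _ hz', h2 _ hz', ← mul_sub, ← Finset.sum_sub_distrib, pow_succ, mul_assoc,
        Finset.mul_sum Finset.univ _ (2 : ℝ)]
      congr 1
      refine Finset.sum_congr rfl fun i _ => ?_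
      have hb := hashBit_lt M i r
      have hlt := hash_lt M i r
      rcases (show hashBit M i r = 0 ∨ hashBit M i r = 1 by omega) with hb | hb
      · have : hash M i r ≠ z := by omega
        simp only [hash, hb, mul_zero, add_zero, pow_zero, one_mul, this, if_false]
        split_ifs <;> ring
      · have : hash M i r + 2 ^ r = z ↔ hash M i r = z - 2 ^ r := by omega
        simp only [hash, hb, mul_one, this, pow_one]
        split_ifs <;> ring

/-- The zero vector and the unit vectors. -/
def shift (n t : ℕ) : Index n := fun j => if (j : ℕ) + 1 = t then 1 else 0

/-- The sum of the shifted coefficients with hash value `z`. -/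
def bucket (M : ℕ → ℕ → ℕ) (m : ℕ) (x : Index n → ℝ) (t z : ℕ) : ℝ :=
  ∑ i, if hash M i m = z then chi (shift n t) i * x i else 0

/-- The scale cancels both the normalisation of `dht` and the factor `2 ^ m` from `walsh_rowSum`. -/
theorem walsh_dht (M : ℕ → ℕ → ℕ) (x : Index n → ℝ) (m t : ℕ) {z : ℕ} (hz : z < 2 ^ m) :
    walsh m (fun w => √(2 ^ n) / 2 ^ m * dht x (point n M m t w)) z = bucket M m x t z := by
  have hpt : ∀ w, point n M m t w = toIndex n (rowSum M m w) + shift n t := by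
    intro w
    funext j
    simp [point, toIndex, shift]
  have hs : √((2 : ℝ) ^ n) ≠ 0 := by positivity
  have : ∀ w, √(2 ^ n) / 2 ^ m * dht x (point n M m t w) =
      1 / 2 ^ m * ∑ i, chi (toIndex n (rowSum M m w) + shift n t) i * x i := by
    intro w
    rw [hpt, dht, ← mul_assoc]
    congr 1
    field_simp
  simp only [this]
  rw [walsh_mul, walsh_rowSum M x m _ hz, bucket]
  field_simp

theorem chi_shift_zero (i : Index n) : chi (shift n 0) i = 1 := by
  have : shift n 0 = 0 := by funext j; simp [shift]
  simp [this, chi]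

theorem chi_shift_succ (j : Fin n) (i : Index n) : chi (shift n ((j : ℕ) + 1)) i =
    (-1) ^ (i j).val := by
  have : shift n ((j : ℕ) + 1) = Pi.single j 1 := by
    funext l
    simp [shift, Pi.single_apply, Fin.ext_iff]
  rw [chi, this, single_dotProduct, one_mul]

/-- The absolute sum of the other coefficients in the bucket of `i`. -/
def noise (M : ℕ → ℕ → ℕ) (m : ℕ) (x : Index n → ℝ) (i : Index n) : ℝ :=
  ∑ i' ∈ Finset.univ.erase i, if hash M i' m = hash M i m then |x i'| else 0

theorem abs_bucket_sub_le (M : ℕ → ℕ → ℕ) (m : ℕ) (x : Index n → ℝ) (t : ℕ) (i : Index n) :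
    |bucket M m x t (hash M i m) - chi (shift n t) i * x i| ≤ noise M m x i := by
  rw [bucket, ← Finset.add_sum_erase _ _ (Finset.mem_univ i), if_pos rfl, add_sub_cancel_left]
  refine (Finset.abs_sum_le_sum_abs _ _).trans (Finset.sum_le_sum fun i' _ => ?_)
  split_ifs
  · rw [abs_mul, abs_chi, one_mul]
  · simp

/-- The index that is read off from the signs of the shifted sums over a bucket. -/
def candidate (M : ℕ → ℕ → ℕ) (m : ℕ) (x : Index n → ℝ) (z : ℕ) : Index n := fun j =>
  if bucket M m x 0 z * bucket M m x ((j : ℕ) + 1) z < 0 then 1 else 0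

theorem decode_eq_candidate {M : ℕ → ℕ → ℕ} {m : ℕ} {x : Index n → ℝ} {Y : ℕ → ℝ} {ρ z : ℕ}
    (hY : ∀ t < n + 1, Y ((ρ * (n + 1) + t) * 2 ^ m + z) = bucket M m x t z) :
    decode n Y (2 ^ m) (ρ * (n + 1) * 2 ^ m + z) = candidate M m x z := by
  funext j
  have e : ρ * (n + 1) * 2 ^ m + z + ((j : ℕ) + 1) * 2 ^ m =
      (ρ * (n + 1) + (j + 1)) * 2 ^ m + z := by ring
  have h0 := hY 0 (by omega)
  rw [add_zero] at h0
  rw [decode, e, h0, hY (j + 1) (by omega), candidate]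

/-- A coefficient that exceeds the noise in its bucket is identified. -/
theorem candidate_hash {M : ℕ → ℕ → ℕ} {m : ℕ} {x : Index n → ℝ} {i : Index n}
    (h : noise M m x i < |x i|) : candidate M m x (hash M i m) = i := by
  have h0 := abs_bucket_sub_le M m x 0 i
  rw [chi_shift_zero, one_mul] at h0
  funext j
  have hj := abs_bucket_sub_le M m x ((j : ℕ) + 1) i
  rw [chi_shift_succ] at hj
  rw [candidate]
  set u := bucket M m x 0 (hash M i m)
  set v := bucket M m x ((j : ℕ) + 1) (hash M i m)
  have hval := (i j).val_lt
  -- By `h`, `u` and `v` are closer than `|x i|` to `x i` and `(-1) ^ (i j).val * x i`, so they have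
  -- the signs of these numbers. Their product is negative exactly when digit `j` is `1`.
  rcases (show (i j).val = 0 ∨ (i j).val = 1 by omega) with hd | hd
  · have hd' : i j = 0 := (ZMod.val_eq_zero _).1 hd
    rw [hd, pow_zero, one_mul] at hj
    rw [hd', if_neg]
    rw [not_lt]
    rcases abs_cases (x i) with ⟨hx, hx'⟩ | ⟨hx, hx'⟩
    · exact mul_nonneg (by linarith [abs_le.1 h0]) (by linarith [abs_le.1 hj])
    · exact mul_nonneg_of_nonpos_of_nonpos (by linarith [abs_le.1 h0]) (by linarith [abs_le.1 hj])
  · have hd' : i j = 1 := ZMod.val_injective 2 (by rw [hd, ZMod.val_one])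
    rw [hd, pow_one, neg_one_mul, sub_neg_eq_add] at hj
    rw [hd', if_pos]
    rcases abs_cases (x i) with ⟨hx, hx'⟩ | ⟨hx, hx'⟩
    · exact mul_neg_of_pos_of_neg (by linarith [abs_le.1 h0]) (by linarith [abs_le.1 hj])
    · exact mul_neg_of_neg_of_pos (by linarith [abs_le.1 h0]) (by linarith [abs_le.1 hj])

/-! ### The error of the output -/

theorem selected_of_mem {l : List (Index n)} (hl : l.Nodup) {κ med : ℕ → ℝ} {sel : ℕ → ℕ}
    {N k q : ℕ} (h : IsTop κ N k sel) (hq : q < k) (hp : sel q < l.length) :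
    selected l med sel k l[sel q] = med (sel q) := by
  rw [selected, Finset.sum_eq_single q]
  · simp [hp]
  · intro q' hq' hne
    rw [if_neg]
    intro he
    obtain ⟨hp', he⟩ := List.getElem?_eq_some_iff.1 he
    exact hne (h.inj q' (Finset.mem_range.1 hq') q hq ((hl.getElem_inj_iff).1 he))
  · simp [hq]

theorem selected_of_notMem {l : List (Index n)} {med : ℕ → ℝ} {sel : ℕ → ℕ} {k : ℕ} {i : Index n}
    (h : ∀ q < k, l[sel q]? ≠ some i) : selected l med sel k i = 0 :=
  Finset.sum_eq_zero fun q hq => if_neg (h q (Finset.mem_range.1 hq))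

/-- The indices of the selected coefficients. -/
def chosen (l : List (Index n)) (sel : ℕ → ℕ) (k : ℕ) : Finset (Index n) :=
  Finset.univ.filter fun i => ∃ q < k, l[sel q]? = some i

theorem mem_chosen {l : List (Index n)} {sel : ℕ → ℕ} {k : ℕ} {i : Index n} :
    i ∈ chosen l sel k ↔ ∃ q < k, l[sel q]? = some i := by simp [chosen]

theorem card_chosen_le (l : List (Index n)) (sel : ℕ → ℕ) (k : ℕ) :
    (chosen l sel k).card ≤ k := by
  have : chosen l sel k ⊆ (Finset.range k).image fun q => (l[sel q]?).getD 0 := by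
    intro i hi
    obtain ⟨q, hq, he⟩ := mem_chosen.1 hi
    exact Finset.mem_image.2 ⟨q, Finset.mem_range.2 hq, by simp [he]⟩
  simpa using (Finset.card_le_card this).trans Finset.card_image_le

theorem isSparse_selected (l : List (Index n)) (med : ℕ → ℝ) (sel : ℕ → ℕ) (k : ℕ) :
    IsSparse k (selected l med sel k) := by
  refine (Finset.card_le_card fun i hi => ?_).trans (card_chosen_le l sel k)
  by_contra hn
  exact (Finset.mem_filter.1 hi).2 (selected_of_notMem fun q hq he => hn (mem_chosen.2 ⟨q, hq, he⟩))

theorem le_card_chosen {l : List (Index n)} (hl : l.Nodup) {κ : ℕ → ℝ} {sel : ℕ → ℕ}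
    {N k : ℕ} (h : IsTop κ N k sel) (hlt : ∀ q < k, sel q < l.length) :
    k ≤ (chosen l sel k).card := by
  have := Finset.card_le_card_of_injOn (s := Finset.range k) (t := chosen l sel k)
    (fun q => (l[sel q]?).getD 0) ?_ ?_
  · simpa using this
  · intro q hq
    have hq := Finset.mem_range.1 hq
    exact mem_chosen.2 ⟨q, hq, by simp [hlt q hq]⟩
  · intro q hq q' hq' he
    have hq : q < k := by simpa using hq
    have hq' : q' < k := by simpa using hq'
    simp only [List.getElem?_eq_getElem (hlt q hq), List.getElem?_eq_getElem (hlt q' hq'),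
      Option.getD_some] at he
    exact h.inj q hq q' hq' ((hl.getElem_inj_iff).1 he)

/-- If the listed coefficients are known up to `τ` and no large coefficient is missing, then the
selection of the largest estimates is nearly optimal. -/
theorem l1_selected_sub_le {l : List (Index n)} (hl : l.Nodup) {med : ℕ → ℝ} {sel : ℕ → ℕ}
    {N k : ℕ} (h : IsTop (fun p => |med p|) N k sel) (hk : 0 < k) (hN : l.length ≤ N)
    (hrest : ∀ p, l.length ≤ p → med p = 0) {x : Index n → ℝ} {S : Finset (Index n)}
    (hS : S.card = k) {τ : ℝ} (hτ : 0 ≤ τ)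
    (hmed : ∀ (p : ℕ) (hp : p < l.length), |med p - x l[p]| ≤ τ)
    (hmem : ∀ i ∈ S, τ < |x i| → i ∈ l) :
    l1 (selected l med sel k - x) ≤ ∑ i ∈ Sᶜ, |x i| + 3 * (k * τ) := by
  set T := chosen l sel k with hT
  set z := selected l med sel k with hz
  obtain ⟨q₀, hq₀, hmin⟩ := Finset.exists_min_image (Finset.range k) (fun q => |med (sel q)|)
    ⟨0, Finset.mem_range.2 hk⟩
  rw [Finset.mem_range] at hq₀
  set v := |med (sel q₀)| with hv
  have hv0 : 0 ≤ v := abs_nonneg _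
  have hTc : (T.card : ℝ) ≤ k := by exact_mod_cast card_chosen_le l sel k
  have hin : ∀ i ∈ T, |z i - x i| ≤ τ ∧ v ≤ |z i| := by
    intro i hi
    obtain ⟨q, hq, he⟩ := mem_chosen.1 hi
    obtain ⟨hp, rfl⟩ := List.getElem?_eq_some_iff.1 he
    rw [hz, selected_of_mem hl h hq hp]
    exact ⟨hmed _ hp, hmin q (Finset.mem_range.2 hq)⟩
  have hout : ∀ i ∉ T, z i = 0 := fun i hi =>
    selected_of_notMem fun q hq he => hi (mem_chosen.2 ⟨q, hq, he⟩)
  -- A missed index of `S` above `τ` is listed, and its estimate is at most the smallest selected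
  -- magnitude `v`.
  have hmiss : ∀ i ∈ S \ T, |x i| ≤ v + τ := by
    intro i hi
    rw [Finset.mem_sdiff] at hi
    by_cases hx : τ < |x i|
    · obtain ⟨p, hp, rfl⟩ := List.getElem_of_mem (hmem i hi.1 hx)
      have h1 : |med p| ≤ v := h.le q₀ hq₀ p (by omega) fun q hq he =>
        hi.2 (mem_chosen.2 ⟨q, hq, by simp [he, hp]⟩)
      have h2 := hmed p hp
      have h3 := abs_sub_abs_le_abs_sub (x l[p]) (med p)
      rw [abs_sub_comm] at h3
      linarith
    · linarith
  have hsplit : l1 (z - x) = ∑ i ∈ T, |z i - x i| + (∑ i ∈ S \ T, |x i| +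
      ∑ i ∈ Sᶜ \ T, |x i|) := by
    rw [l1, ← Finset.sum_add_sum_compl T]
    congr 1
    have : Tᶜ = S \ T ∪ Sᶜ \ T := by
      ext i
      simp only [Finset.mem_compl, Finset.mem_union, Finset.mem_sdiff]
      tauto
    rw [this, Finset.sum_union]
    · congr 1 <;>
      · refine Finset.sum_congr rfl fun i hi => ?_
        rw [Pi.sub_apply, hout i (Finset.mem_sdiff.1 hi).2, zero_sub, abs_neg]
    · rw [Finset.disjoint_left]
      intro i hi hi'
      simp only [Finset.mem_compl, Finset.mem_sdiff] at hi hi'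
      tauto
  have hS' : ∑ i ∈ Sᶜ, |x i| = ∑ i ∈ T \ S, |x i| + ∑ i ∈ Sᶜ \ T, |x i| := by
    rw [← Finset.sum_inter_add_sum_sdiff Sᶜ T]
    congr 2
    ext i
    simp only [Finset.mem_inter, Finset.mem_compl, Finset.mem_sdiff]
    tauto
  have h1 : ∑ i ∈ T, |z i - x i| ≤ k * τ :=
    (Finset.sum_le_card_nsmul _ _ _ fun i hi => (hin i hi).1).trans (by
      rw [nsmul_eq_mul]
      exact mul_le_mul_of_nonneg_right hTc hτ)
  have h2 : ∑ i ∈ S \ T, |x i| ≤ (S \ T).card * (v + τ) := by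
    rw [← nsmul_eq_mul]
    exact Finset.sum_le_card_nsmul _ _ _ hmiss
  -- An exchange argument. If only listed positions are selected, `S \ T` and `T \ S` have the same
  -- size, and entries of at most `v + τ` are lost against entries of at least `v - τ`, at a price
  -- of `2 * τ` each. Otherwise a position behind the list was selected, so `v = 0` and each lost
  -- entry is at most `τ`.
  have h3 : ∑ i ∈ S \ T, |x i| ≤ ∑ i ∈ T \ S, |x i| + 2 * (k * τ) := by
    by_cases hlt : ∀ q < k, sel q < l.length
    · have hc : (S \ T).card = (T \ S).card := by
        rw [Finset.card_sdiff_comm]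
        rw [hS]
        exact le_antisymm (le_card_chosen hl h hlt) (card_chosen_le l sel k)
      have h4 : (T \ S).card * (v - τ) ≤ ∑ i ∈ T \ S, |x i| := by
        rw [← nsmul_eq_mul]
        refine Finset.card_nsmul_le_sum _ _ _ fun i hi => ?_
        obtain ⟨h5, h6⟩ := hin i (Finset.mem_sdiff.1 hi).1
        have := abs_sub_abs_le_abs_sub (z i) (x i)
        linarith
      have h5 : ((T \ S).card : ℝ) * τ ≤ k * τ := by
        refine mul_le_mul_of_nonneg_right (le_trans ?_ hTc) hτ
        exact_mod_cast Finset.card_le_card Finset.sdiff_subset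
      rw [hc] at h2
      linarith
    · push Not at hlt
      obtain ⟨q, hq, hq'⟩ := hlt
      have hv' : v ≤ 0 := by simpa [hrest _ hq'] using hmin q (Finset.mem_range.2 hq)
      have h5 : ((S \ T).card : ℝ) * (v + τ) ≤ k * τ := by
        have : ((S \ T).card : ℝ) ≤ k := by
          rw [← hS]
          exact_mod_cast Finset.card_le_card Finset.sdiff_subset
        exact mul_le_mul this (by linarith) (by linarith) (by positivity)
      have h6 : 0 ≤ ∑ i ∈ T \ S, |x i| := Finset.sum_nonneg fun i _ => abs_nonneg _
      have h7 : 0 ≤ k * τ := by positivity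
      linarith
  linarith

/-- If the median were off by more than `τ`, then at least half of the values would be off by more
than `τ` on the same side. -/
theorem IsMedian.abs_sub_le {v : ℕ → ℝ} {R : ℕ} {y a τ : ℝ} (h : IsMedian v R y)
    (hb : 2 * ((Finset.range R).filter fun ρ => τ < |v ρ - a|).card < R) : |y - a| ≤ τ := by
  have key : ∀ p : ℕ → Prop, ∀ [DecidablePred p], (∀ ρ, p ρ → τ < |v ρ - a|) →
      2 * ((Finset.range R).filter p).card < R := by
    intro p _ hp
    have := Finset.card_le_card (Finset.monotone_filter_right (Finset.range R)
      (fun ρ _ => hp ρ : ∀ ρ ∈ _, p ρ → _))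
    omega
  by_contra hn
  rw [not_le, lt_abs] at hn
  rcases hn with hn | hn
  · exact (h.1.trans_lt (key _ fun ρ hρ => lt_abs.2 (Or.inl (by linarith)))).false
  · exact (h.2.trans_lt (key _ fun ρ hρ => lt_abs.2 (Or.inr (by linarith)))).false

theorem tally_eq_card (c : ℕ → Index n) (P : ℕ) (i : Index n) :
    tally c P i = ((Finset.range P).filter fun p => c p = i).card := by
  rw [tally, Finset.card_filter]

/-- Double counting: there are `R * B` candidates altogether, and each listed index accounts for at
least `R / 2` of them. -/
theorem length_le_of_tally {c : ℕ → Index n} {R B : ℕ} (hR : 0 < R) {l : List (Index n)}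
    (hl : l.Nodup) (h : ∀ i ∈ l, R ≤ 2 * tally c (R * B) i) : l.length ≤ 2 * B := by
  have h1 : ∑ i : Index n, tally c (R * B) i = R * B := by
    simp only [tally]
    rw [Finset.sum_comm]
    simp
  have h2 : l.toFinset.card * R ≤ ∑ i ∈ l.toFinset, 2 * tally c (R * B) i := by
    rw [← smul_eq_mul]
    exact Finset.card_nsmul_le_sum _ _ _ fun i hi => h i (List.mem_toFinset.1 hi)
  have h3 := h2.trans (Finset.sum_le_sum_of_subset (Finset.subset_univ _))
  rw [← Finset.mul_sum, h1, List.toFinset_card_of_nodup hl] at h3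
  refine Nat.le_of_mul_le_mul_right (h3.trans_eq ?_) hR
  ring

/-- The number of repetitions in which the bucket of `i` is noisy. -/
def crowding (A : ℕ → ℕ → ℕ → ℕ) (R m : ℕ) (x : Index n → ℝ) (τ : ℝ) (i : Index n) : ℕ :=
  ((Finset.range R).filter fun ρ => τ < noise (A ρ) m x i).card

/-- The candidates of all repetitions and buckets. -/
def candidates (A : ℕ → ℕ → ℕ → ℕ) (m : ℕ) (x : Index n → ℝ) (p : ℕ) : Index n :=
  candidate (A (p / 2 ^ m)) m x (p % 2 ^ m)

/-- A large coefficient that is rarely in a noisy bucket is often a candidate. -/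
theorem le_tally {A : ℕ → ℕ → ℕ → ℕ} {R m : ℕ} {x : Index n → ℝ} {τ : ℝ} {i : Index n}
    (hx : τ < |x i|) (h : 2 * crowding A R m x τ i < R) :
    R ≤ 2 * tally (candidates A m x) (R * 2 ^ m) i := by
  have h1 : ((Finset.range R).filter fun ρ => ¬ τ < noise (A ρ) m x i).card ≤
      tally (candidates A m x) (R * 2 ^ m) i := by
    rw [tally_eq_card]
    -- Each quiet repetition `ρ` contributes the candidate read off from the bucket of `i`; the
    -- quotient by `2 ^ m` recovers `ρ`.
    refine Finset.card_le_card_of_injOn (fun ρ => ρ * 2 ^ m + hash (A ρ) i m) ?_ ?_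
    · intro ρ hρ
      obtain ⟨hρ, hn⟩ := Finset.mem_filter.1 hρ
      rw [Finset.mem_range] at hρ
      have hlt := hash_lt (A ρ) i m
      refine Finset.mem_filter.2 ⟨Finset.mem_range.2 ?_, ?_⟩
      · calc ρ * 2 ^ m + hash (A ρ) i m < (ρ + 1) * 2 ^ m := by rw [add_mul]; omega
          _ ≤ R * 2 ^ m := Nat.mul_le_mul_right _ hρ
      · beta_reduce
        rw [candidates, mul_comm, Nat.mul_add_div (by positivity), Nat.div_eq_of_lt hlt,
          Nat.mul_add_mod, Nat.mod_eq_of_lt hlt, add_zero]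
        exact candidate_hash (by linarith)
    · intro ρ _ ρ' _ he
      have := congrArg (· / 2 ^ m) he
      simpa [mul_comm _ (2 ^ m), Nat.mul_add_div, Nat.div_eq_of_lt (hash_lt _ i m)] using this
  have h2 := Finset.card_filter_add_card_filter_not (s := Finset.range R)
    (fun ρ => τ < noise (A ρ) m x i)
  rw [Finset.card_range] at h2
  rw [crowding] at h
  omega

/-- The error of the output if no important coefficient is often in a noisy bucket. -/
theorem l1_selected_sub_le_of_crowding {A A' : ℕ → ℕ → ℕ → ℕ} {R m k : ℕ} {x : Index n → ℝ}
    {S : Finset (Index n)} (hk : 0 < k) (hS : S.card = k) {l : List (Index n)} (hl : l.Nodup)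
    (hlR : ∀ i, i ∈ l ↔ R ≤ 2 * tally (candidates A m x) (R * 2 ^ m) i)
    {med : ℕ → ℝ} {sel : ℕ → ℕ} (hR : 0 < R)
    (hsel : IsTop (fun p => |med p|) (2 ^ (m + 1)) k sel)
    (hrest : ∀ p, l.length ≤ p → med p = 0)
    (hmed : ∀ (p : ℕ) (hp : p < l.length),
      IsMedian (fun ρ => bucket (A' ρ) m x 0 (hash (A' ρ) l[p] m)) R (med p))
    (h : ∀ i ∈ S, 2 * crowding A R m x ((∑ i ∈ Sᶜ, |x i|) / k) i < R)
    (h' : ∀ i ∈ l, 2 * crowding A' R m x ((∑ i ∈ Sᶜ, |x i|) / k) i < R) :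
    l1 (selected l med sel k - x) ≤ 4 * ∑ i ∈ Sᶜ, |x i| := by
  set σ := ∑ i ∈ Sᶜ, |x i| with hσ
  have hσ0 : 0 ≤ σ := Finset.sum_nonneg fun i _ => abs_nonneg _
  have hk' : (0 : ℝ) < k := by exact_mod_cast hk
  have key := l1_selected_sub_le hl hsel hk ?_ hrest hS (x := x) (τ := σ / k) (by positivity) ?_ ?_
  · rw [mul_div_cancel₀ _ hk'.ne'] at key
    linarith
  · rw [pow_succ, mul_comm]
    exact length_le_of_tally hR hl fun i hi => (hlR i).1 hi
  · intro p hp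
    refine (hmed p hp).abs_sub_le (lt_of_le_of_lt ?_ (h' l[p] (List.getElem_mem hp)))
    refine Nat.mul_le_mul_left 2 (Finset.card_le_card
      (Finset.monotone_filter_right _ fun ρ _ hρ => hρ.trans_le ?_))
    have := abs_bucket_sub_le (A' ρ) m x 0 l[p]
    rwa [chi_shift_zero, one_mul] at this
  · intro i hi hx
    exact (hlR i).2 (le_tally hx (h i hi))

/-! ### Random matrices -/

/-- The matrices over `𝔽₂` with `m` rows of length `n`. -/
abbrev Mat (m n : ℕ) : Type := Fin m → Index n

/-- The entries of a matrix as natural numbers. -/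
def entries {m : ℕ} (M : Mat m n) (r j : ℕ) : ℕ :=
  if h : r < m then digit (M ⟨r, h⟩) j else 0

theorem entries_lt {m : ℕ} (M : Mat m n) (r j : ℕ) : entries M r j < 2 := by
  unfold entries
  split_ifs
  · exact digit_lt _ _
  · norm_num

theorem card_mat (m n : ℕ) : Fintype.card (Mat m n) = 2 ^ (n * m) := by
  simp [ZMod.card, pow_mul]

theorem toIndex_entries {m : ℕ} (M : Mat m n) (r : Fin m) :
    toIndex n (entries M r) = M r := by
  funext j
  simp [toIndex, entries, digit]

theorem hashBit_eq_of_hash_eq {M : ℕ → ℕ → ℕ} {i i' : Index n} {m : ℕ}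
    (h : hash M i m = hash M i' m) : ∀ r < m, hashBit M i r = hashBit M i' r := by
  induction m with
  | zero => intro r hr; omega
  | succ m ih =>
    simp only [hash] at h
    have h1 := hash_lt M i m
    have h2 := hash_lt M i' m
    have h3 := hashBit_lt M i m
    have h4 := hashBit_lt M i' m
    have h5 : hash M i m = hash M i' m ∧ hashBit M i m = hashBit M i' m := by
      rcases (show hashBit M i m = 0 ∨ hashBit M i m = 1 by omega) with h | h <;>
      rcases (show hashBit M i' m = 0 ∨ hashBit M i' m = 1 by omega) with h' | h' <;>
      simp_all
      all_goals omega
    exact Nat.forall_lt_succ_right.2 ⟨ih h5.1, h5.2⟩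

/-- At a coordinate where `d` does not vanish, adding the unit vector sends orthogonal vectors
injectively to vectors that are not orthogonal. -/
theorem two_mul_card_orthogonal_le {d : Index n} (hd : d ≠ 0) :
    2 * (Finset.univ.filter fun v : Index n => v ⬝ᵥ d = 0).card ≤ 2 ^ n := by
  obtain ⟨j, hj⟩ := Function.ne_iff.1 hd
  have h1 : (Finset.univ.filter fun v : Index n => v ⬝ᵥ d = 0).card ≤
      (Finset.univ.filter fun v : Index n => ¬ v ⬝ᵥ d = 0).card := by
    refine Finset.card_le_card_of_injOn (fun v => v + Pi.single j 1) ?_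
      (add_left_injective _).injOn
    intro v hv
    have hv := (Finset.mem_filter.1 hv).2
    refine Finset.mem_filter.2 ⟨Finset.mem_univ _, ?_⟩
    rw [add_dotProduct, hv, single_dotProduct, one_mul, zero_add]
    exact hj
  have h2 := Finset.card_filter_add_card_filter_not (s := (Finset.univ : Finset (Index n)))
    (fun v => v ⬝ᵥ d = 0)
  have h3 : (Finset.univ : Finset (Index n)).card = 2 ^ n := by simp [ZMod.card]
  omega

/-- Two indices rarely have the same hash value. -/
theorem card_collision_mul_le (m : ℕ) {i i' : Index n} (h : i' ≠ i) :
    (Finset.univ.filter fun M : Mat m n =>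
      hash (entries M) i' m = hash (entries M) i m).card * 2 ^ m ≤ Fintype.card (Mat m n) := by
  set O := Finset.univ.filter fun v : Index n => v ⬝ᵥ (i' - i) = 0 with hO
  -- A collision forces all `m` rows to be orthogonal to `i' - i`, and the rows range independently
  -- over all vectors.
  have h1 : (Finset.univ.filter fun M : Mat m n =>
      hash (entries M) i' m = hash (entries M) i m) ⊆ Fintype.piFinset fun _ => O := by
    intro M hM
    rw [Fintype.mem_piFinset]
    intro r
    have := hashBit_eq_of_hash_eq (Finset.mem_filter.1 hM).2 r r.2
    rw [hashBit_eq_val, hashBit_eq_val, toIndex_entries] at this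
    refine Finset.mem_filter.2 ⟨Finset.mem_univ _, ?_⟩
    rw [dotProduct_sub, ZMod.val_injective 2 this, sub_self]
  refine (Nat.mul_le_mul_right _ (Finset.card_le_card h1)).trans ?_
  rw [Fintype.card_piFinset, Finset.prod_const, Finset.card_univ, Fintype.card_fin, ← mul_pow,
    card_mat, pow_mul, mul_comm]
  exact Nat.pow_le_pow_left (two_mul_card_orthogonal_le (sub_ne_zero.2 h)) m

/-- The matrices for which the bucket of `i` is noisy. -/
def noisy (m : ℕ) (x : Index n → ℝ) (τ : ℝ) (i : Index n) : Finset (Mat m n) :=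
  Finset.univ.filter fun M => τ < noise (entries M) m x i

/-- A bucket is noisy for one of two reasons. Another index of `S` falls into it, which has
probability at most `k / 2 ^ m` by a union bound. Or the tail contributes more than `σ / k`,
although its mean contribution is at most `σ / 2 ^ m`; by Markov's inequality this has probability
at most `k / 2 ^ m` too. -/
theorem card_noisy_mul_le (m : ℕ) {k : ℕ} (hk : 0 < k) (x : Index n → ℝ) {S : Finset (Index n)}
    (hS : S.card = k) (i : Index n) :
    ((noisy m x ((∑ i ∈ Sᶜ, |x i|) / k) i).card : ℝ) * 2 ^ m ≤
      2 * k * Fintype.card (Mat m n) := by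
  set σ := ∑ i ∈ Sᶜ, |x i| with hσ
  set G : ℝ := (Fintype.card (Mat m n) : ℝ) with hG
  have hσ0 : 0 ≤ σ := Finset.sum_nonneg fun i _ => abs_nonneg _
  have hk' : (0 : ℝ) < k := by exact_mod_cast hk
  set C : Index n → Finset (Mat m n) := fun i' => Finset.univ.filter fun M =>
    hash (entries M) i' m = hash (entries M) i m with hC
  have hCc : ∀ i', i' ≠ i → ((C i').card : ℝ) * 2 ^ m ≤ G := fun i' h => by
    rw [hG]
    exact_mod_cast card_collision_mul_le m h
  set tail : Mat m n → ℝ := fun M => ∑ i' ∈ Sᶜ.erase i, if M ∈ C i' then |x i'| else 0 with htail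
  have hsub : noisy m x (σ / k) i ⊆ (S.erase i).biUnion C ∪
      Finset.univ.filter fun M => σ / k < tail M := by
    intro M hM
    rw [Finset.mem_union, or_iff_not_imp_left]
    intro hn
    refine Finset.mem_filter.2 ⟨Finset.mem_univ _, (Finset.mem_filter.1 hM).2.trans_le ?_⟩
    rw [noise, htail, ← Finset.sum_subset (Finset.erase_subset_erase i (Finset.subset_univ Sᶜ))]
    · simp [hC]
    · intro i' hi' hi''
      rw [if_neg]
      intro he
      rw [Finset.mem_erase] at hi'
      rw [Finset.mem_erase, Finset.mem_compl] at hi''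
      exact hn (Finset.mem_biUnion.2 ⟨i', Finset.mem_erase.2 ⟨hi'.1, by tauto⟩, by simp [hC, he]⟩)
  have h1 : (((S.erase i).biUnion C).card : ℝ) * 2 ^ m ≤ k * G := by
    calc (((S.erase i).biUnion C).card : ℝ) * 2 ^ m
        ≤ (∑ i' ∈ S.erase i, ((C i').card : ℝ)) * 2 ^ m := by
          refine mul_le_mul_of_nonneg_right ?_ (by positivity)
          exact_mod_cast Finset.card_biUnion_le
      _ ≤ ∑ i' ∈ S.erase i, G := by
          rw [Finset.sum_mul]
          exact Finset.sum_le_sum fun i' hi' => hCc i' (Finset.ne_of_mem_erase hi')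
      _ ≤ k * G := by
          rw [Finset.sum_const, nsmul_eq_mul, ← hS]
          refine mul_le_mul_of_nonneg_right ?_ (by positivity)
          exact_mod_cast Finset.card_le_card (Finset.erase_subset i S)
  have htail_sum : (∑ M, tail M) * 2 ^ m ≤ σ * G := by
    rw [htail, Finset.sum_comm, Finset.sum_mul, hσ, Finset.sum_mul]
    refine (Finset.sum_le_sum fun i' hi' => ?_).trans
      (Finset.sum_le_sum_of_subset_of_nonneg (Finset.erase_subset i _)
        fun i' _ _ => mul_nonneg (abs_nonneg (x i')) (by positivity))
    rw [← Finset.sum_filter, Finset.sum_const, nsmul_eq_mul, Finset.filter_mem_eq_inter,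
      Finset.univ_inter]
    calc ((C i').card : ℝ) * |x i'| * 2 ^ m = |x i'| * ((C i').card * 2 ^ m) := by ring
      _ ≤ |x i'| * G := mul_le_mul_of_nonneg_left (hCc i' (Finset.ne_of_mem_erase hi'))
          (abs_nonneg _)
  have htail0 : ∀ M, 0 ≤ tail M := fun M =>
    Finset.sum_nonneg fun i' _ => by split_ifs <;> positivity
  have h2 : ((Finset.univ.filter fun M => σ / k < tail M).card : ℝ) * 2 ^ m ≤ k * G := by
    -- Markov's inequality divides by `σ`; for `σ = 0` the tail vanishes and the event is empty.
    rcases hσ0.eq_or_lt with h0 | h0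
    · have hz : (Finset.univ.filter fun M => σ / k < tail M) = ∅ := by
        refine Finset.filter_eq_empty_iff.2 fun M _ => not_lt.2 ?_
        have : tail M ≤ σ := by
          refine (Finset.sum_le_sum fun i' _ => ?_).trans
            (Finset.sum_le_sum_of_subset_of_nonneg (f := fun i' => |x i'|)
              (Finset.erase_subset i _) fun i' _ _ => abs_nonneg (x i'))
          split_ifs
          · exact le_rfl
          · exact abs_nonneg _
        simpa [← h0] using this
      rw [hz]
      simp only [Finset.card_empty, Nat.cast_zero, zero_mul]
      positivity
    · have h3 : ((Finset.univ.filter fun M => σ / k < tail M).card : ℝ) * (σ / k) ≤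
          ∑ M, tail M := by
        rw [← nsmul_eq_mul]
        exact (Finset.card_nsmul_le_sum _ _ _ fun M hM => (Finset.mem_filter.1 hM).2.le).trans
          (Finset.sum_le_sum_of_subset_of_nonneg (Finset.subset_univ _) fun M _ _ => htail0 M)
      have h4 := (mul_le_mul_of_nonneg_right h3 (by positivity : (0 : ℝ) ≤ 2 ^ m)).trans htail_sum
      refine le_of_mul_le_mul_left ?_ h0
      calc _ = k * (((Finset.univ.filter fun M => σ / k < tail M).card : ℝ) * (σ / k) * 2 ^ m) := by
            field_simp
        _ ≤ k * (σ * G) := mul_le_mul_of_nonneg_left h4 hk'.le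
        _ = _ := by ring
  have h3 : ((noisy m x (σ / k) i).card : ℝ) ≤ ((S.erase i).biUnion C).card +
      (Finset.univ.filter fun M => σ / k < tail M).card := by
    exact_mod_cast (Finset.card_le_card hsub).trans (Finset.card_union_le _ _)
  have h4 := mul_le_mul_of_nonneg_right h3 (by positivity : (0 : ℝ) ≤ 2 ^ m)
  linarith

/-- A rare event rarely happens in half of `R` independent repetitions. -/
theorem card_majority_mul_le {α : Type*} [Fintype α] [DecidableEq α] (F : Finset α)
    (hF : F.card * 32 ≤ Fintype.card α) (R : ℕ) :
    (Finset.univ.filter fun A : Fin R → α =>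
      R ≤ 2 * (Finset.univ.filter fun ρ => A ρ ∈ F).card).card * 2 ^ R ≤ Fintype.card α ^ R := by
  set E := Finset.univ.filter fun A : Fin R → α =>
      R ≤ 2 * (Finset.univ.filter fun ρ => A ρ ∈ F).card with hE
  -- An exponential moment with weight `16` on `F`: on `E` the product is at least `16 ^ (R / 2) = 4
  -- ^ R`, while a single factor has mean at most `1 + 15 / 32 ≤ 2`. The quotient of the two bounds
  -- is `2 ^ (-R)`.
  have h1 : E.card * 4 ^ R ≤ ∑ A : Fin R → α, ∏ ρ, if A ρ ∈ F then 16 else 1 := by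
    rw [← smul_eq_mul]
    refine (Finset.card_nsmul_le_sum E (fun A => ∏ ρ, if A ρ ∈ F then 16 else 1) _
      fun A hA => ?_).trans (Finset.sum_le_sum_of_subset (Finset.subset_univ _))
    rw [Finset.prod_ite, Finset.prod_const, Finset.prod_const_one, mul_one,
      show 16 = 4 ^ 2 by norm_num, ← pow_mul]
    exact Nat.pow_le_pow_right (by norm_num) (Finset.mem_filter.1 hA).2
  have h2 : ∑ a : α, (if a ∈ F then 16 else 1) ≤ 2 * Fintype.card α := by
    have h3 : ∀ a : α, (if a ∈ F then 16 else 1) = 1 + if a ∈ F then 15 else 0 := by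
      intro a
      split_ifs <;> rfl
    rw [Finset.sum_congr rfl fun a _ => h3 a, Finset.sum_add_distrib, ← Finset.sum_filter,
      Finset.sum_const, Finset.sum_const, Finset.card_univ, Finset.filter_mem_eq_inter,
      Finset.univ_inter, smul_eq_mul, smul_eq_mul]
    omega
  rw [← Fintype.sum_pow fun a : α => if a ∈ F then 16 else 1] at h1
  have h3 := h1.trans (Nat.pow_le_pow_left h2 R)
  rw [show 4 = 2 * 2 by norm_num, mul_pow, mul_pow] at h3
  refine Nat.le_of_mul_le_mul_left (h3.trans' (le_of_eq ?_)) (by positivity : 0 < 2 ^ R)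
  ring

/-- The first `R` matrices of a sequence. -/
def family {m R : ℕ} (A : Fin R → Mat m n) (ρ : ℕ) : ℕ → ℕ → ℕ :=
  entries (if h : ρ < R then A ⟨ρ, h⟩ else 0)

theorem crowding_family {m R : ℕ} (A : Fin R → Mat m n) (x : Index n → ℝ) (τ : ℝ) (i : Index n) :
    crowding (family A) R m x τ i = (Finset.univ.filter fun ρ => A ρ ∈ noisy m x τ i).card := by
  rw [crowding, Finset.card_filter, Finset.card_filter, Finset.sum_range]
  refine Finset.sum_congr rfl fun ρ _ => ?_
  simp [family, noisy]

/-- No important coefficient is often in a noisy bucket. -/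
def Separated (R m : ℕ) (x : Index n → ℝ) (S : Finset (Index n)) (τ : ℝ)
    (A A' : ℕ → ℕ → ℕ → ℕ) : Prop :=
  (∀ i ∈ S, 2 * crowding A R m x τ i < R) ∧
    ∀ i, R ≤ 2 * tally (candidates A m x) (R * 2 ^ m) i → 2 * crowding A' R m x τ i < R

-- Since `64 * k ≤ 2 ^ m`, noise has probability at most `1/32`, so each index is crowded with
-- probability at most `2 ^ (-R)`. The union bound runs over the `k ≤ 2 ^ m` indices of `S` for the
-- first family. For the second family it runs over the at most `2 * 2 ^ m` indices listed by the
-- first; this list is fixed before the second family is drawn, which is the reason for having two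
-- families.
open scoped Classical in
theorem card_not_separated_mul_le {R m k : ℕ} (hR : 0 < R) (hk : 0 < k) (hm : 64 * k ≤ 2 ^ m)
    (x : Index n → ℝ) {S : Finset (Index n)} (hS : S.card = k) :
    (Finset.univ.filter fun V : (Fin R → Mat m n) × (Fin R → Mat m n) =>
      ¬ Separated R m x S ((∑ i ∈ Sᶜ, |x i|) / k) (family V.1) (family V.2)).card * 2 ^ R ≤
    3 * 2 ^ m * Fintype.card (Mat m n) ^ (R + R) := by
  set τ := (∑ i ∈ Sᶜ, |x i|) / k with hτ
  set G := Fintype.card (Mat m n) with hG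
  set E : Index n → Finset (Fin R → Mat m n) := fun i => Finset.univ.filter fun A =>
    R ≤ 2 * (Finset.univ.filter fun ρ => A ρ ∈ noisy m x τ i).card with hE
  have hEc : ∀ i, (E i).card * 2 ^ R ≤ G ^ R := by
    intro i
    refine card_majority_mul_le (noisy m x τ i) ?_ R
    have h1 := card_noisy_mul_le m hk x hS i
    have h2 : ((noisy m x τ i).card * 2 ^ m : ℕ) ≤ 2 * k * G := by exact_mod_cast h1
    have h3 : (noisy m x τ i).card * (64 * k) ≤ 2 * k * G :=
      (Nat.mul_le_mul_left _ hm).trans h2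
    refine Nat.le_of_mul_le_mul_left (?_ : 2 * k * _ ≤ 2 * k * G) (by positivity)
    calc 2 * k * ((noisy m x τ i).card * 32) = (noisy m x τ i).card * (64 * k) := by ring
      _ ≤ _ := h3
  set L : (Fin R → Mat m n) → Finset (Index n) := fun A => Finset.univ.filter fun i =>
    R ≤ 2 * tally (candidates (family A) m x) (R * 2 ^ m) i with hL
  have hLc : ∀ A, (L A).card ≤ 2 * 2 ^ m := by
    intro A
    rw [← Finset.length_toList]
    exact length_le_of_tally hR (Finset.nodup_toList _) fun i hi =>
      (Finset.mem_filter.1 (Finset.mem_toList.1 hi)).2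
  have hsub : (Finset.univ.filter fun V : (Fin R → Mat m n) × (Fin R → Mat m n) =>
      ¬ Separated R m x S τ (family V.1) (family V.2)) ⊆
      S.biUnion (fun i => E i ×ˢ Finset.univ) ∪
        Finset.univ.biUnion fun A => (L A).biUnion fun i => {A} ×ˢ E i := by
    rintro ⟨A, A'⟩ hV
    have hV := (Finset.mem_filter.1 hV).2
    simp only [Separated, crowding_family, not_and_or, not_forall, not_lt] at hV
    rw [Finset.mem_union]
    rcases hV with ⟨i, hi, h⟩ | ⟨i, hi, h⟩
    · exact Or.inl (Finset.mem_biUnion.2 ⟨i, hi, by simpa [hE] using h⟩)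
    · exact Or.inr (Finset.mem_biUnion.2 ⟨A, Finset.mem_univ _, Finset.mem_biUnion.2
        ⟨i, by simpa [hL] using hi, by simpa [hE] using h⟩⟩)
  have hGR : (Finset.univ : Finset (Fin R → Mat m n)).card = G ^ R := by
    rw [Finset.card_univ, Fintype.card_fun, Fintype.card_fin]
  have h1 : (S.biUnion fun i => E i ×ˢ (Finset.univ : Finset (Fin R → Mat m n))).card * 2 ^ R ≤
      k * G ^ (R + R) := by
    refine (Nat.mul_le_mul_right _ Finset.card_biUnion_le).trans ?_
    rw [Finset.sum_mul, ← hS, ← smul_eq_mul]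
    refine Finset.sum_le_card_nsmul _ _ _ fun i _ => ?_
    rw [Finset.card_product, hGR, mul_right_comm, pow_add]
    exact Nat.mul_le_mul_right _ (hEc i)
  have h2 : (Finset.univ.biUnion fun A => (L A).biUnion fun i =>
      ({A} ×ˢ E i : Finset ((Fin R → Mat m n) × (Fin R → Mat m n)))).card * 2 ^ R ≤
      2 * 2 ^ m * G ^ (R + R) := by
    refine (Nat.mul_le_mul_right _ Finset.card_biUnion_le).trans ?_
    rw [Finset.sum_mul, pow_add, mul_left_comm, ← hGR, ← smul_eq_mul]
    refine Finset.sum_le_card_nsmul _ _ _ fun A _ => ?_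
    refine (Nat.mul_le_mul_right _ Finset.card_biUnion_le).trans ?_
    rw [Finset.sum_mul, hGR]
    refine le_trans ?_ (Nat.mul_le_mul_right _ (hLc A))
    rw [← smul_eq_mul]
    refine Finset.sum_le_card_nsmul _ _ _ fun i _ => ?_
    rw [Finset.card_product, Finset.card_singleton, one_mul]
    exact hEc i
  have h3 := (Nat.mul_le_mul_right (2 ^ R) ((Finset.card_le_card hsub).trans
    (Finset.card_union_le _ _)))
  rw [add_mul] at h3
  have h4 : k * G ^ (R + R) ≤ 2 ^ m * G ^ (R + R) := Nat.mul_le_mul_right _ (by omega)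
  calc _ ≤ _ := h3
    _ ≤ 2 ^ m * G ^ (R + R) + 2 * 2 ^ m * G ^ (R + R) := add_le_add (h1.trans h4) h2
    _ = _ := by ring

/-! ### Coin tosses -/

instance : IsProbabilityMeasure coinLaw := by
  unfold coinLaw
  infer_instance

theorem coinLaw_agree (Q : ℕ) (ω₀ : ℕ → Bool) :
    coinLaw.real {ω | ∀ q < Q, ω q = ω₀ q} = (1 / 2) ^ Q := by
  have h : {ω : ℕ → Bool | ∀ q < Q, ω q = ω₀ q} =
      Set.pi (Finset.range Q) fun q => {ω₀ q} := by
    ext ω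
    simp [Set.mem_pi]
  rw [measureReal_def, h, coinLaw, Measure.infinitePi_pi _ fun _ _ => measurableSet_singleton _]
  simp [PMF.uniformOfFintype_apply]

/-- The probability of an event that is determined by the first `Q` coin tosses. -/
theorem coinLaw_preimage_le {α : Type*} {Q : ℕ} (g : (ℕ → Bool) → α)
    (hg : ∀ ω ω', g ω = g ω' → ∀ q < Q, ω q = ω' q) (F : Finset α) :
    coinLaw.real {ω | g ω ∈ F} ≤ F.card * (1 / 2) ^ Q := by
  have h1 : {ω | g ω ∈ F} = ⋃ a ∈ F, {ω | g ω = a} := by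
    ext ω
    simp
  rw [h1, ← nsmul_eq_mul]
  refine (measureReal_biUnion_finset_le _ _).trans (Finset.sum_le_card_nsmul _ _ _ fun a _ => ?_)
  by_cases ha : ∃ ω₀, g ω₀ = a
  · obtain ⟨ω₀, rfl⟩ := ha
    rw [← coinLaw_agree Q ω₀]
    exact measureReal_mono fun ω hω => hg ω ω₀ hω
  · have : {ω | g ω = a} = ∅ := by
      ext ω
      simpa using fun h => ha ⟨ω, h⟩
    rw [this]
    simp

/-- The matrices that are drawn with a sequence of coin tosses. -/
def drawn (R m n : ℕ) (ω : ℕ → Bool) (ρ₀ : ℕ) : Fin R → Mat m n := fun ρ r j =>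
  if ω (((ρ₀ + ρ) * m + r) * n + j) then 1 else 0

/-- The entries of the two families use each of the first `(R + R) * m * n` coins, so the families
determine these coins. This is the hypothesis of `coinLaw_preimage_le`, which turns counting pairs
of families into a bound on probabilities. -/
theorem agree_of_drawn_eq {R m : ℕ} {ω ω' : ℕ → Bool}
    (h : (drawn R m n ω 0, drawn R m n ω R) = (drawn R m n ω' 0, drawn R m n ω' R)) :
    ∀ q < (R + R) * m * n, ω q = ω' q := by
  intro q hq
  have hn : 0 < n := Nat.pos_of_ne_zero (by rintro rfl; simp at hq)
  have hm : 0 < m := Nat.pos_of_ne_zero (by rintro rfl; simp at hq)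
  obtain ⟨h1, h2⟩ := Prod.mk.inj h
  have hρ : q / n / m < R + R := by
    rw [Nat.div_div_eq_div_mul]
    refine Nat.div_lt_of_lt_mul (hq.trans_eq ?_)
    ring
  have key : ∀ ρ₀ ρ : ℕ, ρ < R → ρ₀ + ρ = q / n / m →
      drawn R m n ω ρ₀ = drawn R m n ω' ρ₀ → ω q = ω' q := by
    intro ρ₀ ρ hρR he hd
    have h3 := congrFun (congrFun (congrFun hd ⟨ρ, hρR⟩) ⟨q / n % m, Nat.mod_lt _ hm⟩)
      ⟨q % n, Nat.mod_lt _ hn⟩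
    have h4 : (q / n / m * m + q / n % m) * n + q % n = q := by
      rw [Nat.div_add_mod', Nat.div_add_mod']
    simp only [drawn, he, h4] at h3
    cases hω : ω q <;> cases hω' : ω' q <;> simp_all
  by_cases hlt : q / n / m < R
  · exact key 0 _ hlt (by omega) h1
  · exact key R (q / n / m - R) (by omega) (by omega) h2

/-- With high probability the important coefficients are in quiet buckets. -/
theorem le_coinLaw_separated {R m k h : ℕ} (hR : 0 < R) (hk : 0 < k) (hm : 64 * k ≤ 2 ^ m)
    (hRh : m + 2 + h ≤ R) {η : ℝ} (hη : 1 ≤ η * 2 ^ h) (x : Index n → ℝ) {S : Finset (Index n)}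
    (hS : S.card = k) :
    1 - η ≤ coinLaw.real {ω | Separated R m x S ((∑ i ∈ Sᶜ, |x i|) / k)
      (family (drawn R m n ω 0)) (family (drawn R m n ω R))} := by
  classical
  set τ := (∑ i ∈ Sᶜ, |x i|) / k with hτ
  set F := Finset.univ.filter fun V : (Fin R → Mat m n) × (Fin R → Mat m n) =>
      ¬ Separated R m x S τ (family V.1) (family V.2) with hF
  set good := {ω | Separated R m x S τ (family (drawn R m n ω 0))
    (family (drawn R m n ω R))} with hgood
  have h1 : coinLaw.real goodᶜ ≤ F.card * (1 / 2) ^ ((R + R) * m * n) := by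
    refine (measureReal_mono fun ω hω => ?_).trans (coinLaw_preimage_le
      (fun ω => (drawn R m n ω 0, drawn R m n ω R)) (fun ω ω' => agree_of_drawn_eq) F)
    exact Finset.mem_filter.2 ⟨Finset.mem_univ _, hω⟩
  -- Only subadditivity is invoked here, so no measurability of the event has to be shown.
  have h2 : 1 ≤ coinLaw.real good + coinLaw.real goodᶜ := by
    have := measureReal_union_le (μ := coinLaw) good goodᶜ
    rwa [Set.union_compl_self, probReal_univ] at this
  have h3 : (F.card : ℝ) * 2 ^ R ≤ 3 * 2 ^ m * 2 ^ ((R + R) * m * n) := by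
    have := card_not_separated_mul_le hR hk hm x hS
    rw [card_mat, ← pow_mul, ← hτ, ← hF, show n * m * (R + R) = (R + R) * m * n by ring] at this
    exact_mod_cast this
  -- The `2` in `m + 2 + h ≤ R` supplies a factor `4`, which beats the `3` of the union bound.
  have h4 : (4 : ℝ) * 2 ^ m * 2 ^ h ≤ 2 ^ R := by
    rw [show (4 : ℝ) = 2 ^ 2 by norm_num, ← pow_add, ← pow_add]
    exact pow_le_pow_right₀ (by norm_num) (by omega)
  have h5 : (F.card : ℝ) * (1 / 2) ^ ((R + R) * m * n) ≤ η := by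
    rw [one_div, inv_pow, ← div_eq_mul_inv, div_le_iff₀ (by positivity)]
    refine le_of_mul_le_mul_right (h3.trans ?_) (by positivity : (0 : ℝ) < 2 ^ R)
    have hη0 : 0 < η := by
      by_contra hn
      have : η * 2 ^ h ≤ 0 := mul_nonpos_of_nonpos_of_nonneg (not_lt.1 hn) (by positivity)
      linarith
    have h6 : (3 : ℝ) * 2 ^ m ≤ η * 2 ^ R :=
      calc (3 : ℝ) * 2 ^ m ≤ 4 * 2 ^ m * (η * 2 ^ h) := by
            have : (0 : ℝ) < 2 ^ m := by positivity
            nlinarith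
        _ = η * (4 * 2 ^ m * 2 ^ h) := by ring
        _ ≤ _ := mul_le_mul_of_nonneg_left h4 hη0.le
    calc _ ≤ η * 2 ^ R * 2 ^ ((R + R) * m * n) :=
          mul_le_mul_of_nonneg_right h6 (by positivity)
      _ = _ := by ring
  linarith

/-! ### The algorithm -/

/-- There are no coin tosses. -/
def Cmd.coinFree : Cmd → Prop
  | .coin _ _ => False
  | .seq c d => c.coinFree ∧ d.coinFree
  | .ite _ c d => c.coinFree ∧ d.coinFree
  | .loop _ c => c.coinFree
  | _ => True

theorem Exec.coins_eq {y : Index n → ℝ} {ω : ℕ → Bool} {c : Cmd} {s s' : State n}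
    (h : Exec y ω c s s') (hc : c.coinFree) : s'.coins = s.coins := by
  induction h with
  | skip | nset | rset | query => rfl
  | coin => exact hc.elim
  | seq _ _ ih₁ ih₂ => exact (ih₂ hc.2).trans (ih₁ hc.1)
  | iteTrue _ _ ih => exact ih hc.1
  | iteFalse _ _ ih => exact ih hc.2
  | loopDone => rfl
  | loopStep _ _ _ ih₁ ih₂ => exact (ih₂ hc).trans (ih₁ hc)

/-- `Frame` says nothing about coins, and sampling has to start with coin `0` for entry `q` to be
coin `q`. -/
theorem WP.and_coins {y : Index n → ℝ} {ω : ℕ → Bool} {c : Cmd} {s : State n}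
    {Q : State n → Prop} (h : WP y ω c s Q) (hc : c.coinFree) :
    WP y ω c s fun s' => Q s' ∧ s'.coins = s.coins :=
  let ⟨s', h₁, h₂⟩ := h
  ⟨s', h₁, h₂, h₁.coins_eq hc⟩

/-- Collect the data. -/
def collectCmd : Cmd := bucketCmd ;; repsCmd ;; identityCmd ;; sampleCmd ;; measureCmd

/-- Evaluate the data. -/
def evaluateCmd : Cmd := walshCmd ;; identifyCmd ;; estimateAllCmd ;; outputCmd

/-- The recovery algorithm. -/
def recoverCmd : Cmd := .seq collectCmd evaluateCmd

/-- The answers are confined to `rData`: rescaling writes them back to the same array, and the only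
test on real numbers during collection reads `rTmp`. -/
theorem isNonadaptive_recoverCmd (s₀ : State n) (X : Set (Index n → ℝ)) :
    IsNonadaptive recoverCmd s₀ X := by
  refine isNonadaptive_seq (H := [rData]) ?_ ?_ s₀ X
  · simp [collectCmd, bucketCmd, repsCmd, identityCmd, sampleCmd, measureCmd, entryCmd, tableCmd,
      sumCmd, askCmd, askOneCmd, shiftCmd, Cmd.for, Cmd.confines, BExp.avoids, RExp.avoids]
  · simp [evaluateCmd, walshCmd, butterflyCmd, identifyCmd, recordCmd, decodeCmd, estimateAllCmd,
      estimateCmd, hashCmd, outputCmd, sortCmd, mergeCmd, pickCmd, Cmd.for, Cmd.queryFree]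

/-- The matrix of the identity map. -/
def identityMatrix (r j : ℕ) : ℕ := if r = j then 1 else 0

/-- The hash functions that are used with the coin tosses `ω`: `2 ^ e` functions with values below
`2 ^ m` for identification and as many for estimation. -/
def Sketch (n k : ℕ) (η : ℝ) (ω : ℕ → Bool) (m e : ℕ) (A A' : ℕ → ℕ → ℕ → ℕ) : Prop :=
  (m = Nat.clog 2 k + 6 ∧ e = Nat.clog 2 (minReps k η) ∧ 2 ^ e ≤ 2 ^ n ∧
    A = family (drawn (2 ^ e) m n ω 0) ∧ A' = family (drawn (2 ^ e) m n ω (2 ^ e))) ∨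
  (m = n ∧ e = 0 ∧ 2 ^ n < 2 ^ Nat.clog 2 (minReps k η) ∧
    A = (fun _ => identityMatrix) ∧ A' = fun _ => identityMatrix)

/-- The parameters are given and the rest of the memory is empty. -/
structure Initial (k : ℕ) (η : ℝ) (s : State n) : Prop where
  sparsity : s.nat 0 0 = k
  dim : s.nat 0 1 = n
  eta : s.real 0 0 = η
  nat : ∀ a, a ≠ 0 → s.nat a = 0
  real : ∀ a, a ≠ 0 → s.real a = 0
  time : s.time = 0
  coins : s.coins = 0

/-- The memory holds the hash matrices and, for each repetition, the vectors with the data `D` of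
the hash function. -/
structure Collected (m R : ℕ) (A A' : ℕ → ℕ → ℕ → ℕ) (D : (ℕ → ℕ → ℕ) → ℕ → ℕ → ℝ)
    (s : State n) : Prop where
  rows : s.nat aM 0 = m
  buckets : s.nat aB 0 = 2 ^ m
  reps : s.nat aR 0 = R
  half : s.nat aHalf 0 = R / 2
  out : s.nat aOut 0 = (R + R) * (n + 1) * 2 ^ m
  mat : ∀ ρ < R, ∀ r < m, ∀ j < n, s.nat aMat (((R + ρ) * m + r) * n + j) = A' ρ r j
  data : ∀ ρ < R, ∀ t < n + 1, ∀ w < 2 ^ m,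
    s.real rData ((ρ * (n + 1) + t) * 2 ^ m + w) = D (A ρ) t w
  data' : ∀ ρ < R, ∀ t < n + 1, ∀ w < 2 ^ m,
    s.real rData (((R + ρ) * (n + 1) + t) * 2 ^ m + w) = D (A' ρ) t w

/-- The cost of collecting data. -/
def collectCost (n k N m R B : ℕ) : ℕ :=
  (40 * Nat.clog 2 k + 40) + 100 * N + (40 * n + 100) +
    ((R + R) * (m * (n * 60 + 40) + 40) + 40) +
    ((R + R) * (m * (B * (n * 60 + 40) + 60) + (n + 1) * (B * (n + 100) + 50) + 120) + 30)

theorem entry_family {ω : ℕ → Bool} {R m ρ₀ ρ r j : ℕ} (hρ : ρ < R) (hr : r < m) (hj : j < n) :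
    entry ω n m 0 (((ρ₀ + ρ) * m + r) * n + j) = family (drawn R m n ω ρ₀) ρ r j := by
  simp only [entry, family, entries, digit, drawn, hρ, hr, hj, dif_pos, lt_irrefl, if_false]
  split_ifs <;> rfl

theorem flat_lt {N ρ t w a b : ℕ} (hρ : ρ < N) (ht : t < a) (hw : w < b) :
    (ρ * a + t) * b + w < N * a * b :=
  calc (ρ * a + t) * b + w < (ρ * a + t + 1) * b := by rw [add_mul (ρ * a + t) 1]; omega
    _ ≤ ((ρ + 1) * a) * b := Nat.mul_le_mul_right _ (by rw [add_mul]; omega)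
    _ ≤ _ := Nat.mul_le_mul_right _ (Nat.mul_le_mul_right _ hρ)

theorem WP_collectCmd {x : Index n → ℝ} {ω : ℕ → Bool} {s : State n} {k : ℕ} {η : ℝ} (hη : 0 < η)
    (h : Initial k η s) :
    WP (dht x) ω collectCmd s fun s' => ∃ m e A A', Sketch n k η ω m e A A' ∧
      s'.time ≤ collectCost n k (minReps k η) m (2 ^ e) (2 ^ m) ∧
      Collected m (2 ^ e) A A' (fun M t w => √(2 ^ n) / 2 ^ m * dht x (point n M m t w)) s' := by
  simp only [collectCmd, WP_seq]
  refine ((WP_bucketCmd h.sparsity).and_coins (by simp [bucketCmd, Cmd.coinFree])).mono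
    fun s₁ hF₁ ⟨⟨ht₁, hm₁, hB₁⟩, hc₁⟩ => ?_
  refine ((WP_repsCmd hη hm₁ (by rw [hF₁.real 0 (by decide), h.eta])).and_coins
    (by simp [repsCmd, Cmd.coinFree])).mono
    fun s₂ hF₂ ⟨⟨ht₂, e₀, he₀, hR₂, hH₂, hE₂⟩, hc₂⟩ => ?_
  -- The `8` in `minReps` is the `6` of `m = Nat.clog 2 k + 6` plus the `2` required in
  -- `le_coinLaw_separated`.
  have hN : Nat.clog 2 k + 6 + 2 + halvings η = minReps k η := rfl
  rw [hN] at ht₂ he₀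
  have hn₂ : s₂.nat 0 1 = n := by
    rw [hF₂.nat 0 (by decide), hF₁.nat 0 (by decide), h.dim]
  refine ((WP_identityCmd (m := Nat.clog 2 k + 6) hn₂ (by rw [hF₂.nat aM (by decide), hm₁])
    (by rw [hF₂.nat aB (by decide), hB₁]) hE₂ hR₂ hH₂).and_coins
    (by simp [identityCmd, Cmd.for, Cmd.coinFree])).mono
    fun s₃ hF₃ ⟨⟨ht₃, m, e, hId, hm₃, hB₃, hE₃, hR₃, hH₃, hS₃⟩, hc₃⟩ => ?_
  have hn₃ : s₃.nat 0 1 = n := by rw [hF₃.nat 0 (by decide), hn₂]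
  have hc : s₃.coins = 0 := by rw [hc₃, hc₂, hc₁, h.coins]
  refine (WP_sampleCmd (f := s₃.nat aId 0) hn₃ hm₃ hR₃ rfl hc).mono
    fun s₄ hF₄ ⟨ht₄, hM₄⟩ => ?_
  have hn₄ : s₄.nat 0 1 = n := by rw [hF₄.nat 0 (by decide), hn₃]
  set R := 2 ^ e with hR
  obtain ⟨A, A', hSk, hA, hA'⟩ : ∃ A A', Sketch n k η ω m e A A' ∧
      (∀ ρ < R, ∀ r < m, ∀ j < n, s₄.nat aMat ((ρ * m + r) * n + j) = A ρ r j) ∧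
      ∀ ρ < R, ∀ r < m, ∀ j < n, s₄.nat aMat (((R + ρ) * m + r) * n + j) = A' ρ r j := by
    rcases hId with ⟨hId, rfl, rfl, hle⟩ | ⟨hId, rfl, rfl, hlt⟩
    · refine ⟨_, _, Or.inl ⟨rfl, he₀, hle, rfl, rfl⟩, fun ρ hρ r hr j hj => ?_,
        fun ρ hρ r hr j hj => ?_⟩
      · rw [hM₄ _ (flat_lt (by omega) hr hj), hId, ← entry_family hρ hr hj, zero_add]
      · rw [hM₄ _ (flat_lt (by omega) hr hj), hId, ← entry_family hρ hr hj]
    · rw [he₀] at hlt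
      refine ⟨_, _, Or.inr ⟨rfl, rfl, hlt, rfl, rfl⟩, fun ρ hρ r hr j hj => ?_,
        fun ρ hρ r hr j hj => ?_⟩ <;>
      · rw [hM₄ _ (flat_lt (by omega) hr hj), hId, entry, if_pos one_pos]
        obtain ⟨h1, -, h3⟩ := flat_div_mod hr hj
        rw [h1, h3]
        rfl
  have hcases : ∀ ρ < R + R, ρ < R ∨ ∃ ρ', ρ' < R ∧ ρ = R + ρ' := fun ρ hρ =>
    (lt_or_ge ρ R).imp_right fun h => ⟨ρ - R, by omega, by omega⟩
  set M : ℕ → ℕ → ℕ → ℕ := fun ρ => if ρ < R then A ρ else A' (ρ - R) with hM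
  have hM1 : ∀ ρ < R, M ρ = A ρ := fun ρ hρ => if_pos hρ
  have hM2 : ∀ ρ, M (R + ρ) = A' ρ := fun ρ => by simp [hM]
  refine (WP_measureCmd (m := m) (R := R) (M := M) (c := √(2 ^ n) / 2 ^ m)
    (D := fun q => √(2 ^ n) / 2 ^ m *
      dht x (point n (M (q / 2 ^ m / (n + 1))) m (q / 2 ^ m % (n + 1)) (q % 2 ^ m)))
    hn₄ (by rw [hF₄.nat aM (by decide), hm₃]) (by rw [hF₄.nat aB (by decide), hB₃])
    (by rw [hF₄.nat aR (by decide), hR₃]) (by rw [hF₄.real rScale (by decide), hS₃])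
    ?_ ?_ ?_).mono fun s₅ hF₅ ⟨ht₅, hO₅, hD₅⟩ => ?_
  · intro ρ hρ r hr j hj
    rcases hcases ρ hρ with h | ⟨ρ', h, rfl⟩
    · rw [hM1 ρ h, hA ρ h r hr j hj]
    · rw [hM2, hA' ρ' h r hr j hj]
  · intro q _
    rw [hF₄.nat aVec (by decide), hF₃.nat aVec (by decide), hF₂.nat aVec (by decide),
      hF₁.nat aVec (by decide), h.nat aVec (by norm_num)]
    rfl
  · intro ρ _ t ht w hw
    obtain ⟨h1, h2, h3⟩ := flat_div_mod (ρ := ρ) ht hw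
    rw [h1, h2, h3]
  · have hdata : ∀ ρ < R + R, ∀ t < n + 1, ∀ w < 2 ^ m,
        s₅.real rData ((ρ * (n + 1) + t) * 2 ^ m + w) =
          √(2 ^ n) / 2 ^ m * dht x (point n (M ρ) m t w) := by
      intro ρ hρ t ht w hw
      obtain ⟨h1, h2, h3⟩ := flat_div_mod (ρ := ρ) ht hw
      rw [hD₅ _ (flat_lt hρ ht hw), h1, h2, h3]
    refine ⟨m, e, A, A', hSk, ?_, ?_, ?_, ?_, ?_, hO₅, ?_, ?_, ?_⟩
    · have := h.time
      rw [collectCost, ← hR]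
      omega
    · rw [hF₅.nat aM (by decide), hF₄.nat aM (by decide), hm₃]
    · rw [hF₅.nat aB (by decide), hF₄.nat aB (by decide), hB₃]
    · rw [hF₅.nat aR (by decide), hF₄.nat aR (by decide), hR₃]
    · rw [hF₅.nat aHalf (by decide), hF₄.nat aHalf (by decide), hH₃]
    · intro ρ hρ r hr j hj
      rw [hF₅.nat aMat (by decide), hA' ρ hρ r hr j hj]
    · intro ρ hρ t ht w hw
      rw [hdata ρ (by omega) t ht w hw, hM1 ρ hρ]
    · intro ρ hρ t ht w hw
      rw [hdata (R + ρ) (by omega) t ht w hw, hM2]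

/-- The cost of evaluating data. -/
def evaluateCost (n k m e R B : ℕ) : ℕ :=
  (m * ((R + R) * (n + 1) * B * 100 + 60) + 40) +
    (R * (B * (n * 80 + 160) + 50) + n * 30 + 100) +
    (R * (m * 30 + 40) + 2 * B * (R * (m * (n * 50 + 60) + 140) + e * (R * 160 + 60) + 240) + 60) +
    (B * 2 * 30 + (m + 1) * (B * 2 * 160 + 60) + k * (n * 30 + 100) + 140)

theorem WP_evaluateCmd {y : Index n → ℝ} {x : Index n → ℝ} {ω : ℕ → Bool} {s : State n}
    {k m e : ℕ} {A A' : ℕ → ℕ → ℕ → ℕ} (hk : s.nat 0 0 = k) (hn : s.nat 0 1 = n)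
    (hkm : k ≤ 2 ^ m) (hA' : ∀ ρ r j, A' ρ r j < 2)
    (h : Collected m (2 ^ e) A A'
      (fun M t w => √(2 ^ n) / 2 ^ m * dht x (point n M m t w)) s)
    (hseen : s.nat aSeen = 0) (hlisted : s.nat aListed = 0) (hMed : s.real rMed = 0)
    (hMag : s.real rMag = 0) :
    WP y ω evaluateCmd s fun s' =>
      s'.time ≤ s.time + evaluateCost n k m e (2 ^ e) (2 ^ m) ∧
      ∃ (l : List (Index n)) (med : ℕ → ℝ) (sel : ℕ → ℕ), l.Nodup ∧
        (∀ i, i ∈ l ↔ 2 ^ e ≤ 2 * tally (candidates A m x) (2 ^ e * 2 ^ m) i) ∧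
        IsTop (fun p => |med p|) (2 ^ (m + 1)) k sel ∧ (∀ p, l.length ≤ p → med p = 0) ∧
        (∀ (p : ℕ) (hp : p < l.length),
          IsMedian (fun ρ => bucket (A' ρ) m x 0 (hash (A' ρ) l[p] m)) (2 ^ e) (med p)) ∧
        s'.output = selected l med sel k := by
  have hR0 : 0 < 2 ^ e := by positivity
  set R := 2 ^ e with hR
  simp only [evaluateCmd, WP_seq]
  refine (WP_walshCmd (N := (R + R) * (n + 1)) h.rows h.out).mono fun s₁ hF₁ ⟨ht₁, hW₁⟩ => ?_
  have hbucket : ∀ (ρ : ℕ) (M : ℕ → ℕ → ℕ), ρ < R + R → (∀ t < n + 1, ∀ w < 2 ^ m,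
      s.real rData ((ρ * (n + 1) + t) * 2 ^ m + w) =
        √(2 ^ n) / 2 ^ m * dht x (point n M m t w)) → ∀ t < n + 1, ∀ z < 2 ^ m,
      s₁.real rData ((ρ * (n + 1) + t) * 2 ^ m + z) = bucket M m x t z := by
    intro ρ M hρ hD t ht z hz
    rw [hW₁ _ (flat_lt hρ ht hz), walshBlocks_block _ _ _ hz, ← walsh_dht M x m t hz]
    exact walsh_congr (fun w hw => hD t ht w hw) z
  have hn₁ : s₁.nat 0 1 = n := by rw [hF₁.nat 0 (by decide), hn]
  have hB₁ : s₁.nat aB 0 = 2 ^ m := by rw [hF₁.nat aB (by decide), h.buckets]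
  have hR₁ : s₁.nat aR 0 = R := by rw [hF₁.nat aR (by decide), h.reps]
  refine (WP_identifyCmd (c := candidates A m x) hn₁ hB₁ hR₁ hR0
    (by rw [hF₁.nat aSeen (by decide), hseen]) (by rw [hF₁.nat aListed (by decide), hlisted])
    fun ρ hρ z hz => ?_).mono fun s₂ hF₂ ⟨ht₂, hSt₂, hBa₂, l, hl₂⟩ => ?_
  · rw [candidates, mul_comm ρ, Nat.mul_add_div (by positivity), Nat.div_eq_of_lt hz,
      Nat.mul_add_mod, Nat.mod_eq_of_lt hz, add_zero, decode_eq_candidate]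
    exact fun t ht => hbucket ρ (A ρ) (by omega) (h.data ρ hρ) t ht z hz
  have hn₂ : s₂.nat 0 1 = n := by rw [hF₂.nat 0 (by decide), hn₁]
  refine (WP_estimateAllCmd (m := m) (e := e) (M := A') hn₂
    (by rw [hF₂.nat aM (by decide), hF₁.nat aM (by decide), h.rows])
    (by rw [hF₂.nat aR (by decide), hR₁])
    (by rw [hF₂.nat aHalf (by decide), hF₁.nat aHalf (by decide), h.half]) hBa₂ hSt₂
    (fun ρ hρ r hr j hj => by
      rw [hF₂.nat aMat (by decide), hF₁.nat aMat (by decide), h.mat ρ hρ r hr j hj])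
    hA' hl₂.stored (by rw [hF₂.real rMed (by decide), hF₁.real rMed (by decide), hMed])
    (by rw [hF₂.real rMag (by decide), hF₁.real rMag (by decide), hMag])).mono
    fun s₃ hF₃ ⟨ht₃, hE₃⟩ => ?_
  have hl₃ : Stored l s₃ :=
    ⟨by rw [hF₃.nat aLen (by decide), hl₂.stored.len],
      by rw [hF₃.nat aEnd (by decide), hl₂.stored.fin],
      by rw [hF₃.nat aAddr (by decide)]; exact hl₂.stored.addr,
      by rw [hF₃.nat aBits (by decide)]; exact hl₂.stored.bits⟩
  refine (WP_outputCmd (k := k) (m := m) (by rw [hF₃.nat 0 (by decide), hn₂])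
    (by rw [hF₃.nat 0 (by decide), hF₂.nat 0 (by decide), hF₁.nat 0 (by decide), hk]) hkm
    (by rw [hF₃.nat aB (by decide), hF₂.nat aB (by decide), hB₁]) hl₃ hE₃).mono
    fun s₄ hF₄ ⟨ht₄, _, sel, hsel, hout⟩ => ?_
  refine ⟨?_, l, s₃.real rMed, sel, hl₂.nodup, hl₂.mem, hsel, hE₃.rest, fun p hp => ?_, hout⟩
  · have hlen : l.length ≤ 2 * 2 ^ m :=
      length_le_of_tally hR0 hl₂.nodup fun i hi => (hl₂.mem i).1 hi
    have := Nat.mul_le_mul_right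
      (R * (m * (n * 50 + 60) + 140) + e * (R * 160 + 60) + 240) hlen
    rw [pow_succ] at ht₄
    rw [← hR] at ht₃
    rw [evaluateCost]
    omega
  · have hmed := hE₃.median p hp hp
    -- Estimation starts behind the `R` repetitions for identification and advances by a whole
    -- repetition of `n + 1` shifts, so it reads only the block with shift `0`.
    have hd : (fun ρ => s₂.real rData (R * (n + 1) * 2 ^ m + ρ * ((n + 1) * 2 ^ m) +
        hash (A' ρ) l[p] m)) = fun ρ => s₁.real rData (((R + ρ) * (n + 1) + 0) * 2 ^ m +
        hash (A' ρ) l[p] m) := by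
      funext ρ
      rw [hF₂.real rData (by decide)]
      congr 1
      ring
    rw [hd] at hmed
    have hcongr : ∀ q : ℝ → Prop, ∀ [DecidablePred q],
        ((Finset.range R).filter fun ρ => q (s₁.real rData (((R + ρ) * (n + 1) + 0) * 2 ^ m +
          hash (A' ρ) l[p] m))) =
        (Finset.range R).filter fun ρ => q (bucket (A' ρ) m x 0 (hash (A' ρ) l[p] m)) := by
      intro q _
      refine Finset.filter_congr fun ρ hρ => ?_
      rw [Finset.mem_range] at hρ
      rw [hbucket (R + ρ) (A' ρ) (by omega) (h.data' ρ hρ) 0 (by omega) _ (hash_lt _ _ _)]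
    rw [IsMedian, hcongr fun v => s₃.real rMed p ≤ v,
      hcongr fun v => v ≤ s₃.real rMed p] at hmed
    exact hmed

/-! ### Correctness -/

theorem le_two_pow_bucket (k : ℕ) : 64 * k ≤ 2 ^ (Nat.clog 2 k + 6) := by
  have := Nat.le_pow_clog (b := 2) (by norm_num) k
  rw [pow_add]
  omega

theorem Sketch.le {k m e : ℕ} {η : ℝ} {ω : ℕ → Bool} {A A' : ℕ → ℕ → ℕ → ℕ} (hk : k ≤ 2 ^ n)
    (h : Sketch n k η ω m e A A') : k ≤ 2 ^ m := by
  rcases h with ⟨rfl, -⟩ | ⟨rfl, -⟩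
  · have := le_two_pow_bucket k
    omega
  · exact hk

theorem Sketch.entry_lt {k m e : ℕ} {η : ℝ} {ω : ℕ → Bool} {A A' : ℕ → ℕ → ℕ → ℕ}
    (h : Sketch n k η ω m e A A') (ρ r j : ℕ) : A' ρ r j < 2 := by
  rcases h with ⟨-, -, -, -, rfl⟩ | ⟨-, -, -, -, rfl⟩
  · exact entries_lt _ _ _
  · simp only [identityMatrix]
    split_ifs <;> norm_num

/-- The output is the selection of the largest medians. -/
theorem WP_recoverCmd {k : ℕ} {η : ℝ} (hη : 0 < η) (hk : k ≤ 2 ^ n) {s : State n}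
    (h : Initial k η s) (x : Index n → ℝ) (ω : ℕ → Bool) :
    WP (dht x) ω recoverCmd s fun s' => ∃ m e A A', Sketch n k η ω m e A A' ∧
      s'.time ≤ collectCost n k (minReps k η) m (2 ^ e) (2 ^ m) +
        evaluateCost n k m e (2 ^ e) (2 ^ m) ∧
      ∃ (l : List (Index n)) (med : ℕ → ℝ) (sel : ℕ → ℕ), l.Nodup ∧
        (∀ i, i ∈ l ↔ 2 ^ e ≤ 2 * tally (candidates A m x) (2 ^ e * 2 ^ m) i) ∧
        IsTop (fun p => |med p|) (2 ^ (m + 1)) k sel ∧ (∀ p, l.length ≤ p → med p = 0) ∧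
        (∀ (p : ℕ) (hp : p < l.length),
          IsMedian (fun ρ => bucket (A' ρ) m x 0 (hash (A' ρ) l[p] m)) (2 ^ e) (med p)) ∧
        s'.output = selected l med sel k := by
  simp only [recoverCmd, WP_seq]
  refine (WP_collectCmd hη h).mono fun s₁ hF₁ ⟨m, e, A, A', hS, ht₁, hC⟩ => ?_
  refine (WP_evaluateCmd (k := k) (by rw [hF₁.nat 0 (by decide), h.sparsity])
    (by rw [hF₁.nat 0 (by decide), h.dim]) (hS.le hk) hS.entry_lt hC
    (by rw [hF₁.nat aSeen (by decide), h.nat aSeen (by norm_num)])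
    (by rw [hF₁.nat aListed (by decide), h.nat aListed (by norm_num)])
    (by rw [hF₁.real rMed (by decide), h.real rMed (by norm_num)])
    (by rw [hF₁.real rMag (by decide), h.real rMag (by norm_num)])).mono
    fun s₂ _ ⟨ht₂, hQ⟩ => ⟨m, e, A, A', hS, by omega, hQ⟩

theorem hashBit_identityMatrix (i : Index n) {r : ℕ} (hr : r < n) :
    hashBit identityMatrix i r = digit i r := by
  have h := digit_lt i r
  simp only [hashBit, identityMatrix, ite_mul, one_mul, zero_mul, Finset.sum_ite_eq,
    Finset.mem_range, hr, if_true]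
  exact Nat.mod_eq_of_lt h

/-- The hash bits are the digits themselves, so every bucket contains a single index. -/
theorem noise_identityMatrix (x : Index n → ℝ) (i : Index n) : noise identityMatrix n x i = 0 := by
  refine Finset.sum_eq_zero fun i' hi' => if_neg fun h => Finset.ne_of_mem_erase hi' ?_
  funext j
  have := hashBit_eq_of_hash_eq h j j.2
  rw [hashBit_identityMatrix _ j.2, hashBit_identityMatrix _ j.2] at this
  simp only [digit, j.2, dif_pos, Fin.eta] at this
  exact ZMod.val_injective 2 this

theorem separated_identityMatrix {R : ℕ} (hR : 0 < R) (x : Index n → ℝ) (S : Finset (Index n))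
    {τ : ℝ} (hτ : 0 ≤ τ) :
    Separated R n x S τ (fun _ => identityMatrix) fun _ => identityMatrix := by
  simp [Separated, crowding, noise_identityMatrix, hτ.not_gt, hR]

/-- Separation is a matter of chance only when the matrices are drawn; for the identity it always
holds. Both cases then share the same error bound. -/
theorem Sketch.l1_sub_le {k m e : ℕ} {η : ℝ} {ω : ℕ → Bool} {A A' : ℕ → ℕ → ℕ → ℕ}
    {x : Index n → ℝ} {S : Finset (Index n)} (hk : 0 < k) (hS : S.card = k)
    (h : Sketch n k η ω m e A A') (hsep : 2 ^ Nat.clog 2 (minReps k η) ≤ 2 ^ n →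
      Separated (2 ^ Nat.clog 2 (minReps k η)) (Nat.clog 2 k + 6) x S ((∑ i ∈ Sᶜ, |x i|) / k)
        (family (drawn (2 ^ Nat.clog 2 (minReps k η)) (Nat.clog 2 k + 6) n ω 0))
        (family (drawn (2 ^ Nat.clog 2 (minReps k η)) (Nat.clog 2 k + 6) n ω
          (2 ^ Nat.clog 2 (minReps k η)))))
    {l : List (Index n)} (hl : l.Nodup) {med : ℕ → ℝ} {sel : ℕ → ℕ}
    (hlR : ∀ i, i ∈ l ↔ 2 ^ e ≤ 2 * tally (candidates A m x) (2 ^ e * 2 ^ m) i)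
    (hsel : IsTop (fun p => |med p|) (2 ^ (m + 1)) k sel)
    (hrest : ∀ p, l.length ≤ p → med p = 0)
    (hmed : ∀ (p : ℕ) (hp : p < l.length),
      IsMedian (fun ρ => bucket (A' ρ) m x 0 (hash (A' ρ) l[p] m)) (2 ^ e) (med p)) :
    l1 (selected l med sel k - x) ≤ 4 * ∑ i ∈ Sᶜ, |x i| := by
  have hτ : 0 ≤ (∑ i ∈ Sᶜ, |x i|) / k :=
    div_nonneg (Finset.sum_nonneg fun i _ => abs_nonneg _) (by positivity)
  have hsep' : Separated (2 ^ e) m x S ((∑ i ∈ Sᶜ, |x i|) / k) A A' := by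
    rcases h with ⟨rfl, rfl, hle, rfl, rfl⟩ | ⟨rfl, rfl, -, rfl, rfl⟩
    · exact hsep hle
    · exact separated_identityMatrix (by norm_num) x S hτ
  exact l1_selected_sub_le_of_crowding hk hS hl hlR (by positivity) hsel hrest hmed hsep'.1
    fun i hi => hsep'.2 i ((hlR i).1 hi)

theorem IsHead.exists_sum {k : ℕ} {x h : Index n → ℝ} (hh : IsHead k x h) :
    ∃ S : Finset (Index n), S.card = k ∧ l1 (x - h) = ∑ i ∈ Sᶜ, |x i| := by
  obtain ⟨S, hS, -, h1, h2⟩ := hh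
  refine ⟨S, hS, ?_⟩
  rw [l1, ← Finset.sum_add_sum_compl S, Finset.sum_eq_zero fun i hi => ?_, zero_add]
  · refine Finset.sum_congr rfl fun i hi => ?_
    rw [Pi.sub_apply, h2 i (Finset.mem_compl.1 hi), sub_zero]
  · rw [Pi.sub_apply, h1 i hi, sub_self, abs_zero]

theorem l1_nonneg (x : Index n → ℝ) : 0 ≤ l1 x := Finset.sum_nonneg fun _ _ => abs_nonneg _

/-- Success contains the event of `le_coinLaw_separated`, on which the error is at most `4 * l1 (x -
h)`; the term with `ν` only weakens the claim. -/
theorem recovers_recoverCmd {k : ℕ} {η ν : ℝ} (hη : 0 < η) (hν : 0 ≤ ν) (hk0 : 0 < k)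
    (hk : k ≤ 2 ^ n) {s₀ : State n} (h₀ : Initial k η s₀) (X : Set (Index n → ℝ)) :
    Recovers recoverCmd s₀ X k η 4 ν := by
  refine ⟨fun x _ ω s hs => ?_, fun x _ h hh => ?_⟩
  · obtain ⟨s', hs', m, e, A, A', -, -, l, med, sel, -, -, -, -, -, hout⟩ :=
      WP_recoverCmd hη hk h₀ x ω
    rw [hs.deterministic hs', hout]
    exact isSparse_selected l med sel k
  · obtain ⟨S, hS, hσ⟩ := hh.exists_sum
    have hνx : 0 ≤ ν * l1 x := mul_nonneg hν (l1_nonneg x)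
    have key := le_coinLaw_separated (m := Nat.clog 2 k + 6)
      (R := 2 ^ Nat.clog 2 (minReps k η)) (h := halvings η) (by positivity) hk0
      (le_two_pow_bucket k) (Nat.le_pow_clog (by norm_num) _) (le_halvings hη) x hS
    refine key.trans (measureReal_mono fun ω hω => ?_)
    obtain ⟨s, hs, m, e, A, A', hsk, -, l, med, sel, hl, hlR, hsel, hrest, hmed, hout⟩ :=
      WP_recoverCmd hη hk h₀ x ω
    refine ⟨s, hs, ?_⟩
    rw [hout, hσ]
    have := hsk.l1_sub_le hk0 hS (fun _ => hω) hl hlR hsel hrest hmed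
    linarith

/-! ### Running time -/

/-- For drawn matrices `m ≤ n + 6 ≤ 7 * n`, and the factor `256` is `2` from rounding up the
repetitions times `128` from rounding up `64 * k`. For the identity the product is `2 ^ n`, which is
less than the discarded number of repetitions and hence at most `2 * minReps k η`. -/
theorem Sketch.bounds {k m e : ℕ} {η : ℝ} {ω : ℕ → Bool} {A A' : ℕ → ℕ → ℕ → ℕ} (hn : 1 ≤ n)
    (hk0 : 1 ≤ k) (hk : k ≤ 2 ^ n) (h : Sketch n k η ω m e A A') :
    m ≤ 7 * n ∧ e ≤ n ∧ 2 ^ e * 2 ^ m ≤ 256 * (k * minReps k η) := by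
  have hN : 1 ≤ minReps k η := by rw [minReps]; omega
  have hclog := (Nat.clog_le_iff_le_pow (by norm_num)).2 hk
  have h2 := two_pow_clog_le hN
  rcases h with ⟨rfl, rfl, hle, -, -⟩ | ⟨rfl, rfl, hlt, -, -⟩
  · refine ⟨by omega, (Nat.pow_le_pow_iff_right (by norm_num)).1 hle, ?_⟩
    have h1 := two_pow_clog_le hk0
    calc 2 ^ Nat.clog 2 (minReps k η) * 2 ^ (Nat.clog 2 k + 6)
        ≤ (2 * minReps k η) * (128 * k) := Nat.mul_le_mul h2 (by rw [pow_add]; omega)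
      _ = _ := by ring
  · refine ⟨by omega, by omega, ?_⟩
    have := Nat.mul_le_mul_right (minReps k η) hk0
    omega

/-- The costs are monotone in `m`, `e` and `k`, which may be replaced by `7 * n`, `n` and `B`. Apart
from `100 * N` and a multiple of `Nat.clog 2 k`, which is at most `n`, what remains consists of
monomials with degree at most `1` in `R` and `B` and at most `2` in `n`, all dominated by `R * B * n
^ 2`. -/
theorem cost_le {n k N m e R B : ℕ} (hn : 1 ≤ n) (hR : 1 ≤ R) (hB : 1 ≤ B) (hk : k ≤ B)
    (hclog : Nat.clog 2 k ≤ n) (hm : m ≤ 7 * n) (he : e ≤ n) :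
    collectCost n k N m R B + evaluateCost n k m e R B ≤ 100 * N + 20000 * (R * B * n ^ 2) := by
  have h : ∀ a b c, a ≤ R → b ≤ B → c ≤ n ^ 2 → a * b * c ≤ R * B * n ^ 2 :=
    fun a b c ha hb hc => Nat.mul_le_mul (Nat.mul_le_mul ha hb) hc
  have hn2 : n ≤ n ^ 2 := Nat.le_self_pow (by norm_num) n
  have h1 : 1 ≤ n ^ 2 := hn.trans hn2
  have h1 : collectCost n k N m R B + evaluateCost n k m e R B ≤
      collectCost n k N (7 * n) R B + evaluateCost n B (7 * n) n R B := by
    unfold collectCost evaluateCost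
    gcongr
  refine h1.trans ?_
  unfold collectCost evaluateCost
  have e1 := h R B (n ^ 2) le_rfl le_rfl le_rfl
  have e2 := h R B n le_rfl le_rfl hn2
  have e3 := h R B 1 le_rfl le_rfl (by omega)
  have e4 := h R 1 (n ^ 2) le_rfl hB le_rfl
  have e5 := h R 1 n le_rfl hB hn2
  have e6 := h R 1 1 le_rfl hB (by omega)
  have e7 := h 1 B (n ^ 2) hR le_rfl le_rfl
  have e8 := h 1 B n hR le_rfl hn2
  have e9 := h 1 B 1 hR le_rfl (by omega)
  have e10 := h 1 1 n hR hB hn2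
  have e11 := h 1 1 1 hR hB (by omega)
  nlinarith

theorem halvings_le {η : ℝ} : (halvings η : ℝ) ≤ 2 * lg (1 / η) := by
  have h1 : 1 ≤ lg (1 / η) := le_max_left _ _
  have h2 : Real.logb 2 (1 / η) ≤ lg (1 / η) := le_max_right _ _
  rw [halvings]
  rcases le_total 0 (Real.logb 2 (1 / η)) with h | h
  · have := Nat.ceil_lt_add_one h
    linarith
  · rw [Nat.ceil_eq_zero.2 h, Nat.cast_zero]
    linarith

/-- The case `k = 1` is separate because its logarithm vanishes; there `n ^ 2 ≥ 1` takes over. For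
`k ≥ 2` the logarithm is at least `1` and absorbs the constants: `12` is `1` for the logarithm, `9`
for `8` plus rounding, and `2` for `halvings`. -/
theorem mul_minReps_le {k : ℕ} {η : ℝ} (hn : 1 ≤ n) (hk : 1 ≤ k) :
    (k * minReps k η : ℝ) ≤ 12 * (lg (1 / η) * (k * Real.logb 2 k + n ^ 2)) := by
  have h1 : 1 ≤ lg (1 / η) := le_max_left _ _
  have h2 := halvings_le (η := η)
  have hn' : (1 : ℝ) ≤ (n : ℝ) ^ 2 := one_le_pow₀ (by exact_mod_cast hn)
  have hN : (minReps k η : ℝ) = Nat.clog 2 k + 8 + halvings η := by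
    rw [minReps]
    push_cast
    ring
  rcases hk.eq_or_lt with rfl | hk
  · rw [hN]
    simp only [Nat.clog_one_right, Nat.cast_zero, Nat.cast_one, Real.logb_one]
    nlinarith
  · have hk' : (2 : ℝ) ≤ k := by exact_mod_cast hk
    have hlog : 1 ≤ Real.logb 2 k := by
      rw [Real.le_logb_iff_rpow_le (by norm_num) (by positivity)]
      simpa using hk'
    have hclog : (Nat.clog 2 k : ℝ) ≤ Real.logb 2 k + 1 := by
      have := Nat.ceil_lt_add_one (zero_le_one.trans hlog)
      have h3 := Real.natCeil_logb_natCast 2 k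
      rw [Nat.cast_ofNat] at h3
      rw [h3] at this
      exact this.le
    have h4 : (minReps k η : ℝ) ≤ 12 * (lg (1 / η) * Real.logb 2 k) := by
      rw [hN]
      nlinarith
    calc (k * minReps k η : ℝ) ≤ k * (12 * (lg (1 / η) * Real.logb 2 k)) :=
          mul_le_mul_of_nonneg_left h4 (by positivity)
      _ = 12 * (lg (1 / η) * (k * Real.logb 2 k)) := by ring
      _ ≤ _ := by gcongr; linarith [sq_nonneg (n : ℝ)]

theorem RunsWithin.mono {P : Cmd} {s₀ : State n} {X : Set (Index n → ℝ)} {T T' : ℝ}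
    (h : RunsWithin P s₀ X T) (hT : T ≤ T') : RunsWithin P s₀ X T' := fun x hx ω =>
  let ⟨s, hs, ht⟩ := h x hx ω
  ⟨s, hs, ht.trans hT⟩

theorem runsWithin_recoverCmd {k : ℕ} {η : ℝ} (hη : 0 < η) (hn : 1 ≤ n) (hk0 : 1 ≤ k)
    (hk : k ≤ 2 ^ n) {s₀ : State n} (h₀ : Initial k η s₀) (X : Set (Index n → ℝ)) :
    RunsWithin recoverCmd s₀ X
      (10 ^ 8 * (lg (1 / η) * (k * Real.logb 2 k + n ^ 2) * n ^ 2)) := by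
  intro x _ ω
  obtain ⟨s, hs, m, e, A, A', hsk, ht, -⟩ := WP_recoverCmd hη hk h₀ x ω
  refine ⟨s, hs, ?_⟩
  obtain ⟨hm, he, hX⟩ := hsk.bounds hn hk0 hk
  have h1 := ht.trans (cost_le (N := minReps k η) hn Nat.one_le_two_pow Nat.one_le_two_pow
    (hsk.le hk) ((Nat.clog_le_iff_le_pow (by norm_num)).2 hk) hm he)
  have hn2 : 1 ≤ n ^ 2 := Nat.one_le_pow _ _ hn
  have h2 : minReps k η ≤ k * minReps k η * n ^ 2 :=
    calc minReps k η = 1 * minReps k η * 1 := by ring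
      _ ≤ _ := Nat.mul_le_mul (Nat.mul_le_mul_right _ hk0) hn2
  have h3 := Nat.mul_le_mul_right (n ^ 2) hX
  -- The constant comes from `100 + 20000 * 256 ≤ 8000000`; multiplied by the `12` of
  -- `mul_minReps_le` it stays below `10 ^ 8`.
  have h4 : s.time ≤ 8000000 * (k * minReps k η * n ^ 2) := by
    rw [mul_assoc 256] at h3
    omega
  have h5 := mul_minReps_le (n := n) (η := η) hn hk0
  calc (s.time : ℝ) ≤ 8000000 * (k * minReps k η * n ^ 2) := by exact_mod_cast h4
    _ ≤ 8000000 * (12 * (lg (1 / η) * (k * Real.logb 2 k + n ^ 2)) * n ^ 2) := by gcongr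
    _ = 96000000 * (lg (1 / η) * (k * Real.logb 2 k + n ^ 2) * n ^ 2) := by ring
    _ ≤ _ := by
      refine mul_le_mul_of_nonneg_right (by norm_num) ?_
      have : 0 ≤ Real.logb 2 k := Real.logb_nonneg (by norm_num) (by exact_mod_cast hk0)
      have : 0 ≤ lg (1 / η) := zero_le_one.trans (le_max_left _ _)
      positivity

theorem lg_mono {s t : ℝ} (hs : 0 < s) (h : s ≤ t) : lg s ≤ lg t :=
  max_le_max le_rfl (Real.logb_le_logb_of_le (by norm_num) hs h)

theorem one_le_lg (t : ℝ) : 1 ≤ lg t := le_max_left _ _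

theorem initial_init {k : ℕ} {η : ℝ} {u : List ℕ} {v : List ℝ} (hk : u.getD 0 0 = k)
    (hn : u.getD 1 0 = n) (hη : v.getD 0 0 = η) : Initial k η (State.init n u v) where
  sparsity := by simpa [State.init] using hk
  dim := by simpa [State.init] using hn
  eta := by simpa [State.init] using hη
  nat a ha := by funext i; simp [State.init, ha]
  real a ha := by funext i; simp [State.init, ha]
  time := rfl
  coins := rfl

theorem work_nonneg {k : ℕ} (hk : 1 ≤ k) : 0 ≤ (k : ℝ) * Real.logb 2 k + (n : ℝ) ^ 2 := by
  have : 0 ≤ Real.logb 2 k := Real.logb_nonneg (by norm_num) (by exact_mod_cast hk)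
  positivity

end SparseHadamard

end

/-! ### Comparison with the claimed running times. -/

theorem mainTheorem5 :
    ∃ c : ℝ, 0 < c ∧
      -- approximate recovery with relative error `ν`
      (∃ (P : SparseHadamard.Cmd) (C : ℝ), 0 < C ∧
        ∀ (n k : ℕ) (η ν : ℝ), 1 ≤ n → 1 ≤ k → k ≤ 2 ^ n → 0 < η → 0 < ν →
          SparseHadamard.RunsWithin P (SparseHadamard.State.init n [k, n] [η, ν]) Set.univ
            (C * (SparseHadamard.lg (SparseHadamard.lg (1 / ν) / η) * SparseHadamard.lg (1 / ν) *
              ((k : ℝ) * Real.logb 2 k + (n : ℝ) ^ 2) * (n : ℝ) ^ 2)) ∧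
          SparseHadamard.IsNonadaptive P (SparseHadamard.State.init n [k, n] [η, ν]) Set.univ ∧
          SparseHadamard.Recovers P (SparseHadamard.State.init n [k, n] [η, ν]) Set.univ k η c ν) ∧
      -- `ℓ₁/ℓ₁` recovery when each coefficient of the transform takes `O(n)` bits
      (∃ P : SparseHadamard.Cmd, ∀ a : ℕ,
        (∃ C : ℝ, 0 < C ∧
          ∀ (n k : ℕ) (η : ℝ), 1 ≤ n → 1 ≤ k → k ≤ 2 ^ n → 0 < η →
            SparseHadamard.RunsWithin P (SparseHadamard.State.init n [k, n, a] [η])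
              {x | SparseHadamard.IsFixedPoint (a * n) (SparseHadamard.dht x)}
              (C * (SparseHadamard.lg (n / η) *
                ((k : ℝ) * Real.logb 2 k + (n : ℝ) ^ 2) * (n : ℝ) ^ 3)) ∧
            SparseHadamard.IsNonadaptive P (SparseHadamard.State.init n [k, n, a] [η])
              {x | SparseHadamard.IsFixedPoint (a * n) (SparseHadamard.dht x)} ∧
            SparseHadamard.Recovers P (SparseHadamard.State.init n [k, n, a] [η])
              {x | SparseHadamard.IsFixedPoint (a * n) (SparseHadamard.dht x)} k η c 0) ∧
        -- the case `η = 1 / n ^ O(1)` and `k = Ω(n ^ 2)`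
        (∀ (d : ℕ) (δ : ℝ), 0 < δ → ∃ C : ℝ, 0 < C ∧
          ∀ (n k : ℕ) (η : ℝ), 2 ≤ n → 2 ≤ k → k ≤ 2 ^ n →
            δ * (n : ℝ) ^ 2 ≤ k → 1 / (n : ℝ) ^ d ≤ η →
            SparseHadamard.RunsWithin P (SparseHadamard.State.init n [k, n, a] [η])
              {x | SparseHadamard.IsFixedPoint (a * n) (SparseHadamard.dht x)}
              (C * ((k : ℝ) * (n : ℝ) ^ 3 * Real.logb 2 k * Real.logb 2 n)))) := by
  open SparseHadamard in
  -- One program witnesses both parts. In the last constant, `d + 1` bounds `lg (1 / η)` in units of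
  -- `log₂ n`, and `1 + 1 / δ` bounds `k log₂ k + n ^ 2` in units of `k log₂ k`.
  refine ⟨4, by norm_num, ⟨recoverCmd, 10 ^ 8, by norm_num, fun n k η ν hn hk0 hk hη hν => ?_⟩,
    recoverCmd, fun a => ⟨⟨10 ^ 8, by norm_num, fun n k η hn hk0 hk hη => ?_⟩,
      fun d δ hδ => ⟨10 ^ 8 * ((d + 1) * (1 + 1 / δ)), by positivity,
        fun n k η hn hk0 hk hkδ hηd => ?_⟩⟩⟩
  · have h₀ : Initial k η (State.init n [k, n] [η, ν]) := initial_init rfl rfl rfl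
    refine ⟨(runsWithin_recoverCmd hη hn hk0 hk h₀ _).mono ?_, isNonadaptive_recoverCmd _ _,
      recovers_recoverCmd hη hν.le hk0 hk h₀ _⟩
    have h1 := one_le_lg (1 / ν)
    -- The running time proved involves only `lg (1 / η)`; since `lg (1 / ν) ≥ 1`, both factors with
    -- `ν` in the claim can only increase it.
    have h2 : lg (1 / η) ≤ lg (lg (1 / ν) / η) :=
      lg_mono (by positivity) (div_le_div_of_nonneg_right h1 hη.le)
    have h3 : lg (1 / η) * 1 ≤ lg (lg (1 / ν) / η) * lg (1 / ν) :=
      mul_le_mul h2 h1 zero_le_one (zero_le_one.trans (one_le_lg _))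
    rw [mul_one] at h3
    have h4 := work_nonneg (n := n) hk0
    gcongr
  · have h₀ : Initial k η (State.init n [k, n, a] [η]) := initial_init rfl rfl rfl
    refine ⟨(runsWithin_recoverCmd hη hn hk0 hk h₀ _).mono ?_, isNonadaptive_recoverCmd _ _,
      recovers_recoverCmd hη le_rfl hk0 hk h₀ _⟩
    have hn' : (1 : ℝ) ≤ n := by exact_mod_cast hn
    have h2 : lg (1 / η) ≤ lg (n / η) :=
      lg_mono (by positivity) (div_le_div_of_nonneg_right hn' hη.le)
    have h3 : (n : ℝ) ^ 2 ≤ n ^ 3 := pow_le_pow_right₀ hn' (by norm_num)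
    have h4 := work_nonneg (n := n) hk0
    have h5 := zero_le_one.trans (one_le_lg (n / η))
    gcongr
  · have hn' : (2 : ℝ) ≤ n := by exact_mod_cast hn
    have hη : 0 < η := lt_of_lt_of_le (by positivity) hηd
    have h₀ : Initial k η (State.init n [k, n, a] [η]) := initial_init rfl rfl rfl
    refine (runsWithin_recoverCmd hη (by omega) (by omega) hk h₀ _).mono ?_
    have hlog : ∀ t : ℕ, 2 ≤ t → 1 ≤ Real.logb 2 t := fun t ht => by
      have : (2 : ℝ) ≤ t := by exact_mod_cast ht
      rw [Real.le_logb_iff_rpow_le (by norm_num) (by positivity)]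
      simpa using this
    have hlk := hlog k hk0
    have hln := hlog n hn
    -- Here `1 / η ≤ n ^ d`. The summand `1` in `d + 1` covers the truncation of `lg` at `1`,
    -- because `log₂ n ≥ 1`.
    have h1 : lg (1 / η) ≤ (d + 1) * Real.logb 2 n := by
      refine (lg_mono (by positivity) (t := (n : ℝ) ^ d) ?_).trans (max_le ?_ ?_)
      · rw [div_le_iff₀ hη, mul_comm]
        exact (div_le_iff₀ (by positivity)).1 hηd
      · have : 0 ≤ d * Real.logb 2 n := by positivity
        linarith
      · rw [Real.logb_pow]
        linarith
    -- From `n ^ 2 ≤ k / δ` and `log₂ k ≥ 1`.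
    have h2 : (k : ℝ) * Real.logb 2 k + n ^ 2 ≤ (1 + 1 / δ) * (k * Real.logb 2 k) := by
      have h3 : (n : ℝ) ^ 2 ≤ 1 / δ * k := by
        rw [one_div, ← div_eq_inv_mul, le_div_iff₀ hδ, mul_comm]
        exact hkδ
      have h4 : 1 / δ * k ≤ 1 / δ * (k * Real.logb 2 k) :=
        mul_le_mul_of_nonneg_left (le_mul_of_one_le_right (by positivity) hlk) (by positivity)
      linarith
    have h3 : (n : ℝ) ^ 2 ≤ n ^ 3 := pow_le_pow_right₀ (by linarith) (by norm_num)
    have h4 := work_nonneg (n := n) (k := k) (by omega)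
    calc 10 ^ 8 * (lg (1 / η) * (k * Real.logb 2 k + (n : ℝ) ^ 2) * (n : ℝ) ^ 2)
        ≤ 10 ^ 8 * ((d + 1) * Real.logb 2 n * ((1 + 1 / δ) * (k * Real.logb 2 k)) *
          (n : ℝ) ^ 3) := by gcongr
      _ = _ := by ring
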